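/- **Setting.** Let $e_j$ ($j\ge 0$) be the normalized eigenvectors of $\Delta=1+t^2-d^2/dt^2$ on $L^2(\mathbb R)$, with eigenvalues $\mu_j=2j+2$. For $f=\sum_j\lambda_je_j$ (complex coefficients) and $k\in\mathbb R$ put $\|f\|_k^2=\sum_j|\lambda_j|^2\mu_j^{2k}$, let $H_{\infty-}=\bigcap_{k\ge 0}\{f:\|f\|_k<\infty\}$, and for $\xi=\sum\xi_je_j,\ \eta=\sum\eta_je_j\in H_{\infty-}$ let $\langle\xi,\eta\rangle_0=\sum_j\xi_j\eta_j$. For a multi-index $A=(r_j)_{j\ge0}\in\mathbb N^{(\mathbb N)}$ (finitely many $r_j\ne0$) let $|A|=\sum_jr_j$, $\|A\|=\prod_j\mu_j^{r_j}$, and let $e_A$ be the symmetric tensor product of the $e_j^{\otimes r_j}$, normalized to be a unit vector. For $\phi=\sum_A\lambda_Ae_A$ and $k,C>0$ put $\|\phi\|_{k,C}^2=\sum_A|\lambda_A|^2C^{2|A|}\|A\|^{2k}|A|!$, and let $W_{\infty-}$ be the space of all $\phi$ for which all these norms are finite. Let $\langle\phi,\psi\rangle_0=\sum_A\lambda_A(\phi)\lambda_A(\psi)|A|!$,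 and $\phi_\xi=\sum_m\xi^{\otimes m}/m!\in W_{\infty-}$ for $\xi\in H_{\infty-}$. For $n\in\mathbb N$, $L(W_{\infty-}^n,W_{\infty-})$ is the space of $n$-multilinear maps $\Xi:W_{\infty-}^n\to W_{\infty-}$ such that for all $k,C>0$ there are $k_2,C_2,K_2>0$ with $\|\Xi(\phi^1,\dots,\phi^n)\|_{k,C}\le K_2\prod_i\|\phi^i\|_{k_2,C_2}$. The symbol of $\Xi$ is $\hat\Xi(\xi^1,\dots,\xi^n,\eta)=\langle\Xi(\phi_{\xi^1},\dots,\phi_{\xi^n}),\phi_\eta\rangle_0$. **Theorem.** Let $n\in\mathbb N$. (a) Let $F:H_{\infty-}^n\times H_{\infty-}\to\mathbb C$ satisfy - (O$_1$) for all $\xi_1^i,\xi_2^i,\eta_1,\eta_2\in H_{\infty-}$ the map $(z_1,\dots,z_n,w)\mapsto F(z_1\xi_1^1+\xi_2^1,\dots,z_n\xi_1^n+\xi_2^n,w\eta_1+\eta_2)$ is entire on $\mathbb C^n\times\mathbb C$; - (O$_2$) for all $k,K>0$ there are $C_0$, $k_1>k$ and $K_1>0$ such that, for all $\xi^1,\dots,\xi^n,\eta\in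 H_{\infty-}$, $$|F(\xi^1,\dots,\xi^n,\eta)|^2\le C_0\exp\Big[K_1\sum_{i=1}^n\|\xi^i\|_{k_1}^2+K\|\eta\|_{-k}^2\Big].\qquad(*)$$ Then there is exactly one $\Xi\in L(W_{\infty-}^n,W_{\infty-})$ with $\hat\Xi=F$. (b) The moduli of continuity are controlled by the data in (O$_2$): for all $k,C>0$ there are $k',K>0$ such that for all $k_1>k'$ and $K_1>0$ there are $k_2,C_2,B>0$ for which the following holds. If $\Xi\in L(W_{\infty-}^n,W_{\infty-})$ and $F=\hat\Xi$ satisfies $(*)$, with $k'$ in place of $k$, with this $K$, these $k_1,K_1$ and some $C_0$, then $\|\Xi(\phi^1,\dots,\phi^n)\|_{k,C}^2\le B\,C_0\prod_i\|\phi^i\|_{k_2,C_2}^2$ for all $\phi^i\in W_{\infty-}$. (c) Every $\Xi\in L(W_{\infty-}^n,W_{\infty-})$ has a convergent Fock expansion. Let $\Psi(\xi^1,\dots,\xi^n,\eta)=\exp[-\sum_i\langle\xi^i,\eta\rangle_0]\,\hat\Xi(\xi^1,\dots,\xi^n,\eta)$. For $l\in\mathbb N$ and $M=(m_1,\dots,m_n)\in\mathbb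 N^n$ let $$K_{l,M}\big((\xi^i_a)_{1\le i\le n,\,1\le a\le m_i},(\eta_b)_{1\le b\le l}\big)$$ be $\frac1{l!\,m_1!\cdots m_n!}$ times the mixed partial derivative at $0$, of order one in each of the variables $z^i_a,w_b$, of $\Psi\big(\sum_az^1_a\xi^1_a,\dots,\sum_az^n_a\xi^n_a,\sum_bw_b\eta_b\big)$. Then there are $\Xi_{l,M}\in L(W_{\infty-}^n,W_{\infty-})$ with symbols $$\hat\Xi_{l,M}(\xi^1,\dots,\xi^n,\eta)=K_{l,M}(\xi^1,\dots,\xi^1,\dots,\xi^n,\dots,\xi^n,\eta,\dots,\eta)\exp\Big[\sum_i\langle\xi^i,\eta\rangle_0\Big]$$ ($\xi^i$ taken $m_i$ times, $\eta$ taken $l$ times). Each $\Xi_{l,M}$ is a homogeneous kernel operator: the numbers $\kappa_{I,J}=K_{l,M}(e_J,e_I)$, where $I\in\mathbb N^l$ and $J\in\prod_i\mathbb N^{m_i}$, satisfy that for every $k'>0$ there is $k>0$ with $\sum_{I,J}|\kappa_{I,J}|^2\big(\prod_b\mu_{I_b}\big)^{k'}\big(\prod_{i,a}\mu_{J_{i,a}}\big)^{-k}<\infty$,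 and $\hat\Xi_{l,M}(\xi^1,\dots,\xi^n,\eta)=\sum_{I,J}\kappa_{I,J}\prod_b\eta_{I_b}\prod_{i,a}\xi^i_{J_{i,a}}\,\exp[\sum_i\langle\xi^i,\eta\rangle_0]$. Finally $\Xi=\sum_{l,M}\Xi_{l,M}$, unconditionally in $L(W_{\infty-}^n,W_{\infty-})$: for all $k,C>0$ there are $k_2,C_2>0$ such that the finite partial sums converge to $\Xi$ in the operator norm from $\|\cdot\|_{k_2,C_2}$ (in each argument) to $\|\cdot\|_{k,C}$. -/

import Mathlib

namespace WhiteNoise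

noncomputable section

/-! ### The one-particle spaces

A series `f = ∑ λ_j e_j` in the normalized eigenvectors `e_j` of `1 + t² - d²/dt²` on `L²(ℝ)` is
represented by its sequence of complex coefficients `λ_j`. -/

/-- The eigenvalues `μ_j = 2 j + 2` of the operator `1 + t² - d²/dt²`. -/
def mu (j : ℕ) : ℝ := 2 * (j : ℝ) + 2

lemma mu_pos (j : ℕ) : 0 < mu j := by unfold mu; positivity

/-- The square of the Sobolev norm, `‖f‖_k² = ∑ |λ_j|² μ_j^{2k}`, for a real index `k`. -/
def hNormSq (k : ℝ) (f : ℕ → ℂ) : ℝ := ∑' j, ‖f j‖ ^ 2 * mu j ^ (2 * k)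

lemma summable_sq_add {ι : Type*} {w : ι → ℝ} (hw : ∀ i, 0 ≤ w i) {f g : ι → ℂ}
    (hf : Summable fun i => ‖f i‖ ^ 2 * w i) (hg : Summable fun i => ‖g i‖ ^ 2 * w i) :
    Summable fun i => ‖f i + g i‖ ^ 2 * w i := by
  refine Summable.of_nonneg_of_le (fun i => mul_nonneg (sq_nonneg _) (hw i)) (fun i => ?_)
    ((hf.mul_left 2).add (hg.mul_left 2))
  have h1 := norm_add_le (f i) (g i)
  have h2 : ‖f i + g i‖ ^ 2 ≤ 2 * ‖f i‖ ^ 2 + 2 * ‖g i‖ ^ 2 := by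
    nlinarith [norm_nonneg (f i + g i), norm_nonneg (f i), norm_nonneg (g i),
      sq_nonneg (‖f i‖ - ‖g i‖)]
  nlinarith [mul_le_mul_of_nonneg_right h2 (hw i)]

lemma summable_sq_smul {ι : Type*} {w : ι → ℝ} (c : ℂ) {f : ι → ℂ}
    (hf : Summable fun i => ‖f i‖ ^ 2 * w i) :
    Summable fun i => ‖c * f i‖ ^ 2 * w i := by
  refine (hf.mul_left (‖c‖ ^ 2)).congr (fun i => ?_)
  rw [norm_mul]; ring

/-- The (complexified) test function space `H_{∞-} = ⋂_{k ≥ 0} H_k`. -/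
def TestFun : Submodule ℂ (ℕ → ℂ) where
  carrier := {f | ∀ k : ℝ, 0 ≤ k → Summable fun j => ‖f j‖ ^ 2 * mu j ^ (2 * k)}
  zero_mem' := fun k _ => by simp
  add_mem' := fun {f g} hf hg k hk =>
    summable_sq_add (fun j => Real.rpow_nonneg (mu_pos j).le _) (hf k hk) (hg k hk)
  smul_mem' := fun c f hf k hk => by
    simpa using summable_sq_smul c (hf k hk)

/-- The eigenvector `e_j`, as an element of `H_{∞-}`. -/
def basisFun (j : ℕ) : TestFun :=
  ⟨Pi.single j 1, fun k _ => by
    refine summable_of_ne_finset_zero (s := {j}) (fun i hi => ?_)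
    have : i ≠ j := by simpa using hi
    simp [this]⟩

/-- The complex bilinear pairing `⟨ξ, η⟩_0 = ∑ ξ_j η_j`, the bilinear extension of the inner
product of `L²(ℝ)`. -/
def hPair (ξ η : TestFun) : ℂ := ∑' j, (ξ : ℕ → ℂ) j * (η : ℕ → ℂ) j

/-! ### The weighted Fock spaces

The multi-index `A = ((i_1, r_1), …, (i_n, r_n))` is the finitely supported function `i_j ↦ r_j`.
A series `φ = ∑ λ_A e_A`, where `e_A` is the symmetric tensor product of the `e_{i_j}^{r_j}`
normalized to a unit vector of `H^{⊗|A|}`, is represented by its coefficients. -/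

/-- The Hida weight `‖A‖ = ∏ (2 i_j + 2)^{r_j}`. -/
def hidaWeight (A : ℕ →₀ ℕ) : ℝ := A.prod fun i r => mu i ^ r

/-- The weight of `|λ_A|²` in `‖φ‖_{k,C}²`. The length `|A| = ∑ r_j` is `A.degree`. -/
def fockWeight (k C : ℝ) (A : ℕ →₀ ℕ) : ℝ :=
  C ^ (2 * A.degree) * hidaWeight A ^ (2 * k) * (A.degree.factorial : ℝ)

/-- The norm `‖φ‖_{k,C} = (∑_A |λ_A|² C^{2|A|} ‖A‖^{2k} |A|!)^{1/2}`. -/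
def wNorm (k C : ℝ) (φ : (ℕ →₀ ℕ) → ℂ) : ℝ := √(∑' A, ‖φ A‖ ^ 2 * fockWeight k C A)

lemma hidaWeight_pos (A : ℕ →₀ ℕ) : 0 < hidaWeight A :=
  Finset.prod_pos fun i _ => pow_pos (mu_pos i) _

lemma fockWeight_nonneg (k C : ℝ) (A : ℕ →₀ ℕ) : 0 ≤ fockWeight k C A := by
  unfold fockWeight
  rw [pow_mul]
  have := Real.rpow_nonneg (hidaWeight_pos A).le (2 * k)
  positivity

/-- The Hida test algebra `W_{∞-} = ⋂_{k > 0, C > 0} W_{k,C}`. -/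
def HidaTest : Submodule ℂ ((ℕ →₀ ℕ) → ℂ) where
  carrier := {φ | ∀ k C : ℝ, 0 < k → 0 < C → Summable fun A => ‖φ A‖ ^ 2 * fockWeight k C A}
  zero_mem' := fun k C _ _ => by simp
  add_mem' := fun {f g} hf hg k C hk hC =>
    summable_sq_add (fun A => fockWeight_nonneg k C A) (hf k C hk hC) (hg k C hk hC)
  smul_mem' := fun c f hf k C hk hC => by
    simpa using summable_sq_smul c (hf k C hk hC)

/-- The coefficients of `φ_ξ = ∑_n ξ^{⊗n} / n!`: since `e_A` is a unit vector,
`ξ^{⊗n} = ∑_{|A| = n} (n! / ∏ r_j!)^{1/2} (∏ ξ_{i_j}^{r_j}) e_A`. -/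
def coherentCoeff (ξ : ℕ → ℂ) (A : ℕ →₀ ℕ) : ℂ :=
  ((√(A.multinomial : ℝ) / (A.degree.factorial : ℝ) : ℝ) : ℂ) * A.prod fun i r => ξ i ^ r

lemma summable_finsupp_prod {x : ℕ → ℝ} (hx : ∀ i, 0 ≤ x i) (hs : Summable x)
    {g : ℕ → ℕ → ℝ} (hnn : ∀ i r, 0 ≤ g i r) (h0 : ∀ i, g i 0 = 1)
    (hle : ∀ i R, ∑ r ∈ Finset.range R, g i r ≤ Real.exp (x i)) :
    Summable fun A : ℕ →₀ ℕ => A.prod fun i r => g i r := by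
  classical
  refine summable_of_sum_le (c := Real.exp (∑' i, x i))
    (fun A => Finset.prod_nonneg fun i _ => hnn i _) (fun s => ?_)
  obtain ⟨N, hN⟩ : ∃ N : ℕ, ∀ A ∈ s, A.support ⊆ Finset.range N := by
    obtain ⟨N, hN⟩ := (s.biUnion Finsupp.support).exists_nat_subset_range
    exact ⟨N, fun A hA => (Finset.subset_biUnion_of_mem Finsupp.support hA).trans hN⟩
  obtain ⟨R, hR⟩ : ∃ R : ℕ, ∀ A ∈ s, ∀ i, A i < R := by
    refine ⟨(s.sup fun A => A.degree) + 1, fun A hA i => Nat.lt_succ_of_le ?_⟩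
    exact (Finsupp.le_degree i A).trans (Finset.le_sup (f := fun A : ℕ →₀ ℕ => A.degree) hA)
  have hprod : ∀ A ∈ s, (A.prod fun i r => g i r)
      = ∏ i : Fin N, g i (A i) := fun A hA => by
    rw [Finsupp.prod_of_support_subset A (hN A hA) _ (fun i _ => h0 i),
      Finset.prod_range]
  have hinj : Set.InjOn (fun (A : ℕ →₀ ℕ) (i : Fin N) => A i) s := by
    intro A hA B hB h
    ext i
    by_cases hi : i < N
    · exact congrFun h ⟨i, hi⟩
    · have hA' : A i = 0 := by
        by_contra hne
        exact hi (Finset.mem_range.1 (hN A hA (Finsupp.mem_support_iff.2 hne)))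
      have hB' : B i = 0 := by
        by_contra hne
        exact hi (Finset.mem_range.1 (hN B hB (Finsupp.mem_support_iff.2 hne)))
      rw [hA', hB']
  calc ∑ A ∈ s, A.prod (fun i r => g i r)
      = ∑ A ∈ s, ∏ i : Fin N, g i (A i) := Finset.sum_congr rfl hprod
    _ = ∑ a ∈ s.image (fun (A : ℕ →₀ ℕ) (i : Fin N) => A i),
          ∏ i : Fin N, g i (a i) := by rw [Finset.sum_image hinj]
    _ ≤ ∑ a ∈ Fintype.piFinset (fun _ : Fin N => Finset.range R),
          ∏ i : Fin N, g i (a i) := by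
        refine Finset.sum_le_sum_of_subset_of_nonneg (fun a ha => ?_)
          (fun a _ _ => Finset.prod_nonneg fun i _ => hnn i _)
        obtain ⟨A, hA, rfl⟩ := Finset.mem_image.1 ha
        simpa using fun i : Fin N => hR A hA i
    _ = ∏ i : Fin N, ∑ r ∈ Finset.range R, g i r :=
        (Finset.prod_univ_sum _ _).symm
    _ ≤ ∏ i : Fin N, Real.exp (x i) :=
        Finset.prod_le_prod (fun i _ => Finset.sum_nonneg fun r _ => hnn i r)
          (fun i _ => hle i R)
    _ = Real.exp (∑ i ∈ Finset.range N, x i) := by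
        rw [Finset.sum_range, Real.exp_sum]
    _ ≤ Real.exp (∑' i, x i) :=
        Real.exp_le_exp.2 (hs.sum_le_tsum _ fun i _ => hx i)

lemma summable_prod_pow_div_factorial {x : ℕ → ℝ} (hx : ∀ i, 0 ≤ x i) (hs : Summable x) :
    Summable fun A : ℕ →₀ ℕ => A.prod fun i r => x i ^ r / (r.factorial : ℝ) :=
  summable_finsupp_prod hx hs (g := fun i r => x i ^ r / (r.factorial : ℝ))
    (fun i r => div_nonneg (pow_nonneg (hx i) r) (Nat.cast_nonneg _)) (fun i => by simp)
    (fun i R => Real.sum_le_exp_of_nonneg (hx i) R)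

lemma norm_coherentCoeff_sq_mul (ξ : ℕ → ℂ) (k C : ℝ) (A : ℕ →₀ ℕ) :
    ‖coherentCoeff ξ A‖ ^ 2 * fockWeight k C A
      = A.prod fun i r => (C ^ 2 * (‖ξ i‖ ^ 2 * mu i ^ (2 * k))) ^ r / (r.factorial : ℝ) := by
  have hm : ((A.prod fun _ r => (r.factorial : ℝ)) * (A.multinomial : ℝ)) = (A.degree.factorial : ℝ) := by
    have h := Nat.multinomial_spec A.support A
    rw [← Finsupp.multinomial_eq] at h
    simp only [Finsupp.prod, Finsupp.degree]
    exact_mod_cast h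
  have hw : hidaWeight A ^ (2 * k) = A.prod fun i r => (mu i ^ (2 * k)) ^ r := by
    unfold hidaWeight Finsupp.prod
    rw [← Real.finsetProd_rpow _ _ (fun i _ => (pow_pos (mu_pos i) _).le)]
    refine Finset.prod_congr rfl fun i _ => ?_
    change (mu i ^ A i) ^ (2 * k) = (mu i ^ (2 * k)) ^ A i
    rw [← Real.rpow_natCast, ← Real.rpow_natCast, ← Real.rpow_mul (mu_pos i).le,
      ← Real.rpow_mul (mu_pos i).le, mul_comm]
  have hC : C ^ (2 * A.degree) = A.prod fun _ r => (C ^ 2) ^ r := by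
    rw [pow_mul]
    simp only [Finsupp.prod, Finsupp.degree, Finset.prod_pow_eq_pow_sum]
    rfl
  have hf : (A.prod fun _ r => (r.factorial : ℝ)) ≠ 0 :=
    Finset.prod_ne_zero_iff.2 fun i _ => Nat.cast_ne_zero.2 (Nat.factorial_ne_zero _)
  have hd : (A.degree.factorial : ℝ) ≠ 0 := Nat.cast_ne_zero.2 (Nat.factorial_ne_zero _)
  have hξ : ‖A.prod fun i r => ξ i ^ r‖ ^ 2 = A.prod fun i r => (‖ξ i‖ ^ 2) ^ r := by
    simp only [Finsupp.prod, norm_prod, norm_pow, ← Finset.prod_pow]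
    exact Finset.prod_congr rfl fun i _ => by ring
  have hrhs : (A.prod fun i r => (C ^ 2 * (‖ξ i‖ ^ 2 * mu i ^ (2 * k))) ^ r / (r.factorial : ℝ))
      = (A.prod fun _ r => (C ^ 2) ^ r) * ((A.prod fun i r => (‖ξ i‖ ^ 2) ^ r) *
        (A.prod fun i r => (mu i ^ (2 * k)) ^ r)) / (A.prod fun _ r => (r.factorial : ℝ)) := by
    simp only [Finsupp.prod, mul_pow, Finset.prod_div_distrib, Finset.prod_mul_distrib]
  unfold coherentCoeff fockWeight
  rw [hrhs, norm_mul, mul_pow, hξ, Complex.norm_real, Real.norm_eq_abs, sq_abs, div_pow,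
    Real.sq_sqrt (Nat.cast_nonneg _), ← hC, ← hw, ← hm]
  have hmm : (A.multinomial : ℝ) ≠ 0 := by
    intro h0
    rw [h0, mul_zero] at hm
    exact hd hm.symm
  field_simp

/-- The coherent vector `φ_ξ ∈ W_{∞-}` of `ξ ∈ H_{∞-}`. -/
def coherent (ξ : TestFun) : HidaTest :=
  ⟨coherentCoeff ξ, fun k C hk _ => by
    simp_rw [norm_coherentCoeff_sq_mul]
    refine summable_prod_pow_div_factorial (fun i => ?_) ((ξ.2 k hk.le).mul_left _)
    have := Real.rpow_nonneg (mu_pos i).le (2 * k)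
    positivity⟩

/-- The complex bilinear pairing `⟨φ, ψ⟩_0 = ∑_A λ_A(φ) λ_A(ψ) |A|!`, the bilinear extension of
the inner product of the Fock space `W_0`. -/
def wPair (φ ψ : HidaTest) : ℂ :=
  ∑' A, (φ : (ℕ →₀ ℕ) → ℂ) A * (ψ : (ℕ →₀ ℕ) → ℂ) A * (A.degree.factorial : ℂ)

/-! ### Continuous multilinear operators and their symbols -/

/-- The `n`-multilinear maps from `W_{∞-}^n` to `W_{∞-}`. -/
abbrev MultiOp (n : ℕ) : Type := MultilinearMap ℂ (fun _ : Fin n => HidaTest) HidaTest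

/-- Membership in `L(W_{∞-}^n, W_{∞-})`. -/
def IsContinuousOp {n : ℕ} (X : MultiOp n) : Prop :=
  ∀ k C : ℝ, 0 < k → 0 < C → ∃ k₂ C₂ K₂ : ℝ, 0 < k₂ ∧ 0 < C₂ ∧ 0 < K₂ ∧
    ∀ φ : Fin n → HidaTest, wNorm k C (X φ) ≤ K₂ * ∏ i, wNorm k₂ C₂ (φ i)

/-- The symbol `(ξ¹, …, ξⁿ, η) ↦ ⟨Ξ(φ_{ξ¹}, …, φ_{ξⁿ}), φ_η⟩_0`. -/
def symbol {n : ℕ} (X : MultiOp n) (ξ : Fin n → TestFun) (η : TestFun) : ℂ :=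
  wPair (X fun i => coherent (ξ i)) (coherent η)

/-- Condition `(O₁)`. -/
def IsEntireOnLines {n : ℕ} (F : (Fin n → TestFun) → TestFun → ℂ) : Prop :=
  ∀ (ξ₁ ξ₂ : Fin n → TestFun) (η₁ η₂ : TestFun),
    Differentiable ℂ fun p : (Fin n → ℂ) × ℂ =>
      F (fun i => p.1 i • ξ₁ i + ξ₂ i) (p.2 • η₁ + η₂)

/-- The estimate in `(O₂)` with given constants. -/
def GrowthBound {n : ℕ} (F : (Fin n → TestFun) → TestFun → ℂ) (k K C k₁ K₁ : ℝ) : Prop :=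
  ∀ (ξ : Fin n → TestFun) (η : TestFun),
    ‖F ξ η‖ ^ 2 ≤ C * Real.exp (K₁ * ∑ i, hNormSq k₁ (ξ i) + K * hNormSq (-k) η)

/-- Condition `(O₂)`. -/
def HasGaussianGrowth {n : ℕ} (F : (Fin n → TestFun) → TestFun → ℂ) : Prop :=
  ∀ k K : ℝ, 0 < k → 0 < K → ∃ C k₁ K₁ : ℝ, k < k₁ ∧ 0 < K₁ ∧ GrowthBound F k K C k₁ K₁

/-! ### The Fock expansion -/

/-- `exp(∑_i ⟨ξ^i, η⟩_0)`. -/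
def expPair {n : ℕ} (ξ : Fin n → TestFun) (η : TestFun) : ℂ := Complex.exp (∑ i, hPair (ξ i) η)

/-- `Ψ(ξ¹, …, ξⁿ, η) = exp(-∑_i ⟨ξ^i, η⟩_0) Ξ̂(ξ¹, …, ξⁿ, η)`. -/
def reducedSymbol {n : ℕ} (X : MultiOp n) (ξ : Fin n → TestFun) (η : TestFun) : ℂ :=
  Complex.exp (-∑ i, hPair (ξ i) η) * symbol X ξ η

/-- The mixed partial derivative at the origin, once with respect to every variable. -/
def mixedPartial {ι : Type} [Fintype ι] [DecidableEq ι] (g : (ι → ℂ) → ℂ) : ℂ :=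
  iteratedFDeriv ℂ (Fintype.card ι) g 0 fun a => Pi.single ((Fintype.equivFin ι).symm a) 1

/-- The form `K_{l,M}(ξ_1^1, …, ξ_{m_1}^1, …, ξ_1^n, …, ξ_{m_n}^n, η_1, …, η_l)`, that is,
`1 / (l! m_1! ⋯ m_n!)` times the mixed partial derivative at `0` of
`(z, w) ↦ Ψ(∑_a z_a^1 ξ_a^1, …, ∑_a z_a^n ξ_a^n, ∑_b w_b η_b)`. -/
def fockForm {n : ℕ} (X : MultiOp n) (l : ℕ) (M : Fin n → ℕ)
    (ξ : ∀ i, Fin (M i) → TestFun) (η : Fin l → TestFun) : ℂ :=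
  ((l.factorial : ℂ) * ∏ i, ((M i).factorial : ℂ))⁻¹ *
    mixedPartial fun z : (Σ i, Fin (M i)) ⊕ Fin l → ℂ =>
      reducedSymbol X (fun i => ∑ a, z (Sum.inl ⟨i, a⟩) • ξ i a) (∑ b, z (Sum.inr b) • η b)

/-- Arrays of kernel coefficients `κ_{I,J}`, with `I ∈ ℕ^l` and `J = (J_1, …, J_n)`,
`J_i ∈ ℕ^{m_i}`. -/
abbrev KernelCoeff {n : ℕ} (l : ℕ) (M : Fin n → ℕ) : Type :=
  (Fin l → ℕ) × (∀ i, Fin (M i) → ℕ) → ℂ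

/-- The kernel `∑ κ_{I,J} e_I ⊗ e_J` belongs to (completed) `H_{∞-}^{⊗l} ⊗ H_{-∞}^{⊗(m_1+⋯+m_n)}`:
for every `k'` there is `k` with `∑ |κ_{I,J}|² ‖I‖^{k'} ‖J‖^{-k} < ∞`. -/
def IsRegularKernel {n l : ℕ} {M : Fin n → ℕ} (κ : KernelCoeff l M) : Prop :=
  ∀ k' : ℝ, 0 < k' → ∃ k : ℝ, 0 < k ∧ Summable fun p : (Fin l → ℕ) × (∀ i, Fin (M i) → ℕ) =>
    ‖κ p‖ ^ 2 * (∏ b, mu (p.1 b)) ^ k' * (∏ i, ∏ a, mu (p.2 i a)) ^ (-k)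

/-- `⟨κ, η^{⊗l} ⊗ (ξ¹)^{⊗m_1} ⊗ ⋯ ⊗ (ξⁿ)^{⊗m_n}⟩`. -/
def kernelEval {n l : ℕ} {M : Fin n → ℕ} (κ : KernelCoeff l M)
    (ξ : Fin n → TestFun) (η : TestFun) : ℂ :=
  ∑' p : (Fin l → ℕ) × (∀ i, Fin (M i) → ℕ),
    κ p * (∏ b, (η : ℕ → ℂ) (p.1 b)) * ∏ i, ∏ a, (ξ i : ℕ → ℂ) (p.2 i a)

/-- `X` is the homogeneous kernel operator of order `(l, M)` with kernel `κ`: its symbol is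
`⟨κ, η^{⊗l} ⊗ (ξ¹)^{⊗m_1} ⊗ ⋯ ⊗ (ξⁿ)^{⊗m_n}⟩ exp(∑_i ⟨ξ^i, η⟩_0)`. -/
def IsKernelOp {n l : ℕ} {M : Fin n → ℕ} (X : MultiOp n) (κ : KernelCoeff l M) : Prop :=
  IsContinuousOp X ∧ IsRegularKernel κ ∧
    ∀ ξ η, symbol X ξ η = kernelEval κ ξ η * expPair ξ η

/-- The coefficients of the form `K_{l,M}` in the basis `(e_j)`. -/
def fockKernel {n : ℕ} (X : MultiOp n) (l : ℕ) (M : Fin n → ℕ) : KernelCoeff l M := fun p =>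
  fockForm X l M (fun i a => basisFun (p.2 i a)) (fun b => basisFun (p.1 b))

/-- `Y` is the `(l, M)`-component of `X`: its symbol is
`K_{l,M}(ξ¹, …, ξ¹, …, ξⁿ, …, ξⁿ, η, …, η) exp(∑_i ⟨ξ^i, η⟩_0)`, and it is the kernel operator
whose kernel is `K_{l,M}`. -/
def IsFockComponent {n : ℕ} (X : MultiOp n) (l : ℕ) (M : Fin n → ℕ) (Y : MultiOp n) : Prop :=
  IsKernelOp Y (fockKernel X l M) ∧
    ∀ ξ η, symbol Y ξ η = fockForm X l M (fun i _ => ξ i) (fun _ => η) * expPair ξ η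

/-- Unconditional convergence `∑_j Y_j = X` in `L(W_{∞-}^n, W_{∞-})`: for every `(k, C)` there
is `(k₂, C₂)` for which the finite partial sums converge to `X` in the operator norm from
`‖·‖_{k₂,C₂}` to `‖·‖_{k,C}`. -/
def HasOpSum {n : ℕ} {ι : Type} (Y : ι → MultiOp n) (X : MultiOp n) : Prop :=
  ∀ k C : ℝ, 0 < k → 0 < C → ∃ k₂ C₂ : ℝ, 0 < k₂ ∧ 0 < C₂ ∧ ∀ ε : ℝ, 0 < ε →
    ∃ S₀ : Finset ι, ∀ S : Finset ι, S₀ ⊆ S → ∀ φ : Fin n → HidaTest,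
      wNorm k C ((X - ∑ j ∈ S, Y j) φ) ≤ ε * ∏ i, wNorm k₂ C₂ (φ i)

end

end WhiteNoise

/-!
A tuple `(ξ¹, …, ξⁿ, η)` of test functions is one array `u` with the index set
`Option (Fin n) × ℕ`, and everything is expressed by power series `∑ c_α u^α` in these infinitely
many variables.

*Symbols as power series.* The symbol of an operator with matrix entries `x (A, B)` in the bases
`e_A` is such a power series, whose coefficients are the `x (A, B)` up to explicit factors
(`symbol_opOfMatrix`). With these factors the weighted `ℓ²` norm `∑ |c_α|² α! s^α` of the
coefficients is the Hilbert–Schmidt norm of the operator between weighted Fock spaces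
(`hsTerm_coeffOfMatrix`). The weights are nuclear, `∑_j μ_j^{-2} < ∞`, so every continuous operator
is Hilbert–Schmidt after an increase of the weight of the sources
(`IsContinuousOp.isRegularMatrix`), and conversely the Hilbert–Schmidt norm bounds the operator norm
(`IsContinuousOp.wNorm_sq_le`). Continuous operators thus correspond to the *regular* families of
coefficients.

*From growth to coefficients.* A function with `(O₁)` and `(O₂)` has a Taylor series in any finite
number of coordinates (`IsSeparatelyEntire.exists_powerSeries`). Cauchy's inequality on the polydisc
with radii `ρ_p² = α_p / a_p`, where `a` is the weight in the Gaussian bound, gives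
`|c_α|² α! ≤ C₀ e^{|α|} a^α` (`hsTerm_symbolCoeff_le`), and a shift of the weights makes the
weighted `ℓ²` norm a convergent product, bounded by a constant times `C₀`
(`hsTerm_symbolCoeff_summable`). This yields regularity together with the control of the moduli of
continuity (`IsContinuousOp.wNorm_sq_le_of_growthBound`). The function is the sum of its Taylor
series because it is continuous along truncations of the array (`tendsto_onArrays_truncate`); hence
it is the symbol of an operator. Uniqueness holds because Taylor coefficients, being mixed partial
derivatives, are determined by the function (`symbolCoeff_series`).

*The Fock expansion.* Since `2 |⟨ξ, η⟩_0| ≤ δ ‖η‖_{-k}² + δ⁻¹ ‖ξ‖_k²`, multiplication by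
`exp(±∑_i ⟨ξ^i, η⟩_0)` preserves `(O₁)` and `(O₂)` (`GrowthBound.expTwist`), so `Ψ` is a regular
power series. Its mixed partial derivatives are the polarizations of its homogeneous parts
(`mixedPartial_linearForms`, `wordForm_graded`), and the homogeneous parts, multiplied by
`exp(∑_i ⟨ξ^i, η⟩_0)`, are the symbols of the components. The remainder after a finite partial sum
has the symbol `exp(∑_i ⟨ξ^i, η⟩_0) ∑ c_α u^α`, summed over the `α` of the remaining orders; it
satisfies the growth bound with a fixed set of constants, except that `C₀` is the tail of a
convergent series. By the control of the moduli of continuity the partial sums converge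
(`IsContinuousOp.hasOpSum`).
-/

namespace WhiteNoise

noncomputable section

open Finset Filter Topology

/-! ### Monomials and power series in infinitely many variables -/

section Monomials

variable {ι : Type*}

/-- The monomial `u^α = ∏ u_i^{α_i}`. -/
def monom {R : Type*} [CommMonoid R] (u : ι → R) (α : ι →₀ ℕ) : R := α.prod fun i r => u i ^ r

/-- The multi-index factorial `α! = ∏ α_i!`. -/
def mfac (α : ι →₀ ℕ) : ℝ := α.prod fun _ r => (r.factorial : ℝ)

lemma mfac_pos (α : ι →₀ ℕ) : 0 < mfac α :=
  Finset.prod_pos fun _ _ => Nat.cast_pos.2 (Nat.factorial_pos _)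

lemma monom_mul {R : Type*} [CommMonoid R] (u v : ι → R) (α : ι →₀ ℕ) :
    monom (fun i => u i * v i) α = monom u α * monom v α := by
  simp only [monom, Finsupp.prod, mul_pow, Finset.prod_mul_distrib]

lemma monom_const {R : Type*} [CommMonoid R] (t : R) (α : ι →₀ ℕ) :
    monom (fun _ => t) α = t ^ α.degree := by
  simp only [monom, Finsupp.prod, Finset.prod_pow_eq_pow_sum]; rfl

lemma monom_pow {R : Type*} [CommMonoid R] (u : ι → R) (m : ℕ) (α : ι →₀ ℕ) :
    monom (fun i => u i ^ m) α = monom u α ^ m := by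
  simp only [monom, Finsupp.prod, ← Finset.prod_pow]
  exact Finset.prod_congr rfl fun i _ => by rw [← pow_mul, ← pow_mul, mul_comm]

lemma monom_add {R : Type*} [CommMonoid R] (u : ι → R) (α β : ι →₀ ℕ) :
    monom u (α + β) = monom u α * monom u β := by
  classical
  exact Finsupp.prod_add_index' (fun _ => pow_zero _) (fun _ _ _ => pow_add _ _ _)

lemma monom_inv (u : ι → ℝ) (α : ι →₀ ℕ) : monom (fun i => (u i)⁻¹) α = (monom u α)⁻¹ := by
  simp only [monom, Finsupp.prod, inv_pow, Finset.prod_inv_distrib]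

lemma norm_monom (u : ι → ℂ) (α : ι →₀ ℕ) : ‖monom u α‖ = monom (fun i => ‖u i‖) α := by
  simp only [monom, Finsupp.prod, norm_prod, norm_pow]

lemma monom_nonneg {u : ι → ℝ} (hu : ∀ i, 0 ≤ u i) (α : ι →₀ ℕ) : 0 ≤ monom u α :=
  Finset.prod_nonneg fun i _ => pow_nonneg (hu i) _

lemma monom_pos {u : ι → ℝ} (hu : ∀ i, 0 < u i) (α : ι →₀ ℕ) : 0 < monom u α :=
  Finset.prod_pos fun i _ => pow_pos (hu i) _

lemma monom_le_monom {u v : ι → ℝ} (hu : ∀ i, 0 ≤ u i) (h : ∀ i, u i ≤ v i) (α : ι →₀ ℕ) :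
    monom u α ≤ monom v α :=
  Finset.prod_le_prod (fun i _ => pow_nonneg (hu i) _) fun i _ => pow_le_pow_left₀ (hu i) (h i) _

lemma monom_congr_support {R : Type*} [CommMonoid R] {u v : ι → R} {α : ι →₀ ℕ}
    (h : ∀ i ∈ α.support, u i = v i) : monom u α = monom v α :=
  Finset.prod_congr rfl fun i hi => by simp only [h i hi]

lemma monom_eq_zero {R : Type*} [CommMonoidWithZero R] {u : ι → R} {α : ι →₀ ℕ} {i : ι}
    (hi : i ∈ α.support) (h : u i = 0) : monom u α = 0 :=
  Finset.prod_eq_zero hi (by simp only [h]; exact zero_pow (Finsupp.mem_support_iff.1 hi))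

@[simp] lemma monom_zero_index {R : Type*} [CommMonoid R] (u : ι → R) : monom u 0 = 1 := by
  simp [monom]

lemma monom_single {R : Type*} [CommMonoid R] (u : ι → R) (i : ι) (r : ℕ) :
    monom u (Finsupp.single i r) = u i ^ r := by
  simp [monom]

/-- Partial sums of a product-type family over multi-indices are dominated by the product of the
one-variable sums: if `T` contains the supports of the multi-indices, the product of the sums over
`T` contains each of the terms exactly once. -/
lemma sum_finsupp_prod_le {x : ι → ℝ} (hx : ∀ i, 0 ≤ x i) (hs : Summable x)
    {g : ι → ℕ → ℝ} (hnn : ∀ i r, 0 ≤ g i r) (h0 : ∀ i, g i 0 = 1)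
    (hle : ∀ i R, ∑ r ∈ range R, g i r ≤ Real.exp (x i)) (s : Finset (ι →₀ ℕ)) :
    ∑ A ∈ s, A.prod (fun i r => g i r) ≤ Real.exp (∑' i, x i) := by
  classical
  set T : Finset ι := s.biUnion Finsupp.support with hT
  have hN : ∀ A ∈ s, A.support ⊆ T := fun A hA => Finset.subset_biUnion_of_mem Finsupp.support hA
  obtain ⟨R, hR⟩ : ∃ R : ℕ, ∀ A ∈ s, ∀ i, A i < R := by
    refine ⟨(s.sup fun A => A.degree) + 1, fun A hA i => Nat.lt_succ_of_le ?_⟩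
    exact (Finsupp.le_degree i A).trans (Finset.le_sup (f := fun A : ι →₀ ℕ => A.degree) hA)
  have hprod : ∀ A ∈ s, (A.prod fun i r => g i r) = ∏ i : T, g i (A i) := fun A hA => by
    rw [Finsupp.prod_of_support_subset A (hN A hA) _ (fun i _ => h0 i),
      ← Finset.prod_coe_sort]
  have hinj : Set.InjOn (fun (A : ι →₀ ℕ) (i : T) => A i) s := by
    intro A hA B hB h
    ext i
    by_cases hi : i ∈ T
    · exact congrFun h ⟨i, hi⟩
    · have hA' : A i = 0 := by
        by_contra hne
        exact hi (hN A hA (Finsupp.mem_support_iff.2 hne))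
      have hB' : B i = 0 := by
        by_contra hne
        exact hi (hN B hB (Finsupp.mem_support_iff.2 hne))
      rw [hA', hB']
  calc ∑ A ∈ s, A.prod (fun i r => g i r)
      = ∑ A ∈ s, ∏ i : T, g i (A i) := Finset.sum_congr rfl hprod
    _ = ∑ a ∈ s.image (fun (A : ι →₀ ℕ) (i : T) => A i), ∏ i : T, g i (a i) := by
        rw [Finset.sum_image hinj]
    _ ≤ ∑ a ∈ Fintype.piFinset (fun _ : T => range R), ∏ i : T, g i (a i) := by
        refine Finset.sum_le_sum_of_subset_of_nonneg (fun a ha => ?_)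
          (fun a _ _ => Finset.prod_nonneg fun i _ => hnn i _)
        obtain ⟨A, hA, rfl⟩ := Finset.mem_image.1 ha
        simpa using fun i _ => hR A hA i
    _ = ∏ i : T, ∑ r ∈ range R, g i r := (Finset.prod_univ_sum _ _).symm
    _ ≤ ∏ i : T, Real.exp (x i) :=
        Finset.prod_le_prod (fun i _ => Finset.sum_nonneg fun r _ => hnn i r)
          (fun i _ => hle i R)
    _ = Real.exp (∑ i ∈ T, x i) := by
        rw [Finset.prod_coe_sort T (fun i => Real.exp (x i)), Real.exp_sum]
    _ ≤ Real.exp (∑' i, x i) := Real.exp_le_exp.2 (hs.sum_le_tsum _ fun i _ => hx i)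

lemma sum_geom_le_exp {x : ℝ} (h0 : 0 ≤ x) (h1 : x ≤ 1 / 2) (R : ℕ) :
    ∑ r ∈ range R, x ^ r ≤ Real.exp (2 * x) := by
  have hx : 0 < 1 - x := by linarith
  have h2 : ∑ r ∈ range R, x ^ r ≤ (1 - x)⁻¹ := by
    rw [← tsum_geometric_of_lt_one h0 (by linarith)]
    exact (summable_geometric_of_lt_one h0 (by linarith)).sum_le_tsum _ fun i _ => pow_nonneg h0 i
  refine h2.trans ?_
  have h3 : (1 - x)⁻¹ ≤ 1 + 2 * x := by
    rw [inv_le_iff_one_le_mul₀ hx]; nlinarith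
  linarith [Real.add_one_le_exp (2 * x)]

/-- `∑_α x^α ≤ exp (2 ∑ x_i)` when all `x_i ≤ 1/2`. -/
lemma summable_monom {x : ι → ℝ} (h0 : ∀ i, 0 ≤ x i) (h1 : ∀ i, x i ≤ 1 / 2) (hs : Summable x) :
    Summable (monom x) ∧ ∑' α, monom x α ≤ Real.exp (2 * ∑' i, x i) := by
  have key : ∀ s : Finset (ι →₀ ℕ), ∑ α ∈ s, monom x α ≤ Real.exp (2 * ∑' i, x i) := fun s => by
    rw [← tsum_mul_left]
    exact sum_finsupp_prod_le (g := fun i r => x i ^ r) (fun i => by have := h0 i; positivity)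
      (hs.mul_left 2) (fun i r => pow_nonneg (h0 i) r) (fun i => pow_zero _)
      (fun i R => sum_geom_le_exp (h0 i) (h1 i) R) s
  have hsum := summable_of_sum_le (fun α => monom_nonneg h0 α) key
  exact ⟨hsum, hsum.tsum_le_of_sum_le key⟩

/-- `∑_α x^α / α! ≤ exp (∑ x_i)`. -/
lemma summable_monom_div_mfac {x : ι → ℝ} (h0 : ∀ i, 0 ≤ x i) (hs : Summable x) :
    Summable (fun α => monom x α / mfac α) ∧
      ∑' α, monom x α / mfac α ≤ Real.exp (∑' i, x i) := by
  have key : ∀ s : Finset (ι →₀ ℕ), ∑ α ∈ s, monom x α / mfac α ≤ Real.exp (∑' i, x i) :=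
    fun s => by
    have := sum_finsupp_prod_le (g := fun i r => x i ^ r / (r.factorial : ℝ)) h0 hs
      (fun i r => div_nonneg (pow_nonneg (h0 i) r) (Nat.cast_nonneg _)) (fun i => by simp)
      (fun i R => Real.sum_le_exp_of_nonneg (h0 i) R) s
    refine le_trans (le_of_eq (Finset.sum_congr rfl fun α _ => ?_)) this
    simp only [monom, mfac, Finsupp.prod, Finset.prod_div_distrib]
  have hsum := summable_of_sum_le
    (fun α => div_nonneg (monom_nonneg h0 α) (mfac_pos α).le) key
  exact ⟨hsum, hsum.tsum_le_of_sum_le key⟩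

/-- The Cauchy–Schwarz inequality for sums of products. -/
lemma cauchy_schwarz_tsum {κ : Type*} {a b : κ → ℝ} (ha : ∀ i, 0 ≤ a i) (hb : ∀ i, 0 ≤ b i)
    (hsa : Summable fun i => a i ^ 2) (hsb : Summable fun i => b i ^ 2) :
    Summable (fun i => a i * b i) ∧
      (∑' i, a i * b i) ^ 2 ≤ (∑' i, a i ^ 2) * ∑' i, b i ^ 2 := by
  have hA : 0 ≤ ∑' i, a i ^ 2 := tsum_nonneg fun i => sq_nonneg _
  have hB : 0 ≤ ∑' i, b i ^ 2 := tsum_nonneg fun i => sq_nonneg _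
  have key : ∀ s : Finset κ, ∑ i ∈ s, a i * b i ≤ √((∑' i, a i ^ 2) * ∑' i, b i ^ 2) := by
    intro s
    refine Real.le_sqrt_of_sq_le ((Finset.sum_mul_sq_le_sq_mul_sq s a b).trans ?_)
    exact mul_le_mul (hsa.sum_le_tsum s fun i _ => sq_nonneg _)
      (hsb.sum_le_tsum s fun i _ => sq_nonneg _) (Finset.sum_nonneg fun i _ => sq_nonneg _) hA
  have hs := summable_of_sum_le (fun i => mul_nonneg (ha i) (hb i)) key
  refine ⟨hs, ?_⟩
  have h1 := hs.tsum_le_of_sum_le key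
  calc (∑' i, a i * b i) ^ 2 ≤ √((∑' i, a i ^ 2) * ∑' i, b i ^ 2) ^ 2 :=
        pow_le_pow_left₀ (tsum_nonneg fun i => mul_nonneg (ha i) (hb i)) h1 2
    _ = _ := Real.sq_sqrt (mul_nonneg hA hB)

/-- The weighted `ℓ²` density `|c_α|² α! s^α` of a family of Taylor coefficients. Its sum is the
square of the norm of `∑ c_α u^α` in a Gaussian Bargmann–Fock space. -/
def hsTerm (c : (ι →₀ ℕ) → ℂ) (s : ι → ℝ) (α : ι →₀ ℕ) : ℝ := ‖c α‖ ^ 2 * (mfac α * monom s α)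

lemma hsTerm_nonneg (c : (ι →₀ ℕ) → ℂ) {s : ι → ℝ} (hs : ∀ i, 0 < s i) (α : ι →₀ ℕ) :
    0 ≤ hsTerm c s α := by
  have := mfac_pos α
  have := monom_pos hs α
  unfold hsTerm; positivity

/-- A power series with finite weighted `ℓ²` norm converges absolutely and satisfies the pointwise
Gaussian bound of the corresponding Bargmann–Fock space. -/
lemma summable_powerSeries {c : (ι →₀ ℕ) → ℂ} {s : ι → ℝ} (hs : ∀ i, 0 < s i)
    (hc : Summable (hsTerm c s)) {u : ι → ℝ} (hu0 : ∀ i, 0 ≤ u i)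
    (hu : Summable fun i => u i ^ 2 / s i) :
    Summable (fun α => ‖c α‖ * monom u α) ∧
      (∑' α, ‖c α‖ * monom u α) ^ 2 ≤
        (∑' α, hsTerm c s α) * Real.exp (∑' i, u i ^ 2 / s i) := by
  have hx : ∀ i, 0 ≤ u i ^ 2 / s i := fun i => div_nonneg (sq_nonneg _) (hs i).le
  obtain ⟨h1, h2⟩ := summable_monom_div_mfac hx hu
  have hw : ∀ α : ι →₀ ℕ, 0 < mfac α * monom s α := fun α => mul_pos (mfac_pos α) (monom_pos hs α)
  have ea : ∀ α, (‖c α‖ * √(mfac α * monom s α)) ^ 2 = hsTerm c s α := fun α => by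
    rw [mul_pow, Real.sq_sqrt (hw α).le]; rfl
  have eb : ∀ α, (monom u α / √(mfac α * monom s α)) ^ 2
      = monom (fun i => u i ^ 2 / s i) α / mfac α := fun α => by
    rw [div_pow, Real.sq_sqrt (hw α).le]
    simp only [div_eq_mul_inv, monom_mul, monom_inv, monom_pow, mul_inv]
    ring
  have eab : ∀ α, (‖c α‖ * √(mfac α * monom s α)) * (monom u α / √(mfac α * monom s α))
      = ‖c α‖ * monom u α := fun α => by
    have : √(mfac α * monom s α) ≠ 0 := (Real.sqrt_pos.2 (hw α)).ne'
    field_simp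
  have := cauchy_schwarz_tsum (a := fun α => ‖c α‖ * √(mfac α * monom s α))
    (b := fun α => monom u α / √(mfac α * monom s α)) (fun α => by positivity)
    (fun α => div_nonneg (monom_nonneg hu0 α) (Real.sqrt_nonneg _))
    (by simpa only [ea] using hc) (by simpa only [eb] using h1)
  simp only [ea, eb, eab] at this
  refine ⟨this.1, this.2.trans ?_⟩
  exact mul_le_mul_of_nonneg_left h2 (tsum_nonneg fun α => hsTerm_nonneg c hs α)

end Monomials

/-! ### Words and multi-indices -/

section Words

variable {ι T : Type*} [Fintype T]

/-- The multi-index of a word `f : T → ι`: it counts how often each letter occurs. -/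
def letterCount (f : T → ι) : ι →₀ ℕ := ∑ t, Finsupp.single (f t) 1

lemma degree_letterCount (f : T → ι) : (letterCount f).degree = Fintype.card T := by
  simp [letterCount, map_sum]

lemma monom_letterCount {R : Type*} [CommMonoid R] (u : ι → R) (f : T → ι) :
    monom u (letterCount f) = ∏ t, u (f t) := by
  classical
  unfold letterCount
  induction (univ : Finset T) using Finset.induction_on with
  | empty => simp
  | insert a s ha ih => rw [Finset.sum_insert ha, Finset.prod_insert ha, monom_add, ih,
      monom_single, pow_one]

lemma letterCount_comp_equiv {T' : Type*} [Fintype T'] (e : T' ≃ T) (f : T → ι) :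
    letterCount (f ∘ e) = letterCount f :=
  Fintype.sum_equiv e _ _ fun _ => rfl

lemma mem_support_letterCount (f : T → ι) (t : T) : f t ∈ (letterCount f).support := by
  classical
  rw [Finsupp.mem_support_iff]
  simp only [letterCount, Finsupp.finsetSum_apply]
  refine (Finset.sum_pos' (fun _ _ => Nat.zero_le _) ⟨t, mem_univ t, by simp⟩).ne'

open Classical in
/-- The words with letter count `α`. -/
def words (α : ι →₀ ℕ) : Finset (T → ι) :=
  (Fintype.piFinset fun _ : T => α.support).filter fun f => letterCount f = α

lemma mem_words {α : ι →₀ ℕ} {f : T → ι} : f ∈ words α ↔ letterCount f = α := by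
  classical
  unfold words
  rw [Finset.mem_filter, Fintype.mem_piFinset]
  refine ⟨fun h => h.2, fun h => ⟨fun t => ?_, h⟩⟩
  rw [← h]; exact mem_support_letterCount f t

/-- The number of words with letter count `α` is the multinomial coefficient `|α|! / α!`: compare
the coefficients of two expansions of `(∑ X_i)^m`. -/
lemma card_words {α : ι →₀ ℕ} (hα : α.degree = Fintype.card T) :
    ((words α : Finset (T → ι)).card : ℝ) * mfac α = ((Fintype.card T).factorial : ℝ) := by
  classical
  have hfin : ∀ f : T → ι, ∏ t, (MvPolynomial.X (f t) : MvPolynomial ι ℕ)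
      = MvPolynomial.monomial (letterCount f) 1 := fun f => by
    rw [← monom_letterCount (fun i => (MvPolynomial.X i : MvPolynomial ι ℕ)),
      MvPolynomial.monomial_eq, map_one, one_mul, monom]
  have e1 : (∑ i ∈ α.support, (MvPolynomial.X i : MvPolynomial ι ℕ)) ^ Fintype.card T
      = ∑ f ∈ Fintype.piFinset fun _ : T => α.support, MvPolynomial.monomial (letterCount f) 1 := by
    rw [← Finset.card_univ, ← Finset.prod_const, Finset.prod_univ_sum]
    exact Finset.sum_congr rfl fun f _ => hfin f
  have e2 := Finset.sum_pow_eq_sum_piAntidiag α.support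
    (fun i => (MvPolynomial.X i : MvPolynomial ι ℕ)) (Fintype.card T)
  rw [e1] at e2
  have e3 := congrArg (MvPolynomial.coeff α) e2
  rw [MvPolynomial.coeff_sum, MvPolynomial.coeff_sum] at e3
  have hl : ∑ f ∈ Fintype.piFinset fun _ : T => α.support,
      MvPolynomial.coeff α (MvPolynomial.monomial (letterCount f) (1 : ℕ)) =
        (words α : Finset (T → ι)).card := by
    simp only [MvPolynomial.coeff_monomial, words, Finset.card_filter]
  have hr : ∑ k ∈ α.support.piAntidiag (Fintype.card T), MvPolynomial.coeff α
      ((Nat.multinomial α.support k : MvPolynomial ι ℕ) * ∏ i ∈ α.support, MvPolynomial.X i ^ k i)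
      = Nat.multinomial α.support α := by
    have hk : ∀ k ∈ α.support.piAntidiag (Fintype.card T), MvPolynomial.coeff α
      ((Nat.multinomial α.support k : MvPolynomial ι ℕ) * ∏ i ∈ α.support, MvPolynomial.X i ^ k i)
      = if k = α then Nat.multinomial α.support k else 0 := by
      intro k hk
      obtain ⟨-, h2⟩ := Finset.mem_piAntidiag.1 hk
      have : ∏ i ∈ α.support, (MvPolynomial.X i : MvPolynomial ι ℕ) ^ k i
          = MvPolynomial.monomial (Finsupp.onFinset α.support k h2) 1 := by
        rw [MvPolynomial.monomial_eq, map_one, one_mul,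
          Finsupp.prod_of_support_subset _ Finsupp.support_onFinset_subset _
            (fun i _ => pow_zero _)]
        simp
      rw [this, ← map_natCast (MvPolynomial.C (σ := ι) (R := ℕ)), MvPolynomial.coeff_C_mul,
        MvPolynomial.coeff_monomial]
      have : Finsupp.onFinset α.support k h2 = α ↔ k = α := by
        rw [← DFunLike.coe_fn_eq]; simp
      simp [this]
    rw [Finset.sum_congr rfl hk, Finset.sum_ite_eq', if_pos]
    rw [Finset.mem_piAntidiag]
    exact ⟨hα, fun i hi => Finsupp.mem_support_iff.2 hi⟩
  rw [hl, hr] at e3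
  have e4 := Nat.multinomial_spec α.support α
  rw [e3, ← hα, mfac, Finsupp.prod, mul_comm]
  simp only [Finsupp.degree]
  exact_mod_cast e4

lemma natCard_letterCount_fiber (α : ι →₀ ℕ) :
    (Nat.card {f : T → ι // letterCount f = α} : ℝ)
      = if α.degree = Fintype.card T then ((Fintype.card T).factorial : ℝ) / mfac α else 0 := by
  rw [Nat.subtype_card (words α) fun f => mem_words]
  split_ifs with h
  · rw [eq_div_iff (mfac_pos α).ne', card_words h]
  · have : (words α : Finset (T → ι)) = ∅ := Finset.eq_empty_of_forall_notMem fun f hf => h <| by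
      rw [← mem_words.1 hf, degree_letterCount]
    simp [this]

/-- Sums over words are sums over multi-indices, weighted by multinomial coefficients. -/
lemma summable_words {𝕜 : Type*} [RCLike 𝕜] {h : (ι →₀ ℕ) → 𝕜}
    (hs : Summable fun α => if α.degree = Fintype.card T then ‖h α‖ / mfac α else 0) :
    Summable (fun f : T → ι => h (letterCount f)) ∧
    ∑' f : T → ι, h (letterCount f) = ((Fintype.card T).factorial : 𝕜) *
      ∑' α, if α.degree = Fintype.card T then h α / (mfac α : 𝕜) else 0 := by
  let e := Equiv.sigmaFiberEquiv (letterCount : (T → ι) → ι →₀ ℕ)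
  have hfib : ∀ α : ι →₀ ℕ, Finite {f : T → ι // letterCount f = α} := fun α =>
    Finite.of_injective (β := (words α : Finset (T → ι)))
      (fun f => ⟨f.1, mem_words.2 f.2⟩) fun f g hfg => Subtype.ext (by simpa using hfg)
  have he : ∀ p : Σ α : ι →₀ ℕ, {f : T → ι // letterCount f = α},
      h (letterCount (e p)) = h p.1 := fun p => congrArg h p.2.2
  have hs1 : Summable fun p : Σ α : ι →₀ ℕ, {f : T → ι // letterCount f = α} => ‖h p.1‖ := by
    rw [summable_sigma_of_nonneg fun _ => norm_nonneg _]
    refine ⟨fun α => Summable.of_finite, ?_⟩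
    refine (hs.mul_left ((Fintype.card T).factorial : ℝ)).congr fun α => ?_
    change _ = ∑' _ : {f : T → ι // letterCount f = α}, ‖h α‖
    rw [tsum_const, nsmul_eq_mul, natCard_letterCount_fiber]
    split_ifs <;> ring
  have hs2 : Summable fun p : Σ α : ι →₀ ℕ, {f : T → ι // letterCount f = α} => h p.1 :=
    hs1.of_norm
  have hs3 : Summable (fun f : T → ι => h (letterCount f)) := by
    rw [← e.summable_iff]; exact hs2.congr fun p => (he p).symm
  refine ⟨hs3, ?_⟩
  rw [← e.tsum_eq, tsum_congr he, hs2.tsum_sigma, ← tsum_mul_left]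
  refine tsum_congr fun α => ?_
  change ∑' _ : {f : T → ι // letterCount f = α}, h α = _
  rw [tsum_const, nsmul_eq_mul, ← RCLike.ofReal_natCast, natCard_letterCount_fiber]
  split_ifs
  · push_cast; ring
  · simp

end Words

/-- Grouping an absolutely convergent sum according to the values of a function. -/
lemma hasSum_fiberwise {A B E : Type*} [DecidableEq B] [NormedAddCommGroup E] [CompleteSpace E]
    {f : A → E} (hf : Summable f) (d : A → B) :
    HasSum (fun b => ∑' a, if d a = b then f a else 0) (∑' a, f a) := by
  have h1 := (Equiv.sigmaFiberEquiv d).hasSum_iff.2 hf.hasSum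
  have h2 := h1.sigma fun b => (h1.summable.sigma_factor b).hasSum
  convert h2 using 2 with b
  refine Eq.trans ?_ (tsum_subtype {a | d a = b} f).symm
  exact tsum_congr fun a => by simp [Set.indicator_apply]

/-! ### Power series along finite-dimensional spaces -/

section PowerSeriesOfLinearForms

variable {ι T : Type*} [Fintype T]

/-- The symmetric multilinear form with coefficients `α! c_α`, that is, the polarization of the
homogeneous part of `∑ c_α u^α` multiplied by the factorial of the degree. -/
def wordForm (c : (ι →₀ ℕ) → ℂ) (v : T → ι → ℂ) : ℂ :=
  ∑' f : T → ι, c (letterCount f) * mfac (letterCount f) * ∏ a, v a (f a)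

lemma summable_words_mul {c : (ι →₀ ℕ) → ℂ} {V : ι → ℝ} (hV : ∀ i, 0 ≤ V i)
    (hc : Summable fun α => ‖c α‖ * monom V α) :
    Summable (fun f : T → ι => ‖c (letterCount f)‖ * mfac (letterCount f) * ∏ a, V (f a)) ∧
    ∑' f : T → ι, ‖c (letterCount f)‖ * mfac (letterCount f) * ∏ a, V (f a)
      = (Fintype.card T).factorial *
        ∑' α, if α.degree = Fintype.card T then ‖c α‖ * monom V α else 0 := by
  have := summable_words (T := T) (𝕜 := ℝ) (h := fun α => ‖c α‖ * mfac α * monom V α) ?_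
  · simp only [monom_letterCount] at this
    refine ⟨this.1, this.2.trans ?_⟩
    congr 1
    refine tsum_congr fun α => ?_
    have := (mfac_pos α).ne'
    split_ifs
    · simp only [RCLike.ofReal_real_eq_id, id]; field_simp
    · rfl
  · refine Summable.of_nonneg_of_le (fun α => ?_) (fun α => ?_) hc
    · have := (mfac_pos α).le
      split_ifs <;> positivity
    · have h1 := mfac_pos α
      have h2 := monom_nonneg hV α
      split_ifs
      · rw [norm_mul, norm_mul, norm_norm, Real.norm_of_nonneg h1.le, Real.norm_of_nonneg h2]
        apply le_of_eq; field_simp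
      · positivity

lemma norm_word_term (c : (ι →₀ ℕ) → ℂ) (v : T → ι → ℂ) (f : T → ι) :
    ‖c (letterCount f) * mfac (letterCount f) * ∏ a, v a (f a)‖
      = ‖c (letterCount f)‖ * mfac (letterCount f) * ∏ a, ‖v a (f a)‖ := by
  rw [norm_mul, norm_mul, Complex.norm_real, Real.norm_of_nonneg (mfac_pos _).le, norm_prod]

lemma summable_wordForm {c : (ι →₀ ℕ) → ℂ} {V : ι → ℝ} (hV : ∀ i, 0 ≤ V i)
    (hc : Summable fun α => ‖c α‖ * monom V α) {v : T → ι → ℂ} (hv : ∀ a i, ‖v a i‖ ≤ V i) :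
    Summable fun f : T → ι => c (letterCount f) * mfac (letterCount f) * ∏ a, v a (f a) := by
  refine Summable.of_norm_bounded (summable_words_mul (T := T) hV hc).1 fun f => ?_
  rw [norm_word_term]
  have := mfac_pos (letterCount f)
  gcongr
  exact hv _ _

/-- The homogeneous part of degree `|T|` of a power series, as a sum over words. -/
lemma wordForm_diag {c : (ι →₀ ℕ) → ℂ} {u : ι → ℂ}
    (hc : Summable fun α => ‖c α‖ * monom (fun i => ‖u i‖) α) :
    wordForm c (fun _ : T => u) = (Fintype.card T).factorial *
      ∑' α, if α.degree = Fintype.card T then c α * monom u α else 0 := by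
  have := summable_words (T := T) (𝕜 := ℂ) (h := fun α => c α * mfac α * monom u α) ?_
  · simp only [monom_letterCount] at this
    refine this.2.trans ?_
    congr 1
    refine tsum_congr fun α => ?_
    have : (mfac α : ℂ) ≠ 0 := Complex.ofReal_ne_zero.2 (mfac_pos α).ne'
    split_ifs
    · simp only [Complex.coe_algebraMap]; field_simp
    · rfl
  · refine Summable.of_nonneg_of_le (fun α => ?_) (fun α => ?_) hc
    · have := (mfac_pos α).le
      split_ifs <;> positivity
    · have h1 := mfac_pos α
      split_ifs
      · rw [norm_mul, norm_mul, Complex.norm_real, Real.norm_of_nonneg h1.le, norm_monom]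
        apply le_of_eq; field_simp
      · exact mul_nonneg (norm_nonneg _) (monom_nonneg (fun _ => norm_nonneg _) α)

lemma wordForm_comp_equiv {T' : Type*} [Fintype T'] (e : T' ≃ T) (c : (ι →₀ ℕ) → ℂ)
    (v : T → ι → ℂ) : wordForm c (fun t => v (e t)) = wordForm c v := by
  unfold wordForm
  rw [← (e.arrowCongr (Equiv.refl ι)).symm.tsum_eq]
  refine tsum_congr fun f => ?_
  have : (e.arrowCongr (Equiv.refl ι)).symm f = f ∘ e := by ext; simp
  rw [this, letterCount_comp_equiv]
  congr 1
  exact e.prod_comp fun a => v a (f a)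

variable (c : (ι →₀ ℕ) → ℂ) (v : T → ι → ℂ)

/-- The Taylor series at the origin of `z ↦ ∑_α c_α (∑_a z_a v_a)^α`. -/
def linearFormSeries : FormalMultilinearSeries ℂ (T → ℂ) ℂ := fun m =>
  ∑ g : Fin m → T, (wordForm c (fun j => v (g j)) / (m.factorial : ℂ)) •
    (ContinuousMultilinearMap.mkPiAlgebra ℂ (Fin m) ℂ).compContinuousLinearMap
      fun j => ContinuousLinearMap.proj (g j)

lemma linearFormSeries_apply (m : ℕ) (w : Fin m → T → ℂ) :
    linearFormSeries c v m w =
      ∑ g : Fin m → T, wordForm c (fun j => v (g j)) / (m.factorial : ℂ) * ∏ j, w j (g j) := by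
  simp [linearFormSeries]

variable {c v}

lemma norm_sum_smul_le (z : T → ℂ) (v : T → ι → ℂ) (i : ι) :
    ‖∑ a, z a * v a i‖ ≤ ‖z‖ * ∑ a, ‖v a i‖ := by
  rw [Finset.mul_sum]
  refine (norm_sum_le _ _).trans (Finset.sum_le_sum fun a _ => ?_)
  rw [norm_mul]
  exact mul_le_mul_of_nonneg_right (norm_le_pi_norm z a) (norm_nonneg _)

lemma summable_linearForms
    (hc : ∀ R : ℝ, 0 ≤ R → Summable fun α => ‖c α‖ * monom (fun i => R * ∑ a, ‖v a i‖) α)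
    (z : T → ℂ) : Summable fun α => ‖c α‖ * monom (fun i => ‖∑ a, z a * v a i‖) α :=
  Summable.of_nonneg_of_le
    (fun α => mul_nonneg (norm_nonneg _) (monom_nonneg (fun _ => norm_nonneg _) α))
    (fun α => mul_le_mul_of_nonneg_left
      (monom_le_monom (fun _ => norm_nonneg _) (norm_sum_smul_le z v) α) (norm_nonneg _))
    (hc ‖z‖ (norm_nonneg _))

lemma norm_linearFormSeries_le
    (hc : ∀ R : ℝ, 0 ≤ R → Summable fun α => ‖c α‖ * monom (fun i => R * ∑ a, ‖v a i‖) α) (m : ℕ) :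
    ‖linearFormSeries c v m‖ ≤
      ∑' α, if α.degree = m then ‖c α‖ * monom (fun i => ∑ a, ‖v a i‖) α else 0 := by
  have hc1 := hc 1 zero_le_one
  simp only [one_mul] at hc1
  have hV : ∀ i, 0 ≤ ∑ a, ‖v a i‖ := fun i => Finset.sum_nonneg fun a _ => norm_nonneg _
  have hv : ∀ a i, ‖v a i‖ ≤ ∑ a, ‖v a i‖ := fun a i =>
    Finset.single_le_sum (f := fun a => ‖v a i‖) (fun _ _ => norm_nonneg _) (mem_univ a)
  have hm : (0 : ℝ) < m.factorial := Nat.cast_pos.2 m.factorial_pos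
  have h1 : ‖linearFormSeries c v m‖ ≤
      ∑ g : Fin m → T, ‖wordForm c (fun j => v (g j))‖ / (m.factorial : ℝ) := by
    refine ContinuousMultilinearMap.opNorm_le_bound (by positivity) fun w => ?_
    rw [linearFormSeries_apply, Finset.sum_mul]
    refine (norm_sum_le _ _).trans (Finset.sum_le_sum fun g _ => ?_)
    rw [norm_mul, norm_div, Complex.norm_natCast, norm_prod]
    gcongr with j
    exact norm_le_pi_norm (w j) (g j)
  have hsum : ∀ g : Fin m → T, Summable fun f : Fin m → ι =>
      ‖c (letterCount f)‖ * mfac (letterCount f) * ∏ j, ‖v (g j) (f j)‖ := fun g => by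
    have := (summable_wordForm hV hc1 (v := fun j => v (g j)) fun j i => hv _ i).norm
    exact this.congr fun f => norm_word_term c (fun j => v (g j)) f
  have h2 : ∑ g : Fin m → T, ‖wordForm c (fun j => v (g j))‖ ≤
      ∑' f : Fin m → ι, ‖c (letterCount f)‖ * mfac (letterCount f) *
        ∏ j, ∑ a, ‖v a (f j)‖ := by
    calc ∑ g : Fin m → T, ‖wordForm c (fun j => v (g j))‖
        ≤ ∑ g : Fin m → T, ∑' f : Fin m → ι,
          ‖c (letterCount f)‖ * mfac (letterCount f) * ∏ j, ‖v (g j) (f j)‖ := by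
          refine Finset.sum_le_sum fun g _ => ?_
          unfold wordForm
          refine (norm_tsum_le_tsum_norm ?_).trans (le_of_eq (tsum_congr fun f => ?_))
          · exact (summable_wordForm hV hc1 (v := fun j => v (g j)) fun j i => hv _ i).norm
          · exact norm_word_term c (fun j => v (g j)) f
      _ = _ := by
          rw [← Summable.tsum_finsetSum fun g _ => hsum g]
          refine tsum_congr fun f => ?_
          rw [← Finset.mul_sum, Finset.prod_univ_sum]
          simp
  have h3 := (summable_words_mul (T := Fin m) hV hc1).2
  rw [Fintype.card_fin] at h3
  rw [h3] at h2
  refine h1.trans ?_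
  rw [← Finset.sum_div, div_le_iff₀ hm, mul_comm]
  exact h2

lemma linearFormSeries_diag
    (hc : ∀ R : ℝ, 0 ≤ R → Summable fun α => ‖c α‖ * monom (fun i => R * ∑ a, ‖v a i‖) α)
    (m : ℕ) (z : T → ℂ) :
    linearFormSeries c v m (fun _ => z) =
      ∑' α, if α.degree = m then c α * monom (fun i => ∑ a, z a * v a i) α else 0 := by
  have hc1 := hc 1 zero_le_one
  simp only [one_mul] at hc1
  have hV : ∀ i, 0 ≤ ∑ a, ‖v a i‖ := fun i => Finset.sum_nonneg fun a _ => norm_nonneg _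
  have hv : ∀ a i, ‖v a i‖ ≤ ∑ a, ‖v a i‖ := fun a i =>
    Finset.single_le_sum (f := fun a => ‖v a i‖) (fun _ _ => norm_nonneg _) (mem_univ a)
  have hm : (m.factorial : ℂ) ≠ 0 := Nat.cast_ne_zero.2 m.factorial_ne_zero
  have h1 := wordForm_diag (T := Fin m) (summable_linearForms hc z)
  rw [Fintype.card_fin] at h1
  rw [linearFormSeries_apply, ← mul_right_inj' hm, ← h1, Finset.mul_sum]
  have hsum : ∀ g : Fin m → T, Summable fun f : Fin m → ι =>
      (c (letterCount f) * mfac (letterCount f) * ∏ j, v (g j) (f j)) * ∏ j, z (g j) := fun g => by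
    have := summable_wordForm hV hc1 (v := fun j => v (g j)) fun j i => hv _ i
    exact this.mul_right _
  unfold wordForm
  calc _ = ∑ g : Fin m → T, ∑' f : Fin m → ι,
        (c (letterCount f) * mfac (letterCount f) * ∏ j, v (g j) (f j)) * ∏ j, z (g j) := by
        refine Finset.sum_congr rfl fun g _ => ?_
        rw [tsum_mul_right]; field_simp
    _ = _ := by
        rw [← Summable.tsum_finsetSum fun g _ => hsum g]
        refine tsum_congr fun f => ?_
        rw [Finset.prod_univ_sum, Finset.mul_sum]
        simp only [Fintype.piFinset_univ]
        refine Finset.sum_congr rfl fun g _ => ?_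
        rw [Finset.prod_mul_distrib]; ring

/-- A power series, restricted to a finite-dimensional space along which it converges absolutely,
is an entire function with an explicit Taylor series. -/
theorem hasFPowerSeriesOnBall_linearForms
    (hc : ∀ R : ℝ, 0 ≤ R → Summable fun α => ‖c α‖ * monom (fun i => R * ∑ a, ‖v a i‖) α) :
    HasFPowerSeriesOnBall (fun z : T → ℂ => ∑' α, c α * monom (fun i => ∑ a, z a * v a i) α)
      (linearFormSeries c v) 0 ⊤ := by
  have hV : ∀ i, 0 ≤ ∑ a, ‖v a i‖ := fun i => Finset.sum_nonneg fun a _ => norm_nonneg _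
  refine ⟨?_, ENNReal.zero_lt_top, fun {z} _ => ?_⟩
  · rw [top_le_iff]
    refine ENNReal.eq_top_of_forall_nnreal_le fun r => ?_
    refine FormalMultilinearSeries.le_radius_of_bound _
      (∑' α, ‖c α‖ * monom (fun i => r * ∑ a, ‖v a i‖) α) fun m => ?_
    calc _ ≤ (∑' α, if α.degree = m then ‖c α‖ * monom (fun i => ∑ a, ‖v a i‖) α else 0)
          * (r : ℝ) ^ m := by
          gcongr
          exact norm_linearFormSeries_le hc m
      _ ≤ _ := by
          rw [← tsum_mul_right]
          have hle : ∀ α : ι →₀ ℕ, (if α.degree = m then ‖c α‖ * monom (fun i => ∑ a, ‖v a i‖) α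
              else 0) * (r : ℝ) ^ m ≤ ‖c α‖ * monom (fun i => r * ∑ a, ‖v a i‖) α := fun α => by
            rw [monom_mul, monom_const]
            have := monom_nonneg hV α
            split_ifs with h
            · rw [h]; apply le_of_eq; ring
            · rw [zero_mul]; positivity
          refine Summable.tsum_le_tsum hle (Summable.of_nonneg_of_le (fun α => ?_) hle
            (hc r r.2)) (hc r r.2)
          have := monom_nonneg hV α
          split_ifs <;> positivity
  · simp only [zero_add, linearFormSeries_diag hc]
    have hs : Summable fun α => c α * monom (fun i => ∑ a, z a * v a i) α :=
      Summable.of_norm_bounded (summable_linearForms hc z) fun α => by rw [norm_mul, norm_monom]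
    exact hasSum_fiberwise hs Finsupp.degree

theorem differentiable_linearForms
    (hc : ∀ R : ℝ, 0 ≤ R → Summable fun α => ‖c α‖ * monom (fun i => R * ∑ a, ‖v a i‖) α) :
    Differentiable ℂ fun z : T → ℂ => ∑' α, c α * monom (fun i => ∑ a, z a * v a i) α := by
  have := (hasFPowerSeriesOnBall_linearForms hc).differentiableOn
  rwa [Metric.eball_top, differentiableOn_univ] at this

end PowerSeriesOfLinearForms

/-- The mixed partial derivative of `z ↦ ∑_α c_α (∑_a z_a v_a)^α` at the origin. -/
theorem mixedPartial_linearForms {ι : Type*} {T : Type} [Fintype T] [DecidableEq T]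
    {c : (ι →₀ ℕ) → ℂ} {v : T → ι → ℂ}
    (hc : ∀ R : ℝ, 0 ≤ R → Summable fun α => ‖c α‖ * monom (fun i => R * ∑ a, ‖v a i‖) α) :
    mixedPartial (fun z : T → ℂ => ∑' α, c α * monom (fun i => ∑ a, z a * v a i) α)
      = wordForm c v := by
  unfold mixedPartial
  rw [(hasFPowerSeriesOnBall_linearForms hc).iteratedFDeriv_eq_sum_of_completeSpace]
  set τ := (Fintype.equivFin T).symm with hτ
  have h1 : ∀ σ : Equiv.Perm (Fin (Fintype.card T)),
      linearFormSeries c v (Fintype.card T) (fun i => Pi.single (τ (σ i)) 1)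
        = wordForm c v / ((Fintype.card T).factorial : ℂ) := fun σ => by
    rw [linearFormSeries_apply, Finset.sum_eq_single (fun j => τ (σ j))]
    · simp only [Pi.single_eq_same, Finset.prod_const_one, mul_one]
      have := wordForm_comp_equiv (σ.trans τ) c v
      simp only [Equiv.trans_apply] at this
      rw [this]
    · intro g _ hg
      obtain ⟨j, hj⟩ : ∃ j, g j ≠ τ (σ j) := by
        by_contra! h; exact hg (funext h)
      rw [Finset.prod_eq_zero (mem_univ j) (Pi.single_eq_of_ne hj _), mul_zero]
    · simp
  simp only [h1, Finset.sum_const, Finset.card_univ, Fintype.card_perm, Fintype.card_fin,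
    nsmul_eq_mul]
  have hm : ((Fintype.card T).factorial : ℂ) ≠ 0 := Nat.cast_ne_zero.2 (Nat.factorial_ne_zero _)
  field_simp

/-! ### Separately entire functions of finitely many variables -/

section SeparatelyEntire

open Metric

/-- The difference quotients of an entire function converge to the derivative at a rate that only
depends on a local bound of the function. -/
lemma norm_dslope_sub_deriv_le {f : ℂ → ℂ} (hf : Differentiable ℂ f) {ζ : ℂ} {M : ℝ}
    (hM : ∀ z, ‖z - ζ‖ < 2 → ‖f z‖ ≤ M) {z : ℂ} (hz : ‖z - ζ‖ < 2) :
    ‖dslope f ζ z - deriv f ζ‖ ≤ M * ‖z - ζ‖ := by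
  -- The Schwarz lemma for `f` bounds the difference quotient on the disc; the Schwarz lemma for
  -- the difference quotient then bounds its oscillation.
  have hg : DifferentiableOn ℂ (dslope f ζ) (ball ζ 2) :=
    (Complex.differentiableOn_dslope (ball_mem_nhds ζ two_pos)).2 hf.differentiableOn
  have hζ : ‖f ζ‖ ≤ M := hM ζ (by simp)
  have h1 : ∀ w ∈ ball ζ 2, ‖dslope f ζ w‖ ≤ M := fun w hw => by
    have := Complex.norm_dslope_le_div_of_mapsTo_ball (f := f) (c := ζ) (R₁ := 2) (R₂ := 2 * M)
      hf.differentiableOn (fun w hw => ?_) hw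
    · simpa using this
    · rw [mem_closedBall, dist_eq_norm]
      have := hM w (by simpa [dist_eq_norm] using hw)
      linarith [norm_sub_le (f w) (f ζ)]
  have h2 := Complex.dist_le_div_mul_dist_of_mapsTo_ball (f := dslope f ζ) (c := ζ) (z := z)
    (R₁ := 2) (R₂ := 2 * M) hg (fun w hw => ?_) (by simpa [dist_eq_norm] using hz)
  · rwa [dslope_same, dist_eq_norm, dist_eq_norm, mul_div_cancel_left₀ _ two_ne_zero] at h2
  · rw [mem_closedBall, dist_eq_norm]
    linarith [norm_sub_le (dslope f ζ w) (dslope f ζ ζ), h1 w hw, h1 ζ (mem_ball_self two_pos)]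

/-- Differentiation in the second variable preserves the class of locally bounded, separately entire
functions of two variables: the difference quotients in the second variable converge uniformly in
the first. -/
lemma separatelyEntire_deriv {p : ℂ → ℂ → ℂ} (h1 : ∀ t, Differentiable ℂ (p t))
    (h2 : ∀ ζ, Differentiable ℂ fun t => p t ζ)
    (hb : ∀ R : ℝ, ∃ M, ∀ t ζ, ‖t‖ ≤ R → ‖ζ‖ ≤ R → ‖p t ζ‖ ≤ M) :
    (∀ t, Differentiable ℂ (deriv (p t))) ∧ (∀ ζ, Differentiable ℂ fun t => deriv (p t) ζ) ∧
      ∀ R : ℝ, ∃ M, ∀ t ζ, ‖t‖ ≤ R → ‖ζ‖ ≤ R → ‖deriv (p t) ζ‖ ≤ M := by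
  refine ⟨fun t => ?_, fun ζ => ?_, fun R => ?_⟩
  · exact fun z => ((h1 t).analyticAt z).deriv.differentiableAt
  · have key : ∀ R : ℝ, DifferentiableOn ℂ (fun t => deriv (p t) ζ) (ball 0 R) := by
      intro R
      obtain ⟨M, hM⟩ := hb (max R (‖ζ‖ + 2))
      have hlim : TendstoUniformlyOn (fun h t => dslope (p t) ζ (ζ + h))
          (fun t => deriv (p t) ζ) (𝓝[≠] (0 : ℂ)) (ball 0 R) := by
        rw [Metric.tendstoUniformlyOn_iff]
        intro ε hε
        have hn : ∀ᶠ h : ℂ in 𝓝[≠] (0 : ℂ), ‖h‖ < min 2 (ε / (|M| + 1)) := by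
          refine eventually_nhdsWithin_of_eventually_nhds ?_
          have := ball_mem_nhds (0 : ℂ) (ε := min 2 (ε / (|M| + 1))) (by positivity)
          filter_upwards [this] with h hh
          simpa [dist_eq_norm] using hh
        filter_upwards [hn] with h hh t ht
        rw [dist_comm, dist_eq_norm]
        have hh1 := lt_of_lt_of_le hh (min_le_left _ _)
        have hh2 := lt_of_lt_of_le hh (min_le_right _ _)
        have := norm_dslope_sub_deriv_le (h1 t) (ζ := ζ) (M := M) (z := ζ + h) (fun z hz => ?_)
          (by simpa using hh1)
        · refine this.trans_lt ?_
          rw [add_sub_cancel_left]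
          rw [lt_div_iff₀ (by positivity)] at hh2
          nlinarith [le_abs_self M, norm_nonneg h]
        · refine hM t z (le_max_of_le_left ?_) (le_max_of_le_right ?_)
          · simpa using (mem_ball_zero_iff.1 ht).le
          · have := norm_add_le ζ (z - ζ)
            rw [add_sub_cancel] at this
            linarith
      refine hlim.tendstoLocallyUniformlyOn.differentiableOn ?_ isOpen_ball
      filter_upwards [self_mem_nhdsWithin] with h hh
      have hne : ζ + h ≠ ζ := by simpa using hh
      simp only [dslope_of_ne _ hne, slope_def_module]
      exact Differentiable.differentiableOn (((h2 (ζ + h)).sub (h2 ζ)).const_smul (ζ + h - ζ)⁻¹)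
    intro t
    exact (key (‖t‖ + 1)).differentiableAt (isOpen_ball.mem_nhds (by simp))
  · obtain ⟨M, hM⟩ := hb (R + 1)
    refine ⟨M, fun t ζ ht hζ => ?_⟩
    have := Complex.norm_deriv_le_of_forall_mem_sphere_norm_le (c := ζ) (R := 1) (C := M)
      (f := p t) one_pos (h1 t).diffContOnCl fun z hz => ?_
    · simpa using this
    · refine hM t z (by linarith) ?_
      rw [mem_sphere_iff_norm] at hz
      have := norm_add_le ζ (z - ζ)
      rw [add_sub_cancel] at this
      linarith

lemma separatelyEntire_iteratedDeriv (r : ℕ) {p : ℂ → ℂ → ℂ} (h1 : ∀ t, Differentiable ℂ (p t))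
    (h2 : ∀ ζ, Differentiable ℂ fun t => p t ζ)
    (hb : ∀ R : ℝ, ∃ M, ∀ t ζ, ‖t‖ ≤ R → ‖ζ‖ ≤ R → ‖p t ζ‖ ≤ M) (ζ : ℂ) :
    Differentiable ℂ fun t => iteratedDeriv r (p t) ζ := by
  induction r generalizing p with
  | zero => simpa using h2 ζ
  | succ r ih =>
    obtain ⟨h1', h2', hb'⟩ := separatelyEntire_deriv h1 h2 hb
    simpa only [iteratedDeriv_succ'] using ih h1' h2' hb'

variable {ι : Type*}

/-- Functions of finitely many among arbitrarily many complex variables which are entire in each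
variable and bounded on polydiscs. -/
structure IsSeparatelyEntire (G : (ι →₀ ℂ) → ℂ) : Prop where
  differentiable : ∀ u j, Differentiable ℂ fun t : ℂ => G (u + Finsupp.single j t)
  bounded : ∀ (S : Finset ι) (R : ℝ), ∃ M, ∀ u : ι →₀ ℂ, u.support ⊆ S → (∀ i, ‖u i‖ ≤ R) →
    ‖G u‖ ≤ M

/-- The `r`-th Taylor coefficient in the direction of the `j`-th variable. -/
def coordCoeff (j : ι) (r : ℕ) (G : (ι →₀ ℂ) → ℂ) (u : ι →₀ ℂ) : ℂ :=
  (r.factorial : ℂ)⁻¹ * iteratedDeriv r (fun t : ℂ => G (u + Finsupp.single j t)) 0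

lemma norm_coordCoeff_le {G : (ι →₀ ℂ) → ℂ} (hG : IsSeparatelyEntire G) (j : ι) (r : ℕ)
    (u : ι →₀ ℂ) {ρ M : ℝ} (hρ : 0 < ρ)
    (hM : ∀ t : ℂ, ‖t‖ = ρ → ‖G (u + Finsupp.single j t)‖ ≤ M) :
    ‖coordCoeff j r G u‖ ≤ M / ρ ^ r := by
  have h := Complex.norm_iteratedDeriv_le_of_forall_mem_sphere_norm_le r hρ
    (hG.differentiable u j).diffContOnCl (c := 0) (C := M) fun z hz => hM z (by simpa using hz)
  have hr : (0 : ℝ) < r.factorial := Nat.cast_pos.2 r.factorial_pos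
  rw [coordCoeff, norm_mul, norm_inv, Complex.norm_natCast, inv_mul_le_iff₀ hr]
  rwa [mul_div_assoc] at h

lemma norm_single_apply_le (j i : ι) (t : ℂ) : ‖Finsupp.single j t i‖ ≤ ‖t‖ := by
  classical
  rw [Finsupp.single_apply]; split_ifs <;> simp

lemma support_add_single_subset [DecidableEq ι] {S : Finset ι} {u : ι →₀ ℂ} (hu : u.support ⊆ S)
    (j : ι) (t : ℂ) : (u + Finsupp.single j t).support ⊆ insert j S := by
  refine Finsupp.support_add.trans (Finset.union_subset (hu.trans (Finset.subset_insert _ _)) ?_)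
  exact Finsupp.support_single_subset.trans (by simp)

lemma isSeparatelyEntire_coordCoeff {G : (ι →₀ ℂ) → ℂ} (hG : IsSeparatelyEntire G) (j : ι) (r : ℕ) :
    IsSeparatelyEntire (coordCoeff j r G) := by
  classical
  refine ⟨fun u i => ?_, fun S R => ?_⟩
  · refine Differentiable.const_mul ?_ _
    refine separatelyEntire_iteratedDeriv r
      (p := fun s t => G (u + Finsupp.single i s + Finsupp.single j t)) (fun s => ?_) (fun t => ?_)
      (fun R => ?_) 0
    · exact hG.differentiable _ _
    · simp only [add_right_comm u]
      exact hG.differentiable _ _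
    · obtain ⟨M, hM⟩ := hG.bounded (insert j (insert i u.support))
        ((∑ k ∈ u.support, ‖u k‖) + R + R)
      refine ⟨M, fun s t hs ht => hM _ ?_ fun k => ?_⟩
      · exact support_add_single_subset (support_add_single_subset le_rfl _ _) _ _
      · have h1 : ‖u k‖ ≤ ∑ k ∈ u.support, ‖u k‖ := by
          by_cases hk : k ∈ u.support
          · exact Finset.single_le_sum (f := fun k => ‖u k‖) (fun _ _ => norm_nonneg _) hk
          · rw [Finsupp.notMem_support_iff.1 hk, norm_zero]
            exact Finset.sum_nonneg fun _ _ => norm_nonneg _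
        simp only [Finsupp.add_apply]
        refine (norm_add_le _ _).trans (add_le_add ((norm_add_le _ _).trans (add_le_add h1 ?_)) ?_)
        · exact (norm_single_apply_le _ _ _).trans hs
        · exact (norm_single_apply_le _ _ _).trans ht
  · obtain ⟨M, hM⟩ := hG.bounded (insert j S) (R + 1)
    refine ⟨M, fun u hu hR => ?_⟩
    have := norm_coordCoeff_le hG j r u one_pos (M := M) fun t ht => hM _ ?_ fun k => ?_
    · simpa using this
    · exact support_add_single_subset hu _ _
    · rw [Finsupp.add_apply]
      exact (norm_add_le _ _).trans (add_le_add (hR k) ((norm_single_apply_le _ _ _).trans ht.le))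

lemma monom_eq_erase {R : Type*} [CommMonoid R] (u : ι → R) (α : ι →₀ ℕ) (j : ι) :
    monom u α = u j ^ α j * monom u (α.erase j) :=
  (Finsupp.mul_prod_erase' α j (fun i r => u i ^ r) fun _ => pow_zero _).symm

/-- Coefficients in finitely many variables which satisfy Cauchy's inequalities on all polydiscs
define an absolutely convergent power series. -/
lemma summable_of_cauchy_estimate {S : Finset ι} {c : (ι →₀ ℕ) → ℂ}
    (h0 : ∀ α : ι →₀ ℕ, ¬ α.support ⊆ S → c α = 0)
    (hc : ∀ ρ : ι → ℝ, (∀ i, 0 < ρ i) → ∃ M, ∀ α, ‖c α‖ * monom ρ α ≤ M) (u : ι → ℂ) :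
    Summable fun α => c α * monom u α := by
  classical
  -- Cauchy's inequalities on radii `≥ 2 |u_i|` compare with a geometric series in each variable.
  obtain ⟨M, hM⟩ := hc (fun i => 2 * (‖u i‖ + 1)) fun i => by positivity
  have hx := (summable_monom (x := fun i => if i ∈ S then (1 / 2 : ℝ) else 0)
    (fun i => by split_ifs <;> norm_num) (fun i => by split_ifs <;> norm_num)
    (summable_of_ne_finset_zero (s := S) fun i hi => by simp [hi])).1
  refine Summable.of_norm_bounded (hx.mul_left M) fun α => ?_
  by_cases hα : α.support ⊆ S
  · rw [norm_mul, norm_monom]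
    have e1 : monom (fun i => if i ∈ S then (1 / 2 : ℝ) else 0) α = monom (fun _ => 1 / 2) α :=
      monom_congr_support fun i hi => by simp [hα hi]
    calc ‖c α‖ * monom (fun i => ‖u i‖) α
        ≤ ‖c α‖ * monom (fun i => (2 * (‖u i‖ + 1)) * (1 / 2)) α := by
          refine mul_le_mul_of_nonneg_left (monom_le_monom (fun _ => norm_nonneg _) (fun i => ?_) α)
            (norm_nonneg _)
          linarith
      _ = (‖c α‖ * monom (fun i => 2 * (‖u i‖ + 1)) α) * monom (fun _ => 1 / 2) α := by
          rw [monom_mul, mul_assoc]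
      _ ≤ M * monom (fun i => if i ∈ S then (1 / 2 : ℝ) else 0) α := by
          rw [e1]
          exact mul_le_mul_of_nonneg_right (hM α) (monom_nonneg (fun _ => by norm_num) α)
  · rw [h0 α hα, zero_mul, norm_zero]
    have h1 := hM 0
    have : 0 ≤ M := le_trans (by positivity) (h1.trans' (by simp : ‖c 0‖ ≤ _))
    exact mul_nonneg this (monom_nonneg (fun i => by split_ifs <;> norm_num) α)

/-- A separately entire function is given, on every finite-dimensional coordinate space, by an
absolutely convergent power series whose coefficients satisfy Cauchy's inequalities. The induction
adds one variable `j` at a time: the one-variable Taylor coefficients of `G` with respect to `j` are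
again separately entire, so they have power series in the remaining variables. -/
theorem IsSeparatelyEntire.exists_powerSeries (S : Finset ι) {G : (ι →₀ ℂ) → ℂ}
    (hG : IsSeparatelyEntire G) :
    ∃ c : (ι →₀ ℕ) → ℂ, (∀ α : ι →₀ ℕ, ¬ α.support ⊆ S → c α = 0) ∧
      (∀ ρ : ι → ℝ, (∀ i, 0 < ρ i) → ∀ M : ℝ,
        (∀ u : ι →₀ ℂ, u.support ⊆ S → (∀ i, ‖u i‖ ≤ ρ i) → ‖G u‖ ≤ M) →
          ∀ α, ‖c α‖ * monom ρ α ≤ M) ∧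
      ∀ u : ι →₀ ℂ, u.support ⊆ S → HasSum (fun α => c α * monom u α) (G u) := by
  classical
  induction S using Finset.induction_on generalizing G with
  | empty =>
    have h0 : ∀ α : ι →₀ ℕ, α.support ⊆ ∅ ↔ α = 0 := fun α => by
      rw [Finset.subset_empty, Finsupp.support_eq_empty]
    refine ⟨fun α => if α = 0 then G 0 else 0, fun α hα => ?_, fun ρ hρ M hM α => ?_,
      fun u hu => ?_⟩
    · rw [h0] at hα; exact if_neg hα
    · have := hM 0 (by simp) fun i => by simpa using (hρ i).le
      by_cases h : α = 0
      · simpa [h] using this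
      · simpa [h] using (norm_nonneg _).trans this
    · rw [Finset.subset_empty, Finsupp.support_eq_empty] at hu
      subst hu
      convert hasSum_single (0 : ι →₀ ℕ) ?_ using 1
      · simp
      · intro α hα; simp [hα]
  | insert j S hj ih =>
    choose c h0 hcau hsum using fun r => ih (isSeparatelyEntire_coordCoeff hG j r)
    have hers : ∀ α : ι →₀ ℕ, ¬ α.support ⊆ insert j S → ¬ (α.erase j).support ⊆ S := by
      intro α hα h
      rw [Finsupp.support_erase] at h
      exact hα (Finset.subset_insert_iff.2 h)
    set C : (ι →₀ ℕ) → ℂ := fun α => c (α j) (α.erase j) with hC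
    have hC0 : ∀ α : ι →₀ ℕ, ¬ α.support ⊆ insert j S → C α = 0 := fun α hα => h0 _ _ (hers α hα)
    have hCc : ∀ ρ : ι → ℝ, (∀ i, 0 < ρ i) → ∀ M : ℝ,
        (∀ u : ι →₀ ℂ, u.support ⊆ insert j S → (∀ i, ‖u i‖ ≤ ρ i) → ‖G u‖ ≤ M) →
          ∀ α, ‖C α‖ * monom ρ α ≤ M := by
      intro ρ hρ M hM α
      have := hcau (α j) ρ hρ (M / ρ j ^ α j) (fun u hu hle => ?_) (α.erase j)
      · rw [le_div_iff₀ (pow_pos (hρ j) _)] at this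
        rw [monom_eq_erase ρ α j]
        linarith
      · refine norm_coordCoeff_le hG j _ u (hρ j) fun t ht => hM _ ?_ fun i => ?_
        · exact support_add_single_subset hu _ _
        · have huj : u j = 0 := Finsupp.notMem_support_iff.1 fun h => hj (hu h)
          by_cases hij : i = j
          · subst hij; simp [huj, ht]
          · simpa [Finsupp.single_apply, Ne.symm hij] using hle i
    refine ⟨C, hC0, hCc, fun u hu => ?_⟩
    have hbd : ∀ ρ : ι → ℝ, (∀ i, 0 < ρ i) → ∃ M, ∀ α, ‖C α‖ * monom ρ α ≤ M := by
      intro ρ hρ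
      obtain ⟨M, hM⟩ := hG.bounded (insert j S) (∑ i ∈ insert j S, ρ i)
      refine ⟨M, hCc ρ hρ M fun u hu hle => hM u hu fun i => ?_⟩
      by_cases hi : i ∈ insert j S
      · exact (hle i).trans (Finset.single_le_sum (f := ρ) (fun i _ => (hρ i).le) hi)
      · rw [Finsupp.notMem_support_iff.1 fun h => hi (hu h), norm_zero]
        exact Finset.sum_nonneg fun i _ => (hρ i).le
    have hs := summable_of_cauchy_estimate hC0 hbd u
    -- Multi-indices correspond to pairs of the exponent of `j` and a multi-index without `j`, so
    -- the power series is a rearranged iterated series.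
    let Θ : (ι →₀ ℕ) → ℕ × (ι →₀ ℕ) := fun α => (α j, α.erase j)
    have hΘ : Function.Injective Θ := by
      intro α β h
      obtain ⟨h1, h2⟩ := Prod.mk.inj h
      ext i
      by_cases hij : i = j
      · rw [hij]; exact h1
      · have := DFunLike.congr_fun h2 i
        simpa [Finsupp.erase_ne hij] using this
    let u' : ι →₀ ℂ := u.erase j
    have hu' : u'.support ⊆ S := by
      rw [Finsupp.support_erase]; exact Finset.subset_insert_iff.1 hu
    let h : ℕ × (ι →₀ ℕ) → ℂ := fun q => (c q.1 q.2 * monom u' q.2) * u j ^ q.1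
    have hΘh : ∀ α, h (Θ α) = C α * monom u α := fun α => by
      have e : monom u' (α.erase j) = monom u (α.erase j) :=
        monom_congr_support fun i hi => by
          have : i ≠ j := by rintro rfl; simp at hi
          simp [u', Finsupp.erase_ne this]
      rw [monom_eq_erase u α j]
      simp only [h, Θ, e, hC]; ring
    have hout : ∀ q ∉ Set.range Θ, h q = 0 := by
      rintro ⟨r, β⟩ hq
      have : β j ≠ 0 := fun hβ => hq ⟨β.update j r, by
        ext1
        · simp [Θ]
        · ext i
          by_cases hij : i = j
          · subst hij; simp [Θ, hβ]
          · simp [Θ, Finsupp.erase_ne hij]⟩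
      have h1 : c r β = 0 := h0 r β fun hsub => hj (hsub (Finsupp.mem_support_iff.2 this))
      simp [h, h1]
    have hs' : Summable h := by
      rw [← hΘ.summable_iff hout]
      exact hs.congr fun α => (hΘh α).symm
    have h1 : HasSum (fun r => coordCoeff j r G u' * u j ^ r) (∑' q, h q) :=
      hs'.hasSum.prod_fiberwise fun r => (hsum r u' hu').mul_right (u j ^ r)
    have h2 := Complex.hasSum_taylorSeries_of_entire (hG.differentiable u' j) 0 (u j)
    have hG' : G (u' + Finsupp.single j (u j)) = G u := by
      rw [Finsupp.erase_add_single]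
    rw [hG'] at h2
    have h3 : HasSum (fun r => coordCoeff j r G u' * u j ^ r) (G u) := by
      refine h2.congr_fun fun r => ?_
      simp only [coordCoeff, sub_zero, smul_eq_mul]; ring
    have h4 : HasSum (h ∘ Θ) (G u) := by
      rw [hΘ.hasSum_iff hout, ← h1.unique h3]
      exact hs'.hasSum
    exact h4.congr_fun fun α => (hΘh α).symm

end SeparatelyEntire

/-! ### Tuples of test functions as arrays -/

section Arrays

/-- The coordinates of a tuple `(ξ¹, …, ξⁿ, η)`: `(some i, j)` is the `j`-th coordinate of `ξ^i`,
and `(none, j)` that of `η`. -/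
abbrev Idx (n : ℕ) : Type := Option (Fin n) × ℕ

lemma one_le_mu (j : ℕ) : 1 ≤ mu j := by
  unfold mu; have : (0 : ℝ) ≤ j := Nat.cast_nonneg j; linarith

lemma two_le_mu (j : ℕ) : 2 ≤ mu j := by
  unfold mu; have : (0 : ℝ) ≤ j := Nat.cast_nonneg j; linarith

variable {n : ℕ}

/-- The rapidly decreasing arrays, that is, the tuples `(ξ¹, …, ξⁿ, η)` of test functions. -/
def RapidFun (n : ℕ) : Submodule ℂ (Idx n → ℂ) where
  carrier := {w | ∀ k : ℝ, Summable fun p => ‖w p‖ ^ 2 * mu p.2 ^ (2 * k)}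
  zero_mem' := fun k => by simp
  add_mem' := fun {f g} hf hg k =>
    summable_sq_add (w := fun p : Idx n => mu p.2 ^ (2 * k))
      (fun p => Real.rpow_nonneg (mu_pos p.2).le _) (hf k) (hg k)
  smul_mem' := fun c f hf k =>
    summable_sq_smul (w := fun p : Idx n => mu p.2 ^ (2 * k)) c (hf k)

lemma summable_testFun (ξ : TestFun) (k : ℝ) :
    Summable fun j => ‖(ξ : ℕ → ℂ) j‖ ^ 2 * mu j ^ (2 * k) := by
  refine Summable.of_nonneg_of_le
    (fun j => mul_nonneg (sq_nonneg _) (Real.rpow_nonneg (mu_pos j).le _)) (fun j => ?_)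
    (ξ.2 |k| (abs_nonneg k))
  refine mul_le_mul_of_nonneg_left ?_ (sq_nonneg _)
  exact Real.rpow_le_rpow_of_exponent_le (one_le_mu j) (by linarith [le_abs_self k])

/-- The component of an array in the block `o`. -/
def block (w : RapidFun n) (o : Option (Fin n)) : TestFun :=
  ⟨fun j => (w : Idx n → ℂ) (o, j), fun k _ => (w.2 k).comp_injective
    (i := fun j : ℕ => ((o, j) : Idx n)) fun _ _ h => (Prod.mk.inj h).2⟩

@[simp] lemma block_apply (w : RapidFun n) (o : Option (Fin n)) (j : ℕ) :
    (block w o : ℕ → ℂ) j = (w : Idx n → ℂ) (o, j) := rfl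

lemma summable_idx {f : Idx n → ℝ} (h0 : ∀ p, 0 ≤ f p) (h : ∀ o, Summable fun j => f (o, j)) :
    Summable f :=
  (summable_prod_of_nonneg h0).2 ⟨h, Summable.of_finite⟩

lemma sobolevTerm_nonneg (w : Idx n → ℂ) (k : ℝ) (p : Idx n) :
    0 ≤ ‖w p‖ ^ 2 * mu p.2 ^ (2 * k) :=
  mul_nonneg (sq_nonneg _) (Real.rpow_nonneg (mu_pos p.2).le _)

/-- The array of a tuple of test functions. -/
def join (ξ : Fin n → TestFun) (η : TestFun) : RapidFun n :=
  ⟨fun p => ((p.1.elim η ξ : TestFun) : ℕ → ℂ) p.2, fun k =>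
    summable_idx
      (fun p => sobolevTerm_nonneg (fun p => ((p.1.elim η ξ : TestFun) : ℕ → ℂ) p.2) k p)
      fun o => summable_testFun (o.elim η ξ) k⟩

@[simp] lemma join_none (ξ : Fin n → TestFun) (η : TestFun) (j : ℕ) :
    (join ξ η : Idx n → ℂ) (none, j) = (η : ℕ → ℂ) j := rfl

@[simp] lemma join_some (ξ : Fin n → TestFun) (η : TestFun) (i : Fin n) (j : ℕ) :
    (join ξ η : Idx n → ℂ) (some i, j) = (ξ i : ℕ → ℂ) j := rfl

lemma block_join_none (ξ : Fin n → TestFun) (η : TestFun) : block (join ξ η) none = η := rfl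

lemma block_join_some (ξ : Fin n → TestFun) (η : TestFun) (i : Fin n) :
    block (join ξ η) (some i) = ξ i := rfl

lemma join_block (w : RapidFun n) : join (fun i => block w (some i)) (block w none) = w := by
  ext ⟨o, j⟩; cases o <;> rfl

/-- Finitely supported arrays are rapidly decreasing. -/
def ofFinsupp (u : Idx n →₀ ℂ) : RapidFun n :=
  ⟨u, fun k => summable_of_ne_finset_zero (s := u.support) fun p hp => by
    simp [Finsupp.notMem_support_iff.1 hp]⟩

@[simp] lemma ofFinsupp_apply (u : Idx n →₀ ℂ) (p : Idx n) :
    (ofFinsupp u : Idx n → ℂ) p = u p := rfl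

/-- The weight on arrays given by `A μ_j^{2k}` on the `η`-block and `B μ_j^{2l}` on the
`ξ`-blocks. -/
def wt (n : ℕ) (A k B l : ℝ) (p : Idx n) : ℝ :=
  p.1.elim (A * mu p.2 ^ (2 * k)) fun _ => B * mu p.2 ^ (2 * l)

lemma wt_pos {A B : ℝ} (hA : 0 < A) (hB : 0 < B) (k l : ℝ) (p : Idx n) : 0 < wt n A k B l p := by
  have h := fun k => Real.rpow_pos_of_pos (mu_pos p.2) k
  obtain ⟨_ | i, j⟩ := p
  · exact mul_pos hA (h _)
  · exact mul_pos hB (h _)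

lemma wt_mul (A k B l A' k' B' l' : ℝ) (p : Idx n) :
    wt n A k B l p * wt n A' k' B' l' p = wt n (A * A') (k + k') (B * B') (l + l') p := by
  obtain ⟨_ | i, j⟩ := p
  · simp only [wt, Option.elim_none, mul_add, Real.rpow_add (mu_pos j)]; ring
  · simp only [wt, Option.elim_some, mul_add, Real.rpow_add (mu_pos j)]; ring

lemma wt_inv (A k B l : ℝ) (p : Idx n) : (wt n A k B l p)⁻¹ = wt n A⁻¹ (-k) B⁻¹ (-l) p := by
  obtain ⟨_ | i, j⟩ := p
  · simp only [wt, Option.elim_none, mul_neg, Real.rpow_neg (mu_pos j).le, mul_inv]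
  · simp only [wt, Option.elim_some, mul_neg, Real.rpow_neg (mu_pos j).le, mul_inv]

lemma summable_wt (w : RapidFun n) (A k B l : ℝ) :
    Summable fun p => ‖(w : Idx n → ℂ) p‖ ^ 2 * wt n A k B l p := by
  refine Summable.of_norm_bounded (((w.2 k).mul_left |A|).add ((w.2 l).mul_left |B|)) fun p => ?_
  have h := fun k => (Real.rpow_pos_of_pos (mu_pos p.2) k).le
  have h1 := mul_nonneg (abs_nonneg A) (mul_nonneg (sq_nonneg ‖(w : Idx n → ℂ) p‖) (h (2 * k)))
  have h2 := mul_nonneg (abs_nonneg B) (mul_nonneg (sq_nonneg ‖(w : Idx n → ℂ) p‖) (h (2 * l)))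
  obtain ⟨_ | i, j⟩ := p
  · simp only [wt, Option.elim_none, norm_mul, norm_pow, Real.norm_eq_abs,
      abs_of_nonneg (h _), abs_norm] at *
    linarith
  · simp only [wt, Option.elim_some, norm_mul, norm_pow, Real.norm_eq_abs,
      abs_of_nonneg (h _), abs_norm] at *
    linarith

lemma tsum_wt (w : RapidFun n) (A k B l : ℝ) :
    ∑' p, ‖(w : Idx n → ℂ) p‖ ^ 2 * wt n A k B l p
      = B * ∑ i, hNormSq l (block w (some i)) + A * hNormSq k (block w none) := by
  rw [(summable_wt w A k B l).tsum_prod, tsum_fintype, Fintype.sum_option, add_comm,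
    Finset.mul_sum]
  simp only [hNormSq, ← tsum_mul_left, wt, Option.elim_none, Option.elim_some, block_apply]
  congr 1
  · exact Finset.sum_congr rfl fun i _ => tsum_congr fun j => by ring
  · exact tsum_congr fun j => by ring

lemma summable_mu_inv_sq : Summable fun j => mu j ^ (-2 : ℝ) := by
  have h : Summable fun j : ℕ => ((j + 1 : ℕ) : ℝ) ^ (-2 : ℝ) :=
    (summable_nat_add_iff 1).2 (Real.summable_nat_rpow.2 (by norm_num))
  refine Summable.of_nonneg_of_le (fun j => Real.rpow_nonneg (mu_pos j).le _) (fun j => ?_) h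
  refine Real.rpow_le_rpow_of_nonpos (by positivity) ?_ (by norm_num)
  unfold mu; push_cast; have : (0 : ℝ) ≤ j := Nat.cast_nonneg j; linarith

lemma mu_rpow_neg_two_le (j : ℕ) : mu j ^ (-2 : ℝ) ≤ 1 :=
  Real.rpow_le_one_of_one_le_of_nonpos (one_le_mu j) (by norm_num)

/-- The weights `A μ_j^{-2}`, `B μ_j^{-2}` are summable over the array. -/
lemma summable_wt_neg_one (A B : ℝ) : Summable (wt n A (-1) B (-1)) := by
  have h : Summable fun p : Idx n => mu p.2 ^ (-2 : ℝ) :=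
    summable_idx (fun p => Real.rpow_nonneg (mu_pos p.2).le _) fun o => summable_mu_inv_sq
  refine Summable.of_norm_bounded (h.mul_left (|A| + |B|)) fun p => ?_
  have hp := (Real.rpow_pos_of_pos (mu_pos p.2) (-2)).le
  have h1 := mul_nonneg (abs_nonneg A) hp
  have h2 := mul_nonneg (abs_nonneg B) hp
  have e : (2 * (-1) : ℝ) = -2 := by norm_num
  obtain ⟨_ | i, j⟩ := p
  · simp only [wt, Option.elim_none, norm_mul, Real.norm_eq_abs, e, abs_of_nonneg hp] at *
    linarith
  · simp only [wt, Option.elim_some, norm_mul, Real.norm_eq_abs, e, abs_of_nonneg hp] at *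
    linarith

lemma wt_neg_one_le {A B : ℝ} (hA : 0 ≤ A) (hB : 0 ≤ B) (p : Idx n) :
    wt n A (-1) B (-1) p ≤ max A B := by
  have hp := mu_rpow_neg_two_le p.2
  have e : (2 * (-1) : ℝ) = -2 := by norm_num
  obtain ⟨_ | i, j⟩ := p
  · simp only [wt, Option.elim_none, e] at *
    exact (mul_le_of_le_one_right hA hp).trans (le_max_left _ _)
  · simp only [wt, Option.elim_some, e] at *
    exact (mul_le_of_le_one_right hB hp).trans (le_max_right _ _)

end Arrays

/-! ### Symbols given by power series -/

section Series

variable {n : ℕ}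

/-- The function `(ξ¹, …, ξⁿ, η) ↦ ∑_α c_α u^α`, where `u` is the array of `(ξ¹, …, ξⁿ, η)`. -/
def series (c : (Idx n →₀ ℕ) → ℂ) (ξ : Fin n → TestFun) (η : TestFun) : ℂ :=
  ∑' α, c α * monom (join ξ η : Idx n → ℂ) α

/-- The Taylor coefficients that correspond to continuous operators: for every weight of the
target there is a weight of the sources for which the weighted `ℓ²` norm, a Hilbert–Schmidt norm,
is finite. -/
def IsRegular (c : (Idx n →₀ ℕ) → ℂ) : Prop :=
  ∀ k C : ℝ, 0 < k → 0 < C → ∃ k₂ C₂ : ℝ, 0 < k₂ ∧ 0 < C₂ ∧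
    Summable (hsTerm c (wt n (C ^ 2) k (C₂ ^ 2)⁻¹ (-k₂)))

lemma IsRegular.summable {c : (Idx n →₀ ℕ) → ℂ} (hc : IsRegular c) (w : RapidFun n) :
    Summable fun α => ‖c α‖ * monom (fun p => ‖(w : Idx n → ℂ) p‖) α := by
  obtain ⟨k₂, C₂, hk₂, hC₂, hs⟩ := hc 1 1 one_pos one_pos
  refine (summable_powerSeries (fun p => wt_pos (by positivity) (by positivity) _ _ p) hs
    (fun p => norm_nonneg _) ?_).1
  simp only [div_eq_mul_inv, wt_inv]
  exact summable_wt w _ _ _ _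

/-- The weighted `ℓ²` norm of the coefficients is a constant in `(O₂)`. -/
lemma growthBound_series {c : (Idx n →₀ ℕ) → ℂ} {k C k₂ C₂ : ℝ} (hC : 0 < C) (hC₂ : 0 < C₂)
    (hs : Summable (hsTerm c (wt n (C ^ 2) k (C₂ ^ 2)⁻¹ (-k₂)))) :
    GrowthBound (series c) k (C ^ 2)⁻¹ (∑' α, hsTerm c (wt n (C ^ 2) k (C₂ ^ 2)⁻¹ (-k₂)) α)
      k₂ (C₂ ^ 2) := by
  intro ξ η
  set w : Idx n → ℝ := wt n (C ^ 2) k (C₂ ^ 2)⁻¹ (-k₂) with hw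
  have hwp : ∀ p, 0 < w p := fun p => wt_pos (by positivity) (by positivity) _ _ p
  have hu : Summable fun p => ‖(join ξ η : Idx n → ℂ) p‖ ^ 2 / w p := by
    simp only [hw, div_eq_mul_inv, wt_inv]
    exact summable_wt _ _ _ _ _
  obtain ⟨h1, h2⟩ :=
    summable_powerSeries hwp hs (fun p => norm_nonneg ((join ξ η : Idx n → ℂ) p)) hu
  have e : ∑' p, ‖(join ξ η : Idx n → ℂ) p‖ ^ 2 / w p
      = C₂ ^ 2 * ∑ i, hNormSq k₂ (ξ i) + (C ^ 2)⁻¹ * hNormSq (-k) η := by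
    simp only [hw, div_eq_mul_inv, wt_inv, inv_inv, neg_neg, tsum_wt, block_join_some,
      block_join_none]
  rw [← e]
  refine le_trans (pow_le_pow_left₀ (norm_nonneg _) ?_ 2) h2
  unfold series
  refine (norm_tsum_le_tsum_norm ?_).trans (le_of_eq (tsum_congr fun α => ?_))
  · refine h1.congr fun α => ?_
    rw [norm_mul, norm_monom]
  · rw [norm_mul, norm_monom]

lemma rapidFun_sum_norm {T : Type*} [Fintype T] (v : T → RapidFun n) (R : ℝ) :
    ∃ w : RapidFun n, ∀ p, (w : Idx n → ℂ) p = ((R * ∑ a, ‖(v a : Idx n → ℂ) p‖ : ℝ) : ℂ) := by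
  refine ⟨⟨fun p => ((R * ∑ a, ‖(v a : Idx n → ℂ) p‖ : ℝ) : ℂ), fun k => ?_⟩, fun p => rfl⟩
  have h : Summable fun p : Idx n =>
      R ^ 2 * (Fintype.card T * ∑ a, ‖(v a : Idx n → ℂ) p‖ ^ 2 * mu p.2 ^ (2 * k)) :=
    ((summable_sum fun a _ => (v a).2 k).mul_left _).mul_left _
  refine Summable.of_nonneg_of_le
    (fun p => sobolevTerm_nonneg (fun p => ((R * ∑ a, ‖(v a : Idx n → ℂ) p‖ : ℝ) : ℂ)) k p)
    (fun p => ?_) h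
  rw [Complex.norm_real, Real.norm_eq_abs, sq_abs, mul_pow, mul_assoc, ← Finset.sum_mul,
    ← mul_assoc (Fintype.card T : ℝ)]
  refine mul_le_mul_of_nonneg_left ?_ (sq_nonneg R)
  exact mul_le_mul_of_nonneg_right (sq_sum_le_card_mul_sum_sq (s := univ)
    (f := fun a => ‖(v a : Idx n → ℂ) p‖)) (Real.rpow_nonneg (mu_pos p.2).le _)

lemma IsRegular.summable_linearForms {c : (Idx n →₀ ℕ) → ℂ} (hc : IsRegular c) {T : Type*}
    [Fintype T] (v : T → RapidFun n) (R : ℝ) (hR : 0 ≤ R) :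
    Summable fun α => ‖c α‖ * monom (fun p => R * ∑ a, ‖(v a : Idx n → ℂ) p‖) α := by
  obtain ⟨w, hw⟩ := rapidFun_sum_norm v R
  refine (hc.summable w).congr fun α => ?_
  congr 2
  funext p
  rw [hw, Complex.norm_real, Real.norm_of_nonneg]
  exact mul_nonneg hR (Finset.sum_nonneg fun _ _ => norm_nonneg _)

/-- The array `w` with all blocks but `o` replaced by zero. -/
def restrictBlock (w : RapidFun n) (o : Option (Fin n)) : RapidFun n :=
  ⟨fun p => if p.1 = o then (w : Idx n → ℂ) p else 0, fun k => by
    refine Summable.of_nonneg_of_le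
      (fun p => sobolevTerm_nonneg (fun p => if p.1 = o then (w : Idx n → ℂ) p else 0) k p)
      (fun p => ?_) (w.2 k)
    refine mul_le_mul_of_nonneg_right ?_ (Real.rpow_nonneg (mu_pos p.2).le _)
    by_cases hp : p.1 = o <;> simp [hp]⟩

lemma restrictBlock_apply (w : RapidFun n) (o : Option (Fin n)) (p : Idx n) :
    (restrictBlock w o : Idx n → ℂ) p = if p.1 = o then (w : Idx n → ℂ) p else 0 := rfl

lemma isEntireOnLines_series {c : (Idx n →₀ ℕ) → ℂ} (hc : IsRegular c) :
    IsEntireOnLines (series c) := by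
  intro ξ₁ ξ₂ η₁ η₂
  -- The array of the argument is a linear combination of the base point, with coefficient `1`, and
  -- of the blocks of the direction, with coefficients `w` and `z_i`.
  let v : Option (Option (Fin n)) → RapidFun n := fun a =>
    a.elim (join ξ₂ η₂) fun o => restrictBlock (join ξ₁ η₁) o
  let L : (Fin n → ℂ) × ℂ → Option (Option (Fin n)) → ℂ := fun q a =>
    a.elim 1 fun o => o.elim q.2 q.1
  have hL : Differentiable ℂ L := by
    rw [differentiable_pi]
    rintro (_ | _ | i)
    · exact differentiable_const _
    · exact differentiable_snd
    · exact differentiable_pi.1 differentiable_fst i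
  have h := (differentiable_linearForms (v := fun a => (v a : Idx n → ℂ))
    (hc.summable_linearForms v)).comp hL
  have e : (fun q : (Fin n → ℂ) × ℂ =>
      series c (fun i => q.1 i • ξ₁ i + ξ₂ i) (q.2 • η₁ + η₂)) =
      (fun z => ∑' α, c α * monom (fun i => ∑ a, z a * (v a : Idx n → ℂ) i) α) ∘ L := by
    funext q
    simp only [series, Function.comp_apply]
    refine tsum_congr fun α => ?_
    congr 2
    funext p
    rw [Fintype.sum_option, Fintype.sum_option]
    obtain ⟨_ | i, j⟩ := p
    · simp [L, v, restrictBlock_apply, add_comm]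
    · simp [L, v, restrictBlock_apply, add_comm]
  rw [e]
  exact h

end Series

/-! ### Taylor coefficients as mixed partial derivatives -/

section TaylorCoefficients

variable {ι : Type*}

lemma exists_letterCount_eq (α : ι →₀ ℕ) : ∃ f : Fin α.degree → ι, letterCount f = α := by
  have h := card_words (T := Fin α.degree) (α := α) (by simp)
  have hne : (words α : Finset (Fin α.degree → ι)).Nonempty := by
    rw [← Finset.card_pos, Nat.pos_iff_ne_zero]
    intro h0
    rw [h0, Nat.cast_zero, zero_mul] at h
    exact (Nat.cast_pos.2 (Nat.factorial_pos _)).ne h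
  obtain ⟨f, hf⟩ := hne
  exact ⟨f, mem_words.1 hf⟩

/-- A word with letter count `α`. -/
def word (α : ι →₀ ℕ) : Fin α.degree → ι := (exists_letterCount_eq α).choose

lemma letterCount_word (α : ι →₀ ℕ) : letterCount (word α) = α :=
  (exists_letterCount_eq α).choose_spec

lemma wordForm_single [DecidableEq ι] {T : Type*} [Fintype T] (c : (ι →₀ ℕ) → ℂ) (f : T → ι) :
    wordForm c (fun a => Pi.single (f a) 1) = c (letterCount f) * mfac (letterCount f) := by
  unfold wordForm
  rw [tsum_eq_single f]
  · simp
  · intro g hg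
    obtain ⟨a, ha⟩ : ∃ a, g a ≠ f a := by
      by_contra! h; exact hg (funext h)
    rw [Finset.prod_eq_zero (mem_univ a) (Pi.single_eq_of_ne ha _), mul_zero]

/-- The Taylor coefficient of order `α` at the origin, as a mixed partial derivative in which the
`i`-th variable is split into `α_i` variables. -/
def taylorCoeff (G : (ι →₀ ℂ) → ℂ) (α : ι →₀ ℕ) : ℂ :=
  (mfac α : ℂ)⁻¹ * mixedPartial fun z : Fin α.degree → ℂ =>
    G (∑ a, Finsupp.single (word α a) (z a))

lemma sum_single_apply [DecidableEq ι] {T : Type*} [Fintype T] (f : T → ι) (z : T → ℂ) (i : ι) :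
    (∑ a, Finsupp.single (f a) (z a)) i = ∑ a, z a * Pi.single (M := fun _ => ℂ) (f a) 1 i := by
  rw [Finsupp.finsetSum_apply]
  refine Finset.sum_congr rfl fun a _ => ?_
  rw [Finsupp.single_apply, Pi.single_apply]
  simp [eq_comm]

/-- The coefficients of an absolutely convergent power series are determined by its values on
finitely supported arguments. -/
theorem coeff_eq_taylorCoeff {S : Finset ι} {c : (ι →₀ ℕ) → ℂ} {G : (ι →₀ ℂ) → ℂ}
    (hc : ∀ u : ι →₀ ℂ, u.support ⊆ S → Summable fun α => ‖c α‖ * monom (fun i => ‖u i‖) α)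
    (hG : ∀ u : ι →₀ ℂ, u.support ⊆ S → G u = ∑' α, c α * monom u α)
    {α : ι →₀ ℕ} (hα : α.support ⊆ S) : c α = taylorCoeff G α := by
  classical
  have hw : ∀ a, word α a ∈ S := fun a => hα <| by
    have := mem_support_letterCount (word α) a
    rwa [letterCount_word] at this
  have hsup : ∀ z : Fin α.degree → ℂ, (∑ a, Finsupp.single (word α a) (z a)).support ⊆ S := by
    intro z
    refine (Finsupp.support_finsetSum).trans (Finset.biUnion_subset.2 fun a _ => ?_)
    exact Finsupp.support_single_subset.trans (by simpa using hw a)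
  have e : (fun z : Fin α.degree → ℂ => G (∑ a, Finsupp.single (word α a) (z a)))
      = fun z => ∑' β, c β *
        monom (fun i => ∑ a, z a * Pi.single (M := fun _ => ℂ) (word α a) 1 i) β := by
    funext z
    rw [hG _ (hsup z)]
    refine tsum_congr fun β => ?_
    congr 2
    funext i
    exact sum_single_apply _ _ _
  have hm : (mfac α : ℂ) ≠ 0 := Complex.ofReal_ne_zero.2 (mfac_pos α).ne'
  rw [taylorCoeff, e, mixedPartial_linearForms (v := fun a => Pi.single (word α a) 1),
    wordForm_single, letterCount_word]
  · field_simp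
  · intro R hR
    refine (hc _ (hsup fun _ => R)).congr fun β => ?_
    congr 2
    funext i
    rw [sum_single_apply, Finset.mul_sum]
    have : ∀ a, (R : ℂ) * Pi.single (M := fun _ => ℂ) (word α a) 1 i
        = ((R * ‖Pi.single (M := fun _ => ℂ) (word α a) 1 i‖ : ℝ) : ℂ) := fun a => by
      rw [Pi.single_apply]; split_ifs <;> simp
    simp only [this]
    rw [← Complex.ofReal_sum, Complex.norm_real, Real.norm_of_nonneg]
    exact Finset.sum_nonneg fun a _ => mul_nonneg hR (norm_nonneg _)

end TaylorCoefficients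

/-! ### Functions with entire restrictions and Gaussian growth -/

section Symbols

variable {n : ℕ}

/-- A function of tuples of test functions, as a function of arrays. -/
def onArrays (F : (Fin n → TestFun) → TestFun → ℂ) (w : RapidFun n) : ℂ :=
  F (fun i => block w (some i)) (block w none)

lemma onArrays_series (c : (Idx n →₀ ℕ) → ℂ) (w : RapidFun n) :
    onArrays (series c) w = ∑' α, c α * monom (w : Idx n → ℂ) α := by
  rw [onArrays, series, join_block]

/-- The Taylor coefficients of a function of tuples of test functions. -/
def symbolCoeff (F : (Fin n → TestFun) → TestFun → ℂ) : (Idx n →₀ ℕ) → ℂ :=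
  taylorCoeff fun u => onArrays F (ofFinsupp u)

lemma symbolCoeff_series {c : (Idx n →₀ ℕ) → ℂ} (hc : IsRegular c) :
    symbolCoeff (series c) = c := by
  funext α
  refine (coeff_eq_taylorCoeff (S := α.support) (fun u _ => hc.summable (ofFinsupp u))
    (fun u _ => ?_) le_rfl).symm
  exact onArrays_series c _

lemma ofFinsupp_add_single (u : Idx n →₀ ℂ) (p : Idx n) (t : ℂ) :
    ofFinsupp (u + Finsupp.single p t) = t • ofFinsupp (Finsupp.single p 1) + ofFinsupp u := by
  ext q
  simp [add_comm, Finsupp.single_apply]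

/-- Condition `(O₁)` gives entire functions on all complex lines. -/
lemma IsEntireOnLines.differentiable {F : (Fin n → TestFun) → TestFun → ℂ} (h : IsEntireOnLines F)
    (d w : RapidFun n) : Differentiable ℂ fun t : ℂ => onArrays F (t • d + w) := by
  have h1 := h (fun i => block d (some i)) (fun i => block w (some i)) (block d none) (block w none)
  have h2 : Differentiable ℂ fun t : ℂ => ((fun _ => t, t) : (Fin n → ℂ) × ℂ) :=
    (differentiable_pi.2 fun _ => differentiable_id).prodMk differentiable_id
  exact h1.comp h2

lemma GrowthBound.onArrays {F : (Fin n → TestFun) → TestFun → ℂ} {k K C k₁ K₁ : ℝ}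
    (h : GrowthBound F k K C k₁ K₁) (w : RapidFun n) :
    ‖onArrays F w‖ ^ 2 ≤
      C * Real.exp (∑' p, ‖(w : Idx n → ℂ) p‖ ^ 2 * wt n K (-k) K₁ k₁ p) := by
  rw [tsum_wt]
  exact h _ _

lemma GrowthBound.nonneg {F : (Fin n → TestFun) → TestFun → ℂ} {k K C k₁ K₁ : ℝ}
    (h : GrowthBound F k K C k₁ K₁) : 0 ≤ C := by
  have := (sq_nonneg _).trans (h 0 0)
  exact nonneg_of_mul_nonneg_left this (Real.exp_pos _)

lemma isSeparatelyEntire_onArrays {F : (Fin n → TestFun) → TestFun → ℂ} (h : IsEntireOnLines F)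
    {k K C k₁ K₁ : ℝ} (hK : 0 < K) (hK₁ : 0 < K₁) (hF : GrowthBound F k K C k₁ K₁) :
    IsSeparatelyEntire fun u => onArrays F (ofFinsupp u) := by
  refine ⟨fun u p => ?_, fun S R => ?_⟩
  · simp only [ofFinsupp_add_single]
    exact h.differentiable _ _
  · refine ⟨√(C * Real.exp (∑ p ∈ S, R ^ 2 * wt n K (-k) K₁ k₁ p)), fun u hu hR => ?_⟩
    refine Real.le_sqrt_of_sq_le ((hF.onArrays _).trans ?_)
    refine mul_le_mul_of_nonneg_left (Real.exp_le_exp.2 ?_) hF.nonneg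
    rw [tsum_eq_sum (s := S) fun p hp => by
      simp [Finsupp.notMem_support_iff.1 fun h => hp (hu h)]]
    refine Finset.sum_le_sum fun p _ => mul_le_mul_of_nonneg_right ?_ (wt_pos hK hK₁ _ _ p).le
    exact pow_le_pow_left₀ (norm_nonneg _) (hR p) 2

lemma symbolCoeff_spec {F : (Fin n → TestFun) → TestFun → ℂ} (h : IsEntireOnLines F)
    {k K C k₁ K₁ : ℝ} (hK : 0 < K) (hK₁ : 0 < K₁) (hF : GrowthBound F k K C k₁ K₁)
    (S : Finset (Idx n)) :
    (∀ ρ : Idx n → ℝ, (∀ i, 0 < ρ i) → ∀ M : ℝ,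
        (∀ u : Idx n →₀ ℂ, u.support ⊆ S → (∀ i, ‖u i‖ ≤ ρ i) → ‖onArrays F (ofFinsupp u)‖ ≤ M) →
          ∀ α : Idx n →₀ ℕ, α.support ⊆ S → ‖symbolCoeff F α‖ * monom ρ α ≤ M) ∧
      ∀ u : Idx n →₀ ℂ, u.support ⊆ S →
        onArrays F (ofFinsupp u) = ∑' α, symbolCoeff F α * monom u α := by
  obtain ⟨c, h0, hcau, hsum⟩ := (isSeparatelyEntire_onArrays h hK hK₁ hF).exists_powerSeries S
  have hc : ∀ α : Idx n →₀ ℕ, α.support ⊆ S → c α = symbolCoeff F α := fun α hα =>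
    coeff_eq_taylorCoeff (S := S)
      (fun u hu => (hsum u hu).summable.norm.congr fun α => by rw [norm_mul, norm_monom])
      (fun u hu => (hsum u hu).tsum_eq.symm) hα
  refine ⟨fun ρ hρ M hM α hα => ?_, fun u hu => ?_⟩
  · rw [← hc α hα]; exact hcau ρ hρ M hM α
  · rw [← (hsum u hu).tsum_eq]
    refine tsum_congr fun α => ?_
    by_cases hα : α.support ⊆ S
    · rw [hc α hα]
    · obtain ⟨p, hp, hpS⟩ := Finset.not_subset.1 hα
      rw [monom_eq_zero hp (Finsupp.notMem_support_iff.1 fun h => hpS (hu h)), mul_zero, mul_zero]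

/-- Cauchy's inequality on the optimal polydisc, of radii `ρ_p² = α_p / a_p` where `a` is the
weight in the growth bound. -/
lemma hsTerm_symbolCoeff_le {F : (Fin n → TestFun) → TestFun → ℂ} (h : IsEntireOnLines F)
    {k K C k₁ K₁ : ℝ} (hK : 0 < K) (hK₁ : 0 < K₁) (hF : GrowthBound F k K C k₁ K₁)
    {s : Idx n → ℝ} (hs : ∀ p, 0 < s p) (α : Idx n →₀ ℕ) :
    hsTerm (symbolCoeff F) s α ≤
      C * monom (fun p => Real.exp 1 * wt n K (-k) K₁ k₁ p * s p) α := by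
  set a := wt n K (-k) K₁ k₁ with ha
  have ha0 : ∀ p, 0 < a p := fun p => wt_pos hK hK₁ _ _ p
  have hC := hF.nonneg
  let ρ : Idx n → ℝ := fun p => if α p = 0 then 1 else √(α p / a p)
  have hρ : ∀ p, 0 < ρ p := fun p => by
    by_cases hp : α p = 0
    · simp [ρ, hp]
    · have : (0 : ℝ) < α p := Nat.cast_pos.2 (Nat.pos_of_ne_zero hp)
      simp only [ρ, hp, if_false]
      exact Real.sqrt_pos.2 (div_pos this (ha0 p))
  have hρ2 : ∀ p ∈ α.support, ρ p ^ 2 = α p / a p := fun p hp => by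
    simp only [ρ, Finsupp.mem_support_iff.1 hp, if_false]
    exact Real.sq_sqrt (div_nonneg (Nat.cast_nonneg _) (ha0 p).le)
  have h1 := (symbolCoeff_spec h hK hK₁ hF α.support).1 ρ hρ (√(C * Real.exp α.degree))
    (fun u hu hle => ?_) α le_rfl
  · have h2 : ‖symbolCoeff F α‖ ^ 2 * monom (fun p => ρ p ^ 2) α ≤ C * Real.exp α.degree := by
      rw [monom_pow, ← mul_pow]
      refine (pow_le_pow_left₀ ?_ h1 2).trans_eq (Real.sq_sqrt (by positivity))
      exact mul_nonneg (norm_nonneg _) (monom_nonneg (fun p => (hρ p).le) α)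
    have h3 : mfac α * monom s α ≤ monom (fun p => ρ p ^ 2) α * monom (fun p => a p * s p) α := by
      rw [monom_congr_support hρ2, ← monom_mul, mfac, monom, monom, Finsupp.prod, Finsupp.prod,
        Finsupp.prod, ← Finset.prod_mul_distrib]
      refine Finset.prod_le_prod (fun p _ => ?_) fun p _ => ?_
      · have := hs p; positivity
      · have e : (α p : ℝ) / a p * (a p * s p) = α p * s p := by
          have := (ha0 p).ne'; field_simp
        rw [e, mul_pow]
        refine mul_le_mul_of_nonneg_right ?_ (pow_nonneg (hs p).le _)
        exact_mod_cast Nat.factorial_le_pow (α p)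
    calc hsTerm (symbolCoeff F) s α
        ≤ ‖symbolCoeff F α‖ ^ 2 * (monom (fun p => ρ p ^ 2) α * monom (fun p => a p * s p) α) :=
          mul_le_mul_of_nonneg_left h3 (sq_nonneg _)
      _ ≤ C * Real.exp α.degree * monom (fun p => a p * s p) α := by
          rw [← mul_assoc]
          exact mul_le_mul_of_nonneg_right h2
            (monom_nonneg (fun p => (mul_pos (ha0 p) (hs p)).le) α)
      _ = _ := by
          simp only [mul_assoc (Real.exp 1)]
          rw [monom_mul (fun _ => Real.exp 1), monom_const, ← Real.exp_nat_mul, mul_one, mul_assoc]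
  · refine Real.le_sqrt_of_sq_le ((hF.onArrays _).trans ?_)
    refine mul_le_mul_of_nonneg_left (Real.exp_le_exp.2 ?_) hC
    rw [tsum_eq_sum (s := α.support) fun p hp => by
      simp [Finsupp.notMem_support_iff.1 fun h => hp (hu h)]]
    have : (α.degree : ℝ) = ∑ p ∈ α.support, (α p : ℝ) := by
      rw [Finsupp.degree_apply]; push_cast; rfl
    rw [this]
    refine Finset.sum_le_sum fun p hp => ?_
    have h4 := pow_le_pow_left₀ (norm_nonneg _) (hle p) 2
    rw [hρ2 p hp, le_div_iff₀ (ha0 p)] at h4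
    exact h4

/-- For suitable weights the growth bound controls the weighted `ℓ²` norm of the Taylor
coefficients: the weights are chosen such that the bound in `hsTerm_symbolCoeff_le` becomes the
monomial of the summable weight `μ_j^{-2} / 2`, independently of `k`, `C`, `k₁` and `K₁`. -/
lemma hsTerm_symbolCoeff_summable {F : (Fin n → TestFun) → TestFun → ℂ} (h : IsEntireOnLines F)
    {k C K C₀ k₁ K₁ : ℝ} (hC : 0 < C) (hK : K = (2 * Real.exp 1 * C ^ 2)⁻¹) (hK₁ : 0 < K₁)
    (hF : GrowthBound F (k + 1) K C₀ k₁ K₁) :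
    Summable (hsTerm (symbolCoeff F) (wt n (C ^ 2) k (√(2 * Real.exp 1 * K₁) ^ 2)⁻¹ (-(k₁ + 1)))) ∧
    ∑' α, hsTerm (symbolCoeff F) (wt n (C ^ 2) k (√(2 * Real.exp 1 * K₁) ^ 2)⁻¹ (-(k₁ + 1))) α
      ≤ C₀ * Real.exp (2 * ∑' p, wt n (1 / 2) (-1) (1 / 2) (-1) p) := by
  have he := Real.exp_pos 1
  have hK0 : 0 < K := by rw [hK]; positivity
  rw [Real.sq_sqrt (by positivity)]
  have e : ∀ p, Real.exp 1 * wt n K (-(k + 1)) K₁ k₁ p *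
      wt n (C ^ 2) k (2 * Real.exp 1 * K₁)⁻¹ (-(k₁ + 1)) p = wt n (1 / 2) (-1) (1 / 2) (-1) p := by
    intro p
    rw [mul_assoc, wt_mul]
    have e1 : -(k + 1) + k = -1 := by ring
    have e2 : k₁ + -(k₁ + 1) = -1 := by ring
    rw [e1, e2]
    obtain ⟨_ | i, j⟩ := p
    · simp only [wt, Option.elim_none, hK]; field_simp
    · simp only [wt, Option.elim_some]; field_simp
  have h1 := hsTerm_symbolCoeff_le h hK0 hK₁ hF
    (s := wt n (C ^ 2) k (2 * Real.exp 1 * K₁)⁻¹ (-(k₁ + 1)))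
    (fun p => wt_pos (by positivity) (by positivity) _ _ p)
  simp only [e] at h1
  obtain ⟨h2, h3⟩ := summable_monom (x := wt n (1 / 2) (-1) (1 / 2) (-1))
    (fun p => (wt_pos (by norm_num) (by norm_num) _ _ p).le)
    (fun p => (wt_neg_one_le (by norm_num) (by norm_num) p).trans (by simp))
    (summable_wt_neg_one _ _)
  have h4 := Summable.of_nonneg_of_le (fun α => hsTerm_nonneg _
    (fun p => wt_pos (by positivity) (by positivity) _ _ p) α) h1 (h2.mul_left C₀)
  refine ⟨h4, (h4.tsum_le_tsum h1 (h2.mul_left C₀)).trans ?_⟩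
  rw [tsum_mul_left]
  exact mul_le_mul_of_nonneg_left h3 hF.nonneg

lemma isRegular_symbolCoeff {F : (Fin n → TestFun) → TestFun → ℂ} (h : IsEntireOnLines F)
    (hF : HasGaussianGrowth F) : IsRegular (symbolCoeff F) := by
  intro k C hk hC
  have he := Real.exp_pos 1
  obtain ⟨C₀, k₁, K₁, hk₁, hK₁, hb⟩ := hF (k + 1) ((2 * Real.exp 1 * C ^ 2)⁻¹) (by linarith)
    (by positivity)
  exact ⟨k₁ + 1, √(2 * Real.exp 1 * K₁), by linarith, Real.sqrt_pos.2 (by positivity),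
    (hsTerm_symbolCoeff_summable h hC rfl hK₁ hb).1⟩

open Classical in
/-- The truncation of an array to finitely many coordinates. -/
def truncate (w : RapidFun n) (S : Finset (Idx n)) : Idx n →₀ ℂ :=
  Finsupp.onFinset S (fun p => if p ∈ S then (w : Idx n → ℂ) p else 0) fun p hp => by
    by_contra h; simp [h] at hp

open Classical in
lemma truncate_apply (w : RapidFun n) (S : Finset (Idx n)) (p : Idx n) :
    truncate w S p = if p ∈ S then (w : Idx n → ℂ) p else 0 := rfl

lemma support_truncate_subset (w : RapidFun n) (S : Finset (Idx n)) :
    (truncate w S).support ⊆ S := Finsupp.support_onFinset_subset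

/-- A function with `(O₁)` and a growth bound is continuous along truncations: by the Schwarz lemma
on the line through `w` and its truncation, since the bound on a disc of any given radius is
uniform once the tail of `w` is small. -/
lemma tendsto_onArrays_truncate {F : (Fin n → TestFun) → TestFun → ℂ} (h : IsEntireOnLines F)
    {k K C k₁ K₁ : ℝ} (hK : 0 < K) (hK₁ : 0 < K₁) (hF : GrowthBound F k K C k₁ K₁)
    (w : RapidFun n) :
    Tendsto (fun S : Finset (Idx n) => onArrays F (ofFinsupp (truncate w S))) atTop
      (𝓝 (onArrays F w)) := by
  classical
  set a := wt n K (-k) K₁ k₁ with ha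
  have ha0 : ∀ p, 0 < a p := fun p => wt_pos hK hK₁ _ _ p
  set f : Idx n → ℝ := fun p => ‖(w : Idx n → ℂ) p‖ ^ 2 * a p with hf
  have hf0 : ∀ p, 0 ≤ f p := fun p => mul_nonneg (sq_nonneg _) (ha0 p).le
  have hfs : Summable f := summable_wt w _ _ _ _
  -- `M` bounds `F` at all points `v + t (w - v)` with `|t| < R`, where `v` is a truncation of `w`
  -- for which the tail contributes at most `1` to the exponent.
  set M := √(C * Real.exp (∑' p, f p + 1)) with hM
  have hM0 : 0 ≤ M := Real.sqrt_nonneg _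
  rw [Metric.tendsto_nhds]
  intro ε hε
  obtain ⟨R, hR1, hR⟩ : ∃ R : ℝ, 1 < R ∧ 2 * M / R < ε := by
    refine ⟨max 2 (2 * M / ε + 1), lt_of_lt_of_le one_lt_two (le_max_left _ _), ?_⟩
    have h1 : 2 * M / ε < max 2 (2 * M / ε + 1) := lt_of_lt_of_le (lt_add_one _) (le_max_right _ _)
    have h2 : 0 < max 2 (2 * M / ε + 1) := lt_of_lt_of_le two_pos (le_max_left _ _)
    rw [div_lt_iff₀ h2]
    rw [div_lt_iff₀ hε] at h1
    linarith
  have hR0 : 0 < R := by linarith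
  have htail : ∀ᶠ S : Finset (Idx n) in atTop, ∑' p, f p - ∑ p ∈ S, f p < 1 / R ^ 2 := by
    have h1 := hfs.hasSum.eventually (lt_mem_nhds (a := ∑' p, f p - 1 / R ^ 2)
      (by have : 0 < 1 / R ^ 2 := by positivity
          linarith))
    filter_upwards [h1] with S hS
    linarith
  filter_upwards [htail] with S hS
  set v := ofFinsupp (truncate w S) with hv
  have hvp : ∀ p, (v : Idx n → ℂ) p = if p ∈ S then (w : Idx n → ℂ) p else 0 := fun p => rfl
  set g : ℂ → ℂ := fun t => onArrays F (t • (w - v) + v) with hg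
  have hgd : Differentiable ℂ g := h.differentiable _ _
  have hgb : ∀ t : ℂ, ‖t‖ < R → ‖g t‖ ≤ M := fun t ht => by
    refine Real.le_sqrt_of_sq_le ((hF.onArrays _).trans ?_)
    refine mul_le_mul_of_nonneg_left (Real.exp_le_exp.2 ?_) hF.nonneg
    have e1 : ∀ p, ‖((t • (w - v) + v : RapidFun n) : Idx n → ℂ) p‖ ^ 2 * a p
        = (if p ∈ S then f p else 0) + ‖t‖ ^ 2 * (f p - if p ∈ S then f p else 0) := fun p => by
      simp only [Submodule.coe_add, Submodule.coe_smul, Submodule.coe_sub, Pi.add_apply,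
        Pi.smul_apply, Pi.sub_apply, hvp, hf]
      split_ifs
      · simp
      · simp [mul_pow]; ring
    have hS1 : HasSum (fun p => if p ∈ S then f p else 0) (∑ p ∈ S, f p) := by
      have : HasSum (fun p => if p ∈ S then f p else 0) (∑ p ∈ S, if p ∈ S then f p else 0) :=
        hasSum_sum_of_ne_finset_zero fun p hp => by simp [hp]
      rwa [Finset.sum_congr rfl fun p hp => if_pos hp] at this
    have hS2 := hS1.add ((hfs.hasSum.sub hS1).mul_left (‖t‖ ^ 2))
    rw [tsum_congr e1, hS2.tsum_eq]
    have h1 : ∑ p ∈ S, f p ≤ ∑' p, f p := hfs.sum_le_tsum S fun p _ => hf0 p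
    have h2 : ‖t‖ ^ 2 * (∑' p, f p - ∑ p ∈ S, f p) ≤ 1 := by
      calc _ ≤ R ^ 2 * (1 / R ^ 2) := by
            refine mul_le_mul (pow_le_pow_left₀ (norm_nonneg _) ht.le 2) hS.le ?_ (by positivity)
            linarith
        _ = 1 := by field_simp
    linarith
  have h1 : g 1 = onArrays F w := by simp [hg]
  have h0 : g 0 = onArrays F v := by simp [hg]
  have hsch := Complex.dist_le_div_mul_dist_of_mapsTo_ball (f := g) (c := 0) (z := 1) (R₁ := R)
    (R₂ := 2 * M) hgd.differentiableOn (fun t ht => ?_) (by simpa using hR1)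
  · rw [h1, h0, dist_comm] at hsch
    refine hsch.trans_lt ?_
    simpa using hR
  · rw [mem_closedBall_iff_norm]
    have := hgb t (by simpa using ht)
    have := hgb 0 (by simpa using hR0)
    linarith [norm_sub_le (g t) (g 0)]

/-- A function with `(O₁)` and `(O₂)` is the sum of its Taylor series. -/
theorem series_symbolCoeff {F : (Fin n → TestFun) → TestFun → ℂ} (h : IsEntireOnLines F)
    (hF : HasGaussianGrowth F) : series (symbolCoeff F) = F := by
  classical
  have hreg := isRegular_symbolCoeff h hF
  obtain ⟨C, k₁, K₁, hk₁, hK₁, hb⟩ := hF 1 1 one_pos one_pos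
  have key : ∀ w : RapidFun n, onArrays F w = ∑' α, symbolCoeff F α * monom (w : Idx n → ℂ) α := by
    intro w
    refine tendsto_nhds_unique (tendsto_onArrays_truncate h one_pos hK₁ hb w) ?_
    have e : ∀ S, onArrays F (ofFinsupp (truncate w S))
        = ∑' α, symbolCoeff F α * monom (truncate w S) α := fun S =>
      (symbolCoeff_spec h one_pos hK₁ hb S).2 _ (support_truncate_subset w S)
    simp only [e]
    refine tendsto_tsum_of_dominated_convergence (hreg.summable w) (fun α => ?_) ?_
    · refine tendsto_const_nhds.congr' ?_
      filter_upwards [eventually_ge_atTop α.support] with S hS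
      congr 1
      exact monom_congr_support fun p hp => by rw [truncate_apply, if_pos (hS hp)]
    · refine Eventually.of_forall fun S α => ?_
      rw [norm_mul, norm_monom]
      refine mul_le_mul_of_nonneg_left (monom_le_monom (fun _ => norm_nonneg _) (fun p => ?_) α)
        (norm_nonneg _)
      rw [truncate_apply]
      split_ifs
      · exact le_rfl
      · simp
  funext ξ η
  exact (key (join ξ η)).symm

end Symbols

/-! ### The weighted Fock norms -/

section FockNorms

/-- The factor `(|A|! / A!)^{1/2} / |A|!` for which the coefficient of `e_A` in `φ_ξ` is
`fockNormalizer A * ξ^A`. -/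
def fockNormalizer (A : ℕ →₀ ℕ) : ℝ := √(A.multinomial : ℝ) / (A.degree.factorial : ℝ)

lemma coherentCoeff_eq (ξ : ℕ → ℂ) (A : ℕ →₀ ℕ) :
    coherentCoeff ξ A = fockNormalizer A * monom ξ A := rfl

lemma degree_factorial_pos (A : ℕ →₀ ℕ) : (0 : ℝ) < A.degree.factorial :=
  Nat.cast_pos.2 (Nat.factorial_pos _)

lemma mfac_mul_multinomial (A : ℕ →₀ ℕ) :
    mfac A * (A.multinomial : ℝ) = (A.degree.factorial : ℝ) := by
  have h := Nat.multinomial_spec A.support A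
  rw [← Finsupp.multinomial_eq] at h
  simp only [mfac, Finsupp.prod, Finsupp.degree]
  exact_mod_cast h

lemma fockNormalizer_sq (A : ℕ →₀ ℕ) :
    fockNormalizer A ^ 2 * (mfac A * A.degree.factorial) = 1 := by
  have h1 := mfac_mul_multinomial A
  have h2 := (degree_factorial_pos A).ne'
  rw [fockNormalizer, div_pow, Real.sq_sqrt (Nat.cast_nonneg _)]
  field_simp
  linarith

lemma fockNormalizer_pos (A : ℕ →₀ ℕ) : 0 < fockNormalizer A := by
  have h0 : 0 ≤ fockNormalizer A := div_nonneg (Real.sqrt_nonneg _) (degree_factorial_pos A).le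
  refine lt_of_le_of_ne h0 fun h => ?_
  have := fockNormalizer_sq A
  rw [← h] at this
  norm_num at this

lemma fockWeight_eq (k C : ℝ) (A : ℕ →₀ ℕ) :
    fockWeight k C A = A.degree.factorial * monom (fun j => C ^ 2 * mu j ^ (2 * k)) A := by
  have h := norm_coherentCoeff_sq_mul (fun _ => 1) k C A
  have h1 := fockNormalizer_sq A
  have h2 := mfac_pos A
  have e : (A.prod fun i r => (C ^ 2 * (‖(1 : ℂ)‖ ^ 2 * mu i ^ (2 * k))) ^ r / (r.factorial : ℝ))
      = monom (fun j => C ^ 2 * mu j ^ (2 * k)) A / mfac A := by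
    simp [monom, mfac, Finsupp.prod, Finset.prod_div_distrib]
  have e1 : monom (fun _ : ℕ => (1 : ℂ)) A = 1 := by simp [monom_const]
  rw [e, coherentCoeff_eq, e1, mul_one, Complex.norm_real, Real.norm_eq_abs, sq_abs,
    eq_div_iff h2.ne'] at h
  calc fockWeight k C A
      = (fockNormalizer A ^ 2 * (mfac A * A.degree.factorial)) * fockWeight k C A := by
        rw [h1, one_mul]
    _ = A.degree.factorial * (fockNormalizer A ^ 2 * fockWeight k C A * mfac A) := by ring
    _ = _ := by rw [h]

lemma sobolevWeight_pos {C : ℝ} (hC : 0 < C) (k : ℝ) (j : ℕ) : 0 < C ^ 2 * mu j ^ (2 * k) :=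
  mul_pos (pow_pos hC 2) (Real.rpow_pos_of_pos (mu_pos j) _)

lemma fockWeight_pos {C : ℝ} (hC : 0 < C) (k : ℝ) (A : ℕ →₀ ℕ) : 0 < fockWeight k C A := by
  rw [fockWeight_eq]
  exact mul_pos (degree_factorial_pos A) (monom_pos (sobolevWeight_pos hC k) A)

lemma fockWeight_mono {k k' C C' : ℝ} (hC : 0 < C) (hk : k ≤ k') (hCC : C ≤ C') (A : ℕ →₀ ℕ) :
    fockWeight k C A ≤ fockWeight k' C' A := by
  rw [fockWeight_eq, fockWeight_eq]
  refine mul_le_mul_of_nonneg_left (monom_le_monom (fun j => (sobolevWeight_pos hC k j).le)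
    (fun j => ?_) A) (degree_factorial_pos A).le
  exact mul_le_mul (pow_le_pow_left₀ hC.le hCC 2)
    (Real.rpow_le_rpow_of_exponent_le (one_le_mu j) (by linarith))
    (Real.rpow_nonneg (mu_pos j).le _) (sq_nonneg _)

/-- Increasing the index by one makes the weights grow fast enough for the inverse ratios to be
summable: the Fock spaces form a nuclear family. -/
lemma summable_fockWeight_ratio (k : ℝ) {C : ℝ} (hC : 0 < C) :
    Summable fun B => fockWeight k C B / fockWeight (k + 1) C B := by
  have e2 : ((2 : ℝ) ^ (-2 : ℝ)) = 1 / 4 := by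
    rw [Real.rpow_neg zero_le_two]; norm_num
  have h := (summable_monom (x := fun j => mu j ^ (-2 : ℝ))
    (fun j => Real.rpow_nonneg (mu_pos j).le _)
    (fun j => ?_) summable_mu_inv_sq).1
  · refine h.congr fun B => ?_
    rw [fockWeight_eq, fockWeight_eq, mul_div_mul_left _ _ (degree_factorial_pos B).ne',
      eq_div_iff (monom_pos (sobolevWeight_pos hC _) B).ne', ← monom_mul]
    congr 1
    funext j
    have : 2 * k = -2 + 2 * (k + 1) := by ring
    rw [this, Real.rpow_add (mu_pos j)]; ring
  · calc mu j ^ (-2 : ℝ) ≤ 2 ^ (-2 : ℝ) :=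
          Real.rpow_le_rpow_of_nonpos two_pos (two_le_mu j) (by norm_num)
      _ ≤ 1 / 2 := by rw [e2]; norm_num

lemma wNorm_nonneg (k C : ℝ) (φ : (ℕ →₀ ℕ) → ℂ) : 0 ≤ wNorm k C φ := Real.sqrt_nonneg _

lemma wTerm_nonneg (k C : ℝ) (φ : (ℕ →₀ ℕ) → ℂ) (A : ℕ →₀ ℕ) : 0 ≤ ‖φ A‖ ^ 2 * fockWeight k C A :=
  mul_nonneg (sq_nonneg _) (fockWeight_nonneg k C A)

lemma wNorm_sq (k C : ℝ) (φ : (ℕ →₀ ℕ) → ℂ) :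
    wNorm k C φ ^ 2 = ∑' A, ‖φ A‖ ^ 2 * fockWeight k C A :=
  Real.sq_sqrt (tsum_nonneg fun A => wTerm_nonneg k C φ A)

lemma wNorm_mono {k k' C C' : ℝ} (hk0 : 0 < k) (hC : 0 < C) (hk : k ≤ k') (hCC : C ≤ C')
    (φ : HidaTest) : wNorm k C φ ≤ wNorm k' C' φ := by
  refine Real.sqrt_le_sqrt (Summable.tsum_le_tsum (fun A => ?_) (φ.2 k C hk0 hC)
    (φ.2 k' C' (hk0.trans_le hk) (hC.trans_le hCC)))
  exact mul_le_mul_of_nonneg_left (fockWeight_mono hC hk hCC A) (sq_nonneg _)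

/-- A quasi-triangle inequality, which suffices for sums of continuous operators. -/
lemma wNorm_add_le {k C : ℝ} (hk : 0 < k) (hC : 0 < C) (φ ψ : HidaTest) :
    wNorm k C (φ + ψ : HidaTest) ≤ 2 * (wNorm k C φ + wNorm k C ψ) := by
  have h1 := wNorm_nonneg k C φ
  have h2 := wNorm_nonneg k C ψ
  refine Real.sqrt_le_iff.2 ⟨by positivity, ?_⟩
  have hle : ∀ A, ‖((φ + ψ : HidaTest) : (ℕ →₀ ℕ) → ℂ) A‖ ^ 2 * fockWeight k C A ≤
      2 * (‖(φ : (ℕ →₀ ℕ) → ℂ) A‖ ^ 2 * fockWeight k C A) +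
      2 * (‖(ψ : (ℕ →₀ ℕ) → ℂ) A‖ ^ 2 * fockWeight k C A) := fun A => by
    have h3 := norm_add_le ((φ : (ℕ →₀ ℕ) → ℂ) A) ((ψ : (ℕ →₀ ℕ) → ℂ) A)
    have h4 : ‖(φ : (ℕ →₀ ℕ) → ℂ) A + (ψ : (ℕ →₀ ℕ) → ℂ) A‖ ^ 2 ≤
        2 * ‖(φ : (ℕ →₀ ℕ) → ℂ) A‖ ^ 2 + 2 * ‖(ψ : (ℕ →₀ ℕ) → ℂ) A‖ ^ 2 := by
      nlinarith [norm_nonneg ((φ : (ℕ →₀ ℕ) → ℂ) A + (ψ : (ℕ →₀ ℕ) → ℂ) A),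
        sq_nonneg (‖(φ : (ℕ →₀ ℕ) → ℂ) A‖ - ‖(ψ : (ℕ →₀ ℕ) → ℂ) A‖)]
    have h5 := mul_le_mul_of_nonneg_right h4 (fockWeight_nonneg k C A)
    simp only [Submodule.coe_add, Pi.add_apply]
    linarith
  have h3 := Summable.tsum_le_tsum hle ((φ + ψ).2 k C hk hC)
    (((φ.2 k C hk hC).mul_left 2).add ((ψ.2 k C hk hC).mul_left 2))
  rw [Summable.tsum_add ((φ.2 k C hk hC).mul_left 2) ((ψ.2 k C hk hC).mul_left 2), tsum_mul_left,
    tsum_mul_left, ← wNorm_sq, ← wNorm_sq, ← wNorm_sq] at h3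
  rw [← wNorm_sq]
  nlinarith [mul_nonneg h1 h2]

lemma wNorm_neg (k C : ℝ) (φ : HidaTest) : wNorm k C (-φ : HidaTest) = wNorm k C φ := by
  simp [wNorm]

lemma wNorm_zero (k C : ℝ) : wNorm k C (0 : HidaTest) = 0 := by
  simp [wNorm]

lemma eq_zero_of_wNorm_le_zero {k C : ℝ} (hk : 0 < k) (hC : 0 < C) {φ : HidaTest}
    (h : wNorm k C φ ≤ 0) : φ = 0 := by
  have h0 : ∑' A, ‖(φ : (ℕ →₀ ℕ) → ℂ) A‖ ^ 2 * fockWeight k C A = 0 := by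
    rw [← wNorm_sq, le_antisymm h (wNorm_nonneg _ _ _)]; norm_num
  have h1 := (hasSum_zero_iff_of_nonneg fun A => wTerm_nonneg k C φ A).1
    (h0 ▸ (φ.2 k C hk hC).hasSum)
  ext A
  have := congrFun h1 A
  simpa [(fockWeight_pos hC k A).ne'] using this

/-- The basis vector `e_B`. -/
def fockBasis (B : ℕ →₀ ℕ) : HidaTest :=
  ⟨Pi.single B 1, fun k C _ _ => by
    refine summable_of_ne_finset_zero (s := {B}) (fun A hA => ?_)
    have : A ≠ B := by simpa using hA
    simp [this]⟩

lemma fockBasis_apply (B A : ℕ →₀ ℕ) :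
    (fockBasis B : (ℕ →₀ ℕ) → ℂ) A = Pi.single (M := fun _ => ℂ) B 1 A := rfl

lemma wNorm_fockBasis_sq (k C : ℝ) (B : ℕ →₀ ℕ) :
    wNorm k C (fockBasis B) ^ 2 = fockWeight k C B := by
  rw [wNorm_sq, tsum_eq_single B]
  · simp [fockBasis_apply]
  · intro A hA; simp [fockBasis_apply, hA]

open Classical in
/-- The tail `φ - ∑_{B ∈ s} λ_B e_B` tends to zero. -/
lemma exists_wNorm_tail_lt {k C : ℝ} (hk : 0 < k) (hC : 0 < C) (φ : HidaTest) {ε : ℝ}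
    (hε : 0 < ε) : ∃ s : Finset (ℕ →₀ ℕ),
      wNorm k C (φ - ∑ B ∈ s, (φ : (ℕ →₀ ℕ) → ℂ) B • fockBasis B : HidaTest) < ε := by
  have hs := φ.2 k C hk hC
  set f : (ℕ →₀ ℕ) → ℝ := fun A => ‖(φ : (ℕ →₀ ℕ) → ℂ) A‖ ^ 2 * fockWeight k C A with hf
  obtain ⟨s, hlt⟩ := (hs.hasSum.eventually (lt_mem_nhds (a := ∑' A, f A - ε ^ 2)
    (by have : 0 < ε ^ 2 := by positivity
        linarith))).exists
  refine ⟨s, ?_⟩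
  have e : ∀ A, ‖((φ - ∑ B ∈ s, (φ : (ℕ →₀ ℕ) → ℂ) B • fockBasis B : HidaTest) :
      (ℕ →₀ ℕ) → ℂ) A‖ ^ 2 * fockWeight k C A = f A - if A ∈ s then f A else 0 := fun A => by
    have : ((∑ B ∈ s, (φ : (ℕ →₀ ℕ) → ℂ) B • fockBasis B : HidaTest) : (ℕ →₀ ℕ) → ℂ) A
        = if A ∈ s then (φ : (ℕ →₀ ℕ) → ℂ) A else 0 := by
      simp [fockBasis_apply, Pi.single_apply]
    rw [Submodule.coe_sub, Pi.sub_apply, this]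
    split_ifs
    · simp
    · simp [hf]
  have hS1 : HasSum (fun A => if A ∈ s then f A else 0) (∑ A ∈ s, f A) := by
    have : HasSum (fun A => if A ∈ s then f A else 0) (∑ A ∈ s, if A ∈ s then f A else 0) :=
      hasSum_sum_of_ne_finset_zero fun A hA => by simp [hA]
    rwa [Finset.sum_congr rfl fun A hA => if_pos hA] at this
  rw [wNorm, tsum_congr e, (hs.hasSum.sub hS1).tsum_eq, Real.sqrt_lt' hε]
  linarith

lemma summable_wPair (φ ψ : HidaTest) : Summable fun A =>
    (φ : (ℕ →₀ ℕ) → ℂ) A * (ψ : (ℕ →₀ ℕ) → ℂ) A * (A.degree.factorial : ℂ) := by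
  refine Summable.of_norm_bounded ((φ.2 1 1 one_pos one_pos).add (ψ.2 1 1 one_pos one_pos))
    fun A => ?_
  have h1 : (A.degree.factorial : ℝ) ≤ fockWeight 1 1 A := by
    rw [fockWeight_eq]
    refine le_mul_of_one_le_right (degree_factorial_pos A).le ?_
    have := monom_le_monom (u := fun _ : ℕ => (1 : ℝ)) (v := fun j => 1 ^ 2 * mu j ^ (2 * (1 : ℝ)))
      (fun _ => zero_le_one) (fun j => by
        rw [one_pow, one_mul]; exact Real.one_le_rpow (one_le_mu j) (by norm_num)) A
    simpa [monom_const] using this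
  rw [norm_mul, norm_mul, Complex.norm_natCast, ← add_mul]
  refine mul_le_mul ?_ h1 (degree_factorial_pos A).le (by positivity)
  nlinarith [sq_nonneg (‖(φ : (ℕ →₀ ℕ) → ℂ) A‖ - ‖(ψ : (ℕ →₀ ℕ) → ℂ) A‖),
    sq_nonneg (‖(φ : (ℕ →₀ ℕ) → ℂ) A‖), sq_nonneg (‖(ψ : (ℕ →₀ ℕ) → ℂ) A‖)]

lemma wPair_add (φ φ' ψ : HidaTest) : wPair (φ + φ') ψ = wPair φ ψ + wPair φ' ψ := by
  unfold wPair
  rw [← (summable_wPair φ ψ).tsum_add (summable_wPair φ' ψ)]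
  refine tsum_congr fun A => ?_
  simp only [Submodule.coe_add, Pi.add_apply]; ring

lemma wPair_neg (φ ψ : HidaTest) : wPair (-φ) ψ = -wPair φ ψ := by
  unfold wPair
  rw [← tsum_neg]
  refine tsum_congr fun A => ?_
  simp only [Submodule.coe_neg, Pi.neg_apply]; ring

end FockNorms

/-! ### Sums of continuous operators -/

section OperatorAlgebra

variable {n : ℕ}

lemma symbol_add (X Y : MultiOp n) (ξ : Fin n → TestFun) (η : TestFun) :
    symbol (X + Y) ξ η = symbol X ξ η + symbol Y ξ η := wPair_add _ _ _

lemma symbol_sub (X Y : MultiOp n) (ξ : Fin n → TestFun) (η : TestFun) :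
    symbol (X - Y) ξ η = symbol X ξ η - symbol Y ξ η := by
  have : (X - Y) (fun i => coherent (ξ i)) =
      X (fun i => coherent (ξ i)) + -Y (fun i => coherent (ξ i)) := by
    rw [sub_apply, sub_eq_add_neg]
  rw [symbol, this, wPair_add, wPair_neg, ← sub_eq_add_neg]; rfl

lemma symbol_zero (ξ : Fin n → TestFun) (η : TestFun) : symbol (0 : MultiOp n) ξ η = 0 := by
  simp [symbol, wPair]

lemma symbol_sum {κ : Type*} (Y : κ → MultiOp n) (S : Finset κ) (ξ : Fin n → TestFun)
    (η : TestFun) : symbol (∑ j ∈ S, Y j) ξ η = ∑ j ∈ S, symbol (Y j) ξ η := by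
  classical
  induction S using Finset.induction_on with
  | empty => simp [symbol_zero]
  | insert a s ha ih => rw [Finset.sum_insert ha, Finset.sum_insert ha, symbol_add, ih]

lemma isContinuousOp_zero : IsContinuousOp (0 : MultiOp n) := fun k C _ _ =>
  ⟨1, 1, 1, one_pos, one_pos, one_pos, fun φ => by
    rw [zero_apply, wNorm_zero, one_mul]
    exact Finset.prod_nonneg fun i _ => wNorm_nonneg _ _ _⟩

lemma IsContinuousOp.add {X Y : MultiOp n} (hX : IsContinuousOp X) (hY : IsContinuousOp Y) :
    IsContinuousOp (X + Y) := by
  intro k C hk hC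
  obtain ⟨k₂, C₂, K₂, hk₂, hC₂, hK₂, hX⟩ := hX k C hk hC
  obtain ⟨k₃, C₃, K₃, hk₃, hC₃, hK₃, hY⟩ := hY k C hk hC
  refine ⟨max k₂ k₃, max C₂ C₃, 2 * (K₂ + K₃), lt_max_of_lt_left hk₂, lt_max_of_lt_left hC₂,
    by positivity, fun φ => ?_⟩
  have h1 := (hX φ).trans (mul_le_mul_of_nonneg_left (Finset.prod_le_prod
    (fun i _ => wNorm_nonneg _ _ _)
    fun i _ => wNorm_mono hk₂ hC₂ (le_max_left k₂ k₃) (le_max_left C₂ C₃) (φ i)) hK₂.le)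
  have h2 := (hY φ).trans (mul_le_mul_of_nonneg_left (Finset.prod_le_prod
    (fun i _ => wNorm_nonneg _ _ _)
    fun i _ => wNorm_mono hk₃ hC₃ (le_max_right k₂ k₃) (le_max_right C₂ C₃) (φ i)) hK₃.le)
  refine (wNorm_add_le hk hC (X φ) (Y φ)).trans ?_
  linarith

lemma IsContinuousOp.neg {X : MultiOp n} (hX : IsContinuousOp X) : IsContinuousOp (-X) := by
  intro k C hk hC
  obtain ⟨k₂, C₂, K₂, hk₂, hC₂, hK₂, hX⟩ := hX k C hk hC
  refine ⟨k₂, C₂, K₂, hk₂, hC₂, hK₂, fun φ => ?_⟩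
  rw [neg_apply, wNorm_neg]
  exact hX φ

lemma IsContinuousOp.sub {X Y : MultiOp n} (hX : IsContinuousOp X) (hY : IsContinuousOp Y) :
    IsContinuousOp (X - Y) := by
  have : X - Y = X + -Y := MultilinearMap.ext fun φ => sub_eq_add_neg (X φ) (Y φ)
  rw [this]; exact hX.add hY.neg

lemma IsContinuousOp.sum {κ : Type*} {Y : κ → MultiOp n} (hY : ∀ j, IsContinuousOp (Y j))
    (S : Finset κ) : IsContinuousOp (∑ j ∈ S, Y j) := by
  classical
  induction S using Finset.induction_on with
  | empty => simpa using isContinuousOp_zero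
  | insert a s ha ih => rw [Finset.sum_insert ha]; exact (hY a).add ih

/-- A continuous operator that vanishes on the basis vectors is zero. The induction is on the set of
arguments that are not required to be basis vectors. -/
lemma IsContinuousOp.eq_zero {Z : MultiOp n} (hZ : IsContinuousOp Z)
    (h : ∀ B : Fin n → ℕ →₀ ℕ, Z (fun i => fockBasis (B i)) = 0) : Z = 0 := by
  classical
  have key : ∀ (S : Finset (Fin n)) (φ : Fin n → HidaTest),
      (∀ i ∉ S, ∃ B, φ i = fockBasis B) → Z φ = 0 := by
    intro S
    induction S using Finset.induction_on with
    | empty =>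
      intro φ hφ
      choose B hB using fun i => hφ i (Finset.notMem_empty i)
      rw [funext hB]; exact h B
    | insert j S hj ih =>
      intro φ hφ
      obtain ⟨k₂, C₂, K₂, hk₂, hC₂, hK₂, hb⟩ := hZ 1 1 one_pos one_pos
      have hbasis : ∀ B, Z (Function.update φ j (fockBasis B)) = 0 := fun B => by
        refine ih _ fun i hi => ?_
        by_cases hij : i = j
        · subst hij; exact ⟨B, by simp⟩
        · rw [Function.update_of_ne hij]
          exact hφ i (by simp [hij, hi])
      refine eq_zero_of_wNorm_le_zero one_pos one_pos (le_of_forall_pos_le_add fun ε hε => ?_)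
      set P := K₂ * ∏ i ∈ univ.erase j, wNorm k₂ C₂ (φ i) with hP
      have hP0 : 0 ≤ P := mul_nonneg hK₂.le (Finset.prod_nonneg fun i _ => wNorm_nonneg _ _ _)
      obtain ⟨s, hs⟩ := exists_wNorm_tail_lt hk₂ hC₂ (φ j) (ε := ε / (P + 1)) (by positivity)
      set ψ := φ j - ∑ B ∈ s, (φ j : (ℕ →₀ ℕ) → ℂ) B • fockBasis B with hψ
      have h1 : Z φ = Z (Function.update φ j ψ) := by
        have e : Z (Function.update φ j (∑ B ∈ s, (φ j : (ℕ →₀ ℕ) → ℂ) B • fockBasis B)) = 0 := by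
          rw [MultilinearMap.map_update_sum]
          refine Finset.sum_eq_zero fun B _ => ?_
          rw [MultilinearMap.map_update_smul, hbasis, smul_zero]
        rw [hψ, MultilinearMap.map_update_sub, e, sub_zero, Function.update_eq_self]
      rw [h1, zero_add]
      refine (hb _).trans ?_
      rw [← Finset.mul_prod_erase univ _ (mem_univ j), Function.update_self]
      have e : ∏ i ∈ univ.erase j, wNorm k₂ C₂ (Function.update φ j ψ i)
          = ∏ i ∈ univ.erase j, wNorm k₂ C₂ (φ i) :=
        Finset.prod_congr rfl fun i hi => by rw [Function.update_of_ne (Finset.ne_of_mem_erase hi)]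
      rw [e]
      calc K₂ * (wNorm k₂ C₂ ψ * ∏ i ∈ univ.erase j, wNorm k₂ C₂ (φ i))
          = P * wNorm k₂ C₂ ψ := by rw [hP]; ring
        _ ≤ P * (ε / (P + 1)) := mul_le_mul_of_nonneg_left hs.le hP0
        _ ≤ ε := by
            rw [mul_div_assoc', div_le_iff₀ (by positivity)]
            nlinarith
  ext1 φ
  exact key univ φ fun i hi => absurd (mem_univ i) hi

end OperatorAlgebra

/-! ### Operators and Hilbert–Schmidt matrices -/

section Matrices

variable {n : ℕ}

/-- A multi-index on arrays is a multi-index `A` in `η` and multi-indices `B^i` in the `ξ^i`. -/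
def splitIndex (n : ℕ) : (Idx n →₀ ℕ) ≃ (ℕ →₀ ℕ) × (Fin n → ℕ →₀ ℕ) :=
  Finsupp.curryEquiv.trans (Finsupp.equivFunOnFinite.trans Equiv.piOptionEquivProd)

lemma prod_splitIndex {R : Type*} [CommMonoid R] (α : Idx n →₀ ℕ) (g : Idx n → ℕ → R)
    (h0 : ∀ p, g p 0 = 1) :
    α.prod g = ((splitIndex n α).1.prod fun j r => g (none, j) r) *
      ∏ i, ((splitIndex n α).2 i).prod fun j r => g (some i, j) r := by
  classical
  set S := α.support.image Prod.snd with hS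
  have h1 : α.support ⊆ univ ×ˢ S := fun p hp =>
    Finset.mem_product.2 ⟨mem_univ _, Finset.mem_image_of_mem _ hp⟩
  rw [Finsupp.prod_of_support_subset α h1 g fun p _ => h0 p, Finset.prod_product,
    Fintype.prod_option]
  have hsub : ∀ o j, α (o, j) ≠ 0 → j ∈ S := fun o j h =>
    Finset.mem_image.2 ⟨(o, j), Finsupp.mem_support_iff.2 h, rfl⟩
  rw [Finsupp.prod_of_support_subset (splitIndex n α).1 (s := S) (fun j hj =>
    hsub none j ((Finsupp.mem_support_iff (f := (splitIndex n α).1)).1 hj)) _ fun j _ => h0 _]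
  congr 1
  refine Finset.prod_congr rfl fun i _ => ?_
  rw [Finsupp.prod_of_support_subset ((splitIndex n α).2 i) (s := S) (fun j hj =>
    hsub (some i) j ((Finsupp.mem_support_iff (f := (splitIndex n α).2 i)).1 hj)) _ fun j _ => h0 _]
  rfl

lemma monom_splitIndex {R : Type*} [CommMonoid R] (u : Idx n → R) (α : Idx n →₀ ℕ) :
    monom u α = monom (fun j => u (none, j)) (splitIndex n α).1 *
      ∏ i, monom (fun j => u (some i, j)) ((splitIndex n α).2 i) :=
  prod_splitIndex α (fun p r => u p ^ r) fun _ => pow_zero _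

lemma mfac_splitIndex (α : Idx n →₀ ℕ) :
    mfac α = mfac (splitIndex n α).1 * ∏ i, mfac ((splitIndex n α).2 i) :=
  prod_splitIndex α (fun _ r => (r.factorial : ℝ)) fun p => by simp

/-- The factor between the matrix entries of an operator in the bases `e_A` and the Taylor
coefficients of its symbol. -/
def symbolFactor (q : (ℕ →₀ ℕ) × (Fin n → ℕ →₀ ℕ)) : ℝ :=
  fockNormalizer q.1 * q.1.degree.factorial * ∏ i, fockNormalizer (q.2 i)

lemma symbolFactor_pos (q : (ℕ →₀ ℕ) × (Fin n → ℕ →₀ ℕ)) : 0 < symbolFactor q :=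
  mul_pos (mul_pos (fockNormalizer_pos _) (degree_factorial_pos _))
    (Finset.prod_pos fun _ _ => fockNormalizer_pos _)

/-- The Taylor coefficients of the symbol of the operator with the matrix entries
`x (A, B) = ⟨Ξ(e_{B¹}, …, e_{Bⁿ})⟩_A`. -/
def coeffOfMatrix (x : (ℕ →₀ ℕ) × (Fin n → ℕ →₀ ℕ) → ℂ) (α : Idx n →₀ ℕ) : ℂ :=
  x (splitIndex n α) * symbolFactor (splitIndex n α)

/-- The terms of the squared Hilbert–Schmidt norm of a matrix, between the Fock space with the
weight `(k, C)` and the tensor product of those with the weight `(k₂, C₂)`. -/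
def matrixTerm (x : (ℕ →₀ ℕ) × (Fin n → ℕ →₀ ℕ) → ℂ) (k C k₂ C₂ : ℝ)
    (q : (ℕ →₀ ℕ) × (Fin n → ℕ →₀ ℕ)) : ℝ :=
  ‖x q‖ ^ 2 * fockWeight k C q.1 / ∏ i, fockWeight k₂ C₂ (q.2 i)

lemma matrixTerm_nonneg (x : (ℕ →₀ ℕ) × (Fin n → ℕ →₀ ℕ) → ℂ) (k C k₂ C₂ : ℝ)
    (q : (ℕ →₀ ℕ) × (Fin n → ℕ →₀ ℕ)) : 0 ≤ matrixTerm x k C k₂ C₂ q :=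
  div_nonneg (mul_nonneg (sq_nonneg _) (fockWeight_nonneg _ _ _))
    (Finset.prod_nonneg fun _ _ => fockWeight_nonneg _ _ _)

/-- Up to reindexing, the weighted `ℓ²` norm of the Taylor coefficients of a symbol is a
Hilbert–Schmidt norm of the operator. -/
lemma hsTerm_coeffOfMatrix (x : (ℕ →₀ ℕ) × (Fin n → ℕ →₀ ℕ) → ℂ) {k C k₂ C₂ : ℝ} (hC₂ : 0 < C₂)
    (α : Idx n →₀ ℕ) :
    hsTerm (coeffOfMatrix x) (wt n (C ^ 2) k (C₂ ^ 2)⁻¹ (-k₂)) α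
      = matrixTerm x k C k₂ C₂ (splitIndex n α) := by
  unfold hsTerm coeffOfMatrix matrixTerm symbolFactor
  rw [mfac_splitIndex, monom_splitIndex]
  obtain ⟨A, B⟩ := splitIndex n α
  simp only [wt, Option.elim_none, Option.elim_some]
  have hA := fockNormalizer_sq A
  have hB : ∀ i, fockNormalizer (B i) ^ 2 *
      (mfac (B i) * monom (fun j => (C₂ ^ 2)⁻¹ * mu j ^ (2 * -k₂)) (B i))
      = (fockWeight k₂ C₂ (B i))⁻¹ := fun i => by
    have e : monom (fun j => (C₂ ^ 2)⁻¹ * mu j ^ (2 * -k₂)) (B i)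
        = (monom (fun j => C₂ ^ 2 * mu j ^ (2 * k₂)) (B i))⁻¹ := by
      rw [← monom_inv]
      congr 1
      funext j
      rw [mul_neg, Real.rpow_neg (mu_pos j).le, mul_inv]
    have h1 := fockNormalizer_sq (B i)
    have h2 := (degree_factorial_pos (B i)).ne'
    have h3 := (monom_pos (sobolevWeight_pos hC₂ k₂) (B i)).ne'
    rw [e, fockWeight_eq]
    field_simp
    linarith
  have hBp : (∏ i, fockNormalizer (B i)) ^ 2 * ((∏ i, mfac (B i)) *
      ∏ i, monom (fun j => (C₂ ^ 2)⁻¹ * mu j ^ (2 * -k₂)) (B i))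
      = (∏ i, fockWeight k₂ C₂ (B i))⁻¹ := by
    rw [← Finset.prod_pow, ← Finset.prod_mul_distrib, ← Finset.prod_mul_distrib,
      ← Finset.prod_inv_distrib]
    exact Finset.prod_congr rfl fun i _ => hB i
  rw [norm_mul, Complex.norm_real, Real.norm_eq_abs, mul_pow, sq_abs, fockWeight_eq k C A,
    div_eq_mul_inv, ← hBp]
  calc _ = ‖x (A, B)‖ ^ 2 * ((fockNormalizer A ^ 2 * (mfac A * A.degree.factorial)) *
        (A.degree.factorial * monom (fun j => C ^ 2 * mu j ^ (2 * k)) A)) *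
        ((∏ i, fockNormalizer (B i)) ^ 2 * ((∏ i, mfac (B i)) *
      ∏ i, monom (fun j => (C₂ ^ 2)⁻¹ * mu j ^ (2 * -k₂)) (B i))) := by ring
    _ = _ := by rw [hA, one_mul]

lemma summable_matrixTerm_iff (x : (ℕ →₀ ℕ) × (Fin n → ℕ →₀ ℕ) → ℂ) {k C k₂ C₂ : ℝ} (hC₂ : 0 < C₂) :
    Summable (hsTerm (coeffOfMatrix x) (wt n (C ^ 2) k (C₂ ^ 2)⁻¹ (-k₂))) ↔
      Summable (matrixTerm x k C k₂ C₂) := by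
  rw [← (splitIndex n).summable_iff]
  exact summable_congr fun α => hsTerm_coeffOfMatrix x hC₂ α

lemma tsum_matrixTerm (x : (ℕ →₀ ℕ) × (Fin n → ℕ →₀ ℕ) → ℂ) {k C k₂ C₂ : ℝ} (hC₂ : 0 < C₂) :
    ∑' α, hsTerm (coeffOfMatrix x) (wt n (C ^ 2) k (C₂ ^ 2)⁻¹ (-k₂)) α
      = ∑' q, matrixTerm x k C k₂ C₂ q := by
  rw [← (splitIndex n).tsum_eq]
  exact tsum_congr fun α => hsTerm_coeffOfMatrix x hC₂ α

lemma summable_prod_fin {Y : Type*} {f : Fin n → Y → ℝ} (h0 : ∀ i y, 0 ≤ f i y)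
    (hs : ∀ i, Summable (f i)) :
    Summable (fun B : Fin n → Y => ∏ i, f i (B i)) ∧
      ∑' B : Fin n → Y, ∏ i, f i (B i) ≤ ∏ i, ∑' y, f i y := by
  classical
  have key : ∀ s : Finset (Fin n → Y), ∑ B ∈ s, ∏ i, f i (B i) ≤ ∏ i, ∑' y, f i y := by
    intro s
    calc ∑ B ∈ s, ∏ i, f i (B i)
        ≤ ∑ B ∈ Fintype.piFinset fun i => s.image fun B => B i, ∏ i, f i (B i) := by
          refine Finset.sum_le_sum_of_subset_of_nonneg (fun B hB => ?_)
            fun B _ _ => Finset.prod_nonneg fun i _ => h0 i _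
          exact Fintype.mem_piFinset.2 fun i => Finset.mem_image_of_mem (fun B => B i) hB
      _ = ∏ i, ∑ y ∈ s.image fun B => B i, f i y := (Finset.prod_univ_sum _ _).symm
      _ ≤ ∏ i, ∑' y, f i y := Finset.prod_le_prod (fun i _ => Finset.sum_nonneg fun y _ => h0 i y)
          fun i _ => (hs i).sum_le_tsum _ fun y _ => h0 i y
  have h := summable_of_sum_le (fun B => Finset.prod_nonneg fun i _ => h0 i _) key
  exact ⟨h, h.tsum_le_of_sum_le key⟩

/-- The Cauchy–Schwarz inequality for the rows of a matrix with finite Hilbert–Schmidt norm. -/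
lemma row_estimate {x : (ℕ →₀ ℕ) × (Fin n → ℕ →₀ ℕ) → ℂ} {k C k₂ C₂ : ℝ}
    (hC : 0 < C) (hk₂ : 0 < k₂) (hC₂ : 0 < C₂) (hx : Summable (matrixTerm x k C k₂ C₂))
    (φ : Fin n → HidaTest) (A : ℕ →₀ ℕ) :
    Summable (fun B : Fin n → ℕ →₀ ℕ => x (A, B) * ∏ i, (φ i : (ℕ →₀ ℕ) → ℂ) (B i)) ∧
    ‖∑' B : Fin n → ℕ →₀ ℕ, x (A, B) * ∏ i, (φ i : (ℕ →₀ ℕ) → ℂ) (B i)‖ ^ 2 * fockWeight k C A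
      ≤ (∑' B, matrixTerm x k C k₂ C₂ (A, B)) * ∏ i, wNorm k₂ C₂ (φ i) ^ 2 := by
  have hW : ∀ B : Fin n → ℕ →₀ ℕ, 0 < ∏ i, fockWeight k₂ C₂ (B i) := fun B =>
    Finset.prod_pos fun i _ => fockWeight_pos hC₂ _ _
  have hA := fockWeight_pos hC k A
  set a : (Fin n → ℕ →₀ ℕ) → ℝ := fun B => ‖x (A, B)‖ * √(∏ i, fockWeight k₂ C₂ (B i))⁻¹ with ha
  set b : (Fin n → ℕ →₀ ℕ) → ℝ := fun B =>
    √(∏ i, fockWeight k₂ C₂ (B i)) * ∏ i, ‖(φ i : (ℕ →₀ ℕ) → ℂ) (B i)‖ with hb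
  have ea : ∀ B, a B ^ 2 = matrixTerm x k C k₂ C₂ (A, B) * (fockWeight k C A)⁻¹ := fun B => by
    simp only [ha, mul_pow, Real.sq_sqrt (inv_pos.2 (hW B)).le, matrixTerm]
    field_simp
  have eb : ∀ B, b B ^ 2 = ∏ i, ‖(φ i : (ℕ →₀ ℕ) → ℂ) (B i)‖ ^ 2 * fockWeight k₂ C₂ (B i) :=
    fun B => by
    simp only [hb, mul_pow, Real.sq_sqrt (hW B).le, Finset.prod_mul_distrib, ← Finset.prod_pow]
    ring
  have eab : ∀ B, a B * b B = ‖x (A, B) * ∏ i, (φ i : (ℕ →₀ ℕ) → ℂ) (B i)‖ := fun B => by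
    have := (Real.sqrt_pos.2 (hW B)).ne'
    simp only [ha, hb, Real.sqrt_inv, norm_mul, norm_prod]
    field_simp
  obtain ⟨h1, h2⟩ := summable_prod_fin
    (f := fun i B => ‖(φ i : (ℕ →₀ ℕ) → ℂ) B‖ ^ 2 * fockWeight k₂ C₂ B)
    (fun i B => wTerm_nonneg _ _ _ _) fun i => (φ i).2 k₂ C₂ hk₂ hC₂
  have hrow : Summable fun B => matrixTerm x k C k₂ C₂ (A, B) := hx.prod_factor A
  obtain ⟨h3, h4⟩ := cauchy_schwarz_tsum (a := a) (b := b) (fun B => by positivity)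
    (fun B => by positivity) ((hrow.mul_right _).congr fun B => (ea B).symm)
    (h1.congr fun B => (eb B).symm)
  simp only [eab] at h3 h4
  refine ⟨h3.of_norm, ?_⟩
  simp only [ea, eb, tsum_mul_right] at h4
  have h5 : ‖∑' B : Fin n → ℕ →₀ ℕ, x (A, B) * ∏ i, (φ i : (ℕ →₀ ℕ) → ℂ) (B i)‖ ^ 2
      ≤ (∑' B, matrixTerm x k C k₂ C₂ (A, B)) * (fockWeight k C A)⁻¹ *
        ∏ i, wNorm k₂ C₂ (φ i) ^ 2 := by
    refine (pow_le_pow_left₀ (norm_nonneg _) (norm_tsum_le_tsum_norm h3) 2).trans (h4.trans ?_)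
    refine mul_le_mul_of_nonneg_left (h2.trans (le_of_eq ?_)) (mul_nonneg (tsum_nonneg fun B =>
      matrixTerm_nonneg _ _ _ _ _ _) (inv_pos.2 hA).le)
    exact Finset.prod_congr rfl fun i _ => (wNorm_sq _ _ _).symm
  calc _ ≤ (∑' B, matrixTerm x k C k₂ C₂ (A, B)) * (fockWeight k C A)⁻¹ *
        (∏ i, wNorm k₂ C₂ (φ i) ^ 2) * fockWeight k C A := mul_le_mul_of_nonneg_right h5 hA.le
    _ = _ := by field_simp

/-- Hilbert–Schmidt matrices define bounded multilinear maps. -/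
lemma output_estimate {x : (ℕ →₀ ℕ) × (Fin n → ℕ →₀ ℕ) → ℂ} {k C k₂ C₂ : ℝ}
    (hC : 0 < C) (hk₂ : 0 < k₂) (hC₂ : 0 < C₂) (hx : Summable (matrixTerm x k C k₂ C₂))
    (φ : Fin n → HidaTest) :
    Summable (fun A => ‖∑' B : Fin n → ℕ →₀ ℕ, x (A, B) * ∏ i, (φ i : (ℕ →₀ ℕ) → ℂ) (B i)‖ ^ 2 *
      fockWeight k C A) ∧
    ∑' A, ‖∑' B : Fin n → ℕ →₀ ℕ, x (A, B) * ∏ i, (φ i : (ℕ →₀ ℕ) → ℂ) (B i)‖ ^ 2 *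
      fockWeight k C A ≤ (∑' q, matrixTerm x k C k₂ C₂ q) * ∏ i, wNorm k₂ C₂ (φ i) ^ 2 := by
  have h1 := fun A => (row_estimate hC hk₂ hC₂ hx φ A).2
  have h2 : Summable fun A => (∑' B, matrixTerm x k C k₂ C₂ (A, B)) * ∏ i, wNorm k₂ C₂ (φ i) ^ 2 :=
    hx.prod.mul_right _
  have h3 := Summable.of_nonneg_of_le
    (fun A => mul_nonneg (sq_nonneg _) (fockWeight_nonneg _ _ _)) h1 h2
  refine ⟨h3, (h3.tsum_le_tsum h1 h2).trans ?_⟩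
  rw [tsum_mul_right, hx.tsum_prod]

/-- For every weight of the target the matrix is Hilbert–Schmidt for some weight of the sources.
These are the matrices of the continuous operators. -/
def IsRegularMatrix (x : (ℕ →₀ ℕ) × (Fin n → ℕ →₀ ℕ) → ℂ) : Prop :=
  ∀ k C : ℝ, 0 < k → 0 < C → ∃ k₂ C₂ : ℝ, 0 < k₂ ∧ 0 < C₂ ∧ Summable (matrixTerm x k C k₂ C₂)

lemma isRegular_coeffOfMatrix_iff (x : (ℕ →₀ ℕ) × (Fin n → ℕ →₀ ℕ) → ℂ) :
    IsRegular (coeffOfMatrix x) ↔ IsRegularMatrix x := by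
  constructor
  · intro h k C hk hC
    obtain ⟨k₂, C₂, hk₂, hC₂, hs⟩ := h k C hk hC
    exact ⟨k₂, C₂, hk₂, hC₂, (summable_matrixTerm_iff x hC₂).1 hs⟩
  · intro h k C hk hC
    obtain ⟨k₂, C₂, hk₂, hC₂, hs⟩ := h k C hk hC
    exact ⟨k₂, C₂, hk₂, hC₂, (summable_matrixTerm_iff x hC₂).2 hs⟩

lemma IsRegularMatrix.summable_row {x : (ℕ →₀ ℕ) × (Fin n → ℕ →₀ ℕ) → ℂ} (hx : IsRegularMatrix x)
    (φ : Fin n → HidaTest) (A : ℕ →₀ ℕ) :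
    Summable fun B : Fin n → ℕ →₀ ℕ => x (A, B) * ∏ i, (φ i : (ℕ →₀ ℕ) → ℂ) (B i) := by
  obtain ⟨k₂, C₂, hk₂, hC₂, hs⟩ := hx 1 1 one_pos one_pos
  exact (row_estimate one_pos hk₂ hC₂ hs φ A).1

/-- The monomial `φ ↦ ∏ λ_{B^i}(φ^i)` as a multilinear form. -/
def coordForm (B : Fin n → ℕ →₀ ℕ) : MultilinearMap ℂ (fun _ : Fin n => HidaTest) ℂ :=
  (MultilinearMap.mkPiAlgebra ℂ (Fin n) ℂ).compLinearMap
    fun i => (LinearMap.proj (B i)).comp HidaTest.subtype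

lemma coordForm_apply (B : Fin n → ℕ →₀ ℕ) (φ : Fin n → HidaTest) :
    coordForm B φ = ∏ i, (φ i : (ℕ →₀ ℕ) → ℂ) (B i) := by
  simp [coordForm]

/-- The operator with a given matrix. -/
def opOfMatrix (x : (ℕ →₀ ℕ) × (Fin n → ℕ →₀ ℕ) → ℂ) (hx : IsRegularMatrix x) : MultiOp n where
  toFun φ := ⟨fun A => ∑' B, x (A, B) * coordForm B φ, fun k C hk hC => by
    obtain ⟨k₂, C₂, hk₂, hC₂, hs⟩ := hx k C hk hC
    simp only [coordForm_apply]
    exact (output_estimate hC hk₂ hC₂ hs φ).1⟩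
  map_update_add' {inst} φ i a b := by
    have hs : ∀ (φ : Fin n → HidaTest) A, Summable fun B => x (A, B) * coordForm B φ :=
        fun φ A => by
      simpa only [coordForm_apply] using hx.summable_row φ A
    ext A
    change ∑' B, x (A, B) * coordForm B (Function.update φ i (a + b)) =
      ∑' B, x (A, B) * coordForm B (Function.update φ i a) +
        ∑' B, x (A, B) * coordForm B (Function.update φ i b)
    rw [← (hs _ A).tsum_add (hs _ A)]
    refine tsum_congr fun B => ?_
    rw [MultilinearMap.map_update_add, mul_add]
  map_update_smul' {inst} φ i c a := by
    ext A
    change ∑' B, x (A, B) * coordForm B (Function.update φ i (c • a)) =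
      c * ∑' B, x (A, B) * coordForm B (Function.update φ i a)
    rw [← tsum_mul_left]
    refine tsum_congr fun B => ?_
    rw [MultilinearMap.map_update_smul, smul_eq_mul]; ring

lemma opOfMatrix_apply {x : (ℕ →₀ ℕ) × (Fin n → ℕ →₀ ℕ) → ℂ} (hx : IsRegularMatrix x)
    (φ : Fin n → HidaTest) (A : ℕ →₀ ℕ) :
    (opOfMatrix x hx φ : (ℕ →₀ ℕ) → ℂ) A = ∑' B, x (A, B) * ∏ i, (φ i : (ℕ →₀ ℕ) → ℂ) (B i) := by
  change ∑' B, x (A, B) * coordForm B φ = _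
  simp only [coordForm_apply]

lemma wNorm_opOfMatrix_sq_le {x : (ℕ →₀ ℕ) × (Fin n → ℕ →₀ ℕ) → ℂ} (hx : IsRegularMatrix x)
    {k C k₂ C₂ : ℝ} (hC : 0 < C) (hk₂ : 0 < k₂) (hC₂ : 0 < C₂)
    (hs : Summable (matrixTerm x k C k₂ C₂)) (φ : Fin n → HidaTest) :
    wNorm k C (opOfMatrix x hx φ) ^ 2 ≤
      (∑' q, matrixTerm x k C k₂ C₂ q) * ∏ i, wNorm k₂ C₂ (φ i) ^ 2 := by
  rw [wNorm_sq]
  simp only [opOfMatrix_apply]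
  exact (output_estimate hC hk₂ hC₂ hs φ).2

lemma isContinuousOp_opOfMatrix {x : (ℕ →₀ ℕ) × (Fin n → ℕ →₀ ℕ) → ℂ} (hx : IsRegularMatrix x) :
    IsContinuousOp (opOfMatrix x hx) := by
  intro k C hk hC
  obtain ⟨k₂, C₂, hk₂, hC₂, hs⟩ := hx k C hk hC
  have h0 : 0 ≤ ∑' q, matrixTerm x k C k₂ C₂ q := tsum_nonneg fun q => matrixTerm_nonneg _ _ _ _ _ q
  refine ⟨k₂, C₂, √(∑' q, matrixTerm x k C k₂ C₂ q) + 1, hk₂, hC₂, by positivity, fun φ => ?_⟩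
  have hP : 0 ≤ ∏ i, wNorm k₂ C₂ (φ i) := Finset.prod_nonneg fun i _ => wNorm_nonneg _ _ _
  have h := wNorm_opOfMatrix_sq_le hx hC hk₂ hC₂ hs φ
  rw [Finset.prod_pow] at h
  have h1 : wNorm k C (opOfMatrix x hx φ) ≤
      √(∑' q, matrixTerm x k C k₂ C₂ q) * ∏ i, wNorm k₂ C₂ (φ i) := by
    refine le_of_sq_le_sq ?_ (by positivity)
    rwa [mul_pow, Real.sq_sqrt h0]
  linarith

/-- The matrix of an operator in the bases `e_A`. -/
def matrixOf (X : MultiOp n) (q : (ℕ →₀ ℕ) × (Fin n → ℕ →₀ ℕ)) : ℂ :=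
  (X fun i => fockBasis (q.2 i) : (ℕ →₀ ℕ) → ℂ) q.1

lemma matrixOf_opOfMatrix {x : (ℕ →₀ ℕ) × (Fin n → ℕ →₀ ℕ) → ℂ} (hx : IsRegularMatrix x) :
    matrixOf (opOfMatrix x hx) = x := by
  classical
  funext ⟨A, B⟩
  rw [matrixOf, opOfMatrix_apply, tsum_eq_single B]
  · simp [fockBasis_apply]
  · intro B' hB'
    obtain ⟨i, hi⟩ : ∃ i, B' i ≠ B i := by
      by_contra! h; exact hB' (funext h)
    rw [Finset.prod_eq_zero (mem_univ i), mul_zero]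
    simp only [fockBasis_apply]
    exact Pi.single_eq_of_ne hi _

/-- The Hilbert–Schmidt norm of an operator that is bounded from the weight `(k₂, C₂)`, computed
on the larger weight `(k₂ + 1, C₂)` for the arguments. -/
lemma summable_matrixTerm_of_bound {X : MultiOp n} {k C k₂ C₂ K₂ : ℝ} (hk : 0 < k) (hC : 0 < C)
    (hC₂ : 0 < C₂) (hb : ∀ φ : Fin n → HidaTest, wNorm k C (X φ) ≤ K₂ * ∏ i, wNorm k₂ C₂ (φ i)) :
    Summable fun q : (Fin n → ℕ →₀ ℕ) × (ℕ →₀ ℕ) =>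
      matrixTerm (matrixOf X) k C (k₂ + 1) C₂ (q.2, q.1) := by
  have h1 := (summable_prod_fin (n := n)
    (f := fun _ B => fockWeight k₂ C₂ B / fockWeight (k₂ + 1) C₂ B)
    (fun i B => div_nonneg (fockWeight_nonneg _ _ _) (fockWeight_nonneg _ _ _))
    fun _ => summable_fockWeight_ratio k₂ hC₂).1
  rw [summable_prod_of_nonneg fun q => matrixTerm_nonneg _ _ _ _ _ _]
  have hm : ∀ φ : Fin n → HidaTest, Summable fun A => ‖(X φ : (ℕ →₀ ℕ) → ℂ) A‖ ^ 2 *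
      fockWeight k C A := fun φ => (X φ).2 k C hk hC
  unfold matrixTerm matrixOf
  refine ⟨fun B => (hm fun i => fockBasis (B i)).div_const (∏ i, fockWeight (k₂ + 1) C₂ (B i)), ?_⟩
  simp only [tsum_div_const, ← wNorm_sq]
  refine Summable.of_nonneg_of_le (fun B => div_nonneg (sq_nonneg _)
    (Finset.prod_nonneg fun i _ => fockWeight_nonneg _ _ _)) (fun B => ?_) (h1.mul_left (K₂ ^ 2))
  have h2 := pow_le_pow_left₀ (wNorm_nonneg _ _ _) (hb fun i => fockBasis (B i)) 2
  rw [mul_pow, ← Finset.prod_pow] at h2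
  simp only [wNorm_fockBasis_sq] at h2
  rw [Finset.prod_div_distrib, ← mul_div_assoc]
  exact div_le_div_of_nonneg_right h2 (Finset.prod_nonneg fun i _ => fockWeight_nonneg _ _ _)

/-- Continuous operators are Hilbert–Schmidt between suitable Fock spaces, by nuclearity. -/
lemma IsContinuousOp.isRegularMatrix {X : MultiOp n} (hX : IsContinuousOp X) :
    IsRegularMatrix (matrixOf X) := by
  intro k C hk hC
  obtain ⟨k₂, C₂, K₂, hk₂, hC₂, -, hb⟩ := hX k C hk hC
  have h := summable_matrixTerm_of_bound hk hC hC₂ hb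
  refine ⟨k₂ + 1, C₂, by linarith, hC₂, ?_⟩
  rw [← (Equiv.prodComm (Fin n → ℕ →₀ ℕ) (ℕ →₀ ℕ)).summable_iff]
  exact h

/-- A continuous operator is determined by its matrix. -/
theorem IsContinuousOp.eq_opOfMatrix {X : MultiOp n} (hX : IsContinuousOp X) :
    X = opOfMatrix (matrixOf X) hX.isRegularMatrix := by
  have hY := isContinuousOp_opOfMatrix hX.isRegularMatrix
  refine sub_eq_zero.1 ((hX.sub hY).eq_zero fun B => ?_)
  rw [sub_apply, sub_eq_zero]
  ext A
  exact (congrFun (matrixOf_opOfMatrix hX.isRegularMatrix) (A, B)).symm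

/-- The symbol of the operator with a given matrix, as a power series. -/
lemma symbol_opOfMatrix {x : (ℕ →₀ ℕ) × (Fin n → ℕ →₀ ℕ) → ℂ} (hx : IsRegularMatrix x) :
    symbol (opOfMatrix x hx) = series (coeffOfMatrix x) := by
  funext ξ η
  have hreg := (isRegular_coeffOfMatrix_iff x).2 hx
  set f : (ℕ →₀ ℕ) × (Fin n → ℕ →₀ ℕ) → ℂ := fun q =>
    (x q * ∏ i, coherentCoeff (ξ i) (q.2 i)) * (coherentCoeff η q.1 * q.1.degree.factorial) with hf
  have e : ∀ α, coeffOfMatrix x α * monom (join ξ η : Idx n → ℂ) α = f (splitIndex n α) :=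
      fun α => by
    rw [coeffOfMatrix, monom_splitIndex, hf]
    simp only [coherentCoeff_eq, symbolFactor, Finset.prod_mul_distrib, join_none, join_some]
    push_cast
    ring
  have hs : Summable f := by
    rw [← (splitIndex n).summable_iff]
    refine Summable.congr (Summable.of_norm ?_) e
    refine (hreg.summable (join ξ η)).congr fun α => ?_
    rw [norm_mul, norm_monom]
  rw [series, tsum_congr e, (splitIndex n).tsum_eq f, hs.tsum_prod]
  unfold symbol wPair
  refine tsum_congr fun A => ?_
  rw [opOfMatrix_apply, mul_assoc, ← tsum_mul_right]
  rfl

/-- The Taylor coefficients of the symbol of an operator. -/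
def opCoeff (X : MultiOp n) : (Idx n →₀ ℕ) → ℂ := coeffOfMatrix (matrixOf X)

lemma IsContinuousOp.isRegular {X : MultiOp n} (hX : IsContinuousOp X) : IsRegular (opCoeff X) :=
  (isRegular_coeffOfMatrix_iff _).2 hX.isRegularMatrix

lemma IsContinuousOp.symbol_eq {X : MultiOp n} (hX : IsContinuousOp X) :
    symbol X = series (opCoeff X) := by
  conv_lhs => rw [hX.eq_opOfMatrix]
  exact symbol_opOfMatrix _

/-- The operator norm is at most the Hilbert–Schmidt norm. -/
lemma IsContinuousOp.wNorm_sq_le {X : MultiOp n} (hX : IsContinuousOp X) {k C k₂ C₂ : ℝ}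
    (hC : 0 < C) (hk₂ : 0 < k₂) (hC₂ : 0 < C₂)
    (hs : Summable (hsTerm (opCoeff X) (wt n (C ^ 2) k (C₂ ^ 2)⁻¹ (-k₂)))) (φ : Fin n → HidaTest) :
    wNorm k C (X φ) ^ 2 ≤ (∑' α, hsTerm (opCoeff X) (wt n (C ^ 2) k (C₂ ^ 2)⁻¹ (-k₂)) α) *
      ∏ i, wNorm k₂ C₂ (φ i) ^ 2 := by
  have h := wNorm_opOfMatrix_sq_le hX.isRegularMatrix hC hk₂ hC₂
    ((summable_matrixTerm_iff _ hC₂).1 hs) φ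
  rw [← hX.eq_opOfMatrix] at h
  rwa [opCoeff, tsum_matrixTerm _ hC₂]

/-- Every regular family of coefficients comes from a continuous operator. -/
theorem IsRegular.exists_op {c : (Idx n →₀ ℕ) → ℂ} (hc : IsRegular c) :
    ∃ X : MultiOp n, IsContinuousOp X ∧ symbol X = series c := by
  let x : (ℕ →₀ ℕ) × (Fin n → ℕ →₀ ℕ) → ℂ := fun q => c ((splitIndex n).symm q) / symbolFactor q
  have e : coeffOfMatrix x = c := by
    funext α
    have : (symbolFactor (splitIndex n α) : ℂ) ≠ 0 :=
      Complex.ofReal_ne_zero.2 (symbolFactor_pos _).ne'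
    simp only [coeffOfMatrix, x, Equiv.symm_apply_apply]
    field_simp
  have hx : IsRegularMatrix x := (isRegular_coeffOfMatrix_iff x).1 (e ▸ hc)
  exact ⟨opOfMatrix x hx, isContinuousOp_opOfMatrix hx, by rw [symbol_opOfMatrix, e]⟩

end Matrices

/-! ### The characterization of symbols -/

section Characterization

variable {n : ℕ}

lemma sobolev_rpow_nonneg (f : ℕ → ℂ) (k : ℝ) (j : ℕ) : 0 ≤ ‖f j‖ ^ 2 * mu j ^ (2 * k) :=
  mul_nonneg (sq_nonneg _) (Real.rpow_nonneg (mu_pos j).le _)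

lemma hNormSq_nonneg (k : ℝ) (f : ℕ → ℂ) : 0 ≤ hNormSq k f :=
  tsum_nonneg fun j => sobolev_rpow_nonneg f k j

lemma hNormSq_mono {k l : ℝ} (h : k ≤ l) (ξ : TestFun) : hNormSq k ξ ≤ hNormSq l ξ :=
  (summable_testFun ξ k).tsum_le_tsum (fun j => mul_le_mul_of_nonneg_left
    (Real.rpow_le_rpow_of_exponent_le (one_le_mu j) (by linarith)) (sq_nonneg _))
    (summable_testFun ξ l)

lemma GrowthBound.mono {F : (Fin n → TestFun) → TestFun → ℂ} {k K C k₁ K₁ k₁' : ℝ}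
    (h : GrowthBound F k K C k₁ K₁) (hk : k₁ ≤ k₁') (hK₁ : 0 ≤ K₁) :
    GrowthBound F k K C k₁' K₁ := fun ξ η => (h ξ η).trans <| by
  refine mul_le_mul_of_nonneg_left (Real.exp_le_exp.2 ?_) h.nonneg
  have := Finset.sum_le_sum fun (i : Fin n) (_ : i ∈ univ) => hNormSq_mono hk (ξ i)
  gcongr

/-- The symbols of continuous operators satisfy `(O₂)`. -/
lemma IsRegular.hasGaussianGrowth {c : (Idx n →₀ ℕ) → ℂ} (hc : IsRegular c) :
    HasGaussianGrowth (series c) := by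
  intro k K hk hK
  have hC : 0 < (√K)⁻¹ := inv_pos.2 (Real.sqrt_pos.2 hK)
  obtain ⟨k₂, C₂, hk₂, hC₂, hs⟩ := hc k (√K)⁻¹ hk hC
  have h := growthBound_series hC hC₂ hs
  rw [inv_pow, inv_inv, Real.sq_sqrt hK.le] at h
  exact ⟨_, max k₂ (k + 1), C₂ ^ 2, (lt_add_one k).trans_le (le_max_right _ _), by positivity,
    h.mono (le_max_left _ _) (by positivity)⟩

/-- A continuous operator is determined by its symbol. -/
lemma IsContinuousOp.ext_symbol {X Y : MultiOp n} (hX : IsContinuousOp X) (hY : IsContinuousOp Y)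
    (h : symbol X = symbol Y) : X = Y := by
  have h1 : opCoeff X = opCoeff Y := by
    rw [← symbolCoeff_series hX.isRegular, ← symbolCoeff_series hY.isRegular, ← hX.symbol_eq,
      ← hY.symbol_eq, h]
  have h2 : matrixOf X = matrixOf Y := by
    funext q
    have h3 := congrFun h1 ((splitIndex n).symm q)
    simp only [opCoeff, coeffOfMatrix, Equiv.apply_symm_apply] at h3
    exact mul_right_cancel₀ (Complex.ofReal_ne_zero.2 (symbolFactor_pos q).ne') h3
  refine hX.eq_opOfMatrix.trans (Eq.trans ?_ hY.eq_opOfMatrix.symm)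
  congr 1

/-- Every function with `(O₁)` and `(O₂)` is the symbol of exactly one continuous operator. -/
theorem existsUnique_op_of_symbol {F : (Fin n → TestFun) → TestFun → ℂ} (h : IsEntireOnLines F)
    (hF : HasGaussianGrowth F) : ∃! X : MultiOp n, IsContinuousOp X ∧ symbol X = F := by
  obtain ⟨X, hX, hXF⟩ := (isRegular_symbolCoeff h hF).exists_op
  rw [series_symbolCoeff h hF] at hXF
  exact ⟨X, ⟨hX, hXF⟩, fun Y hY => hY.1.ext_symbol hX (hY.2.trans hXF.symm)⟩

/-- The norm of an operator is controlled by the constants in the growth bound of its symbol. -/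
theorem IsContinuousOp.wNorm_sq_le_of_growthBound {X : MultiOp n} (hX : IsContinuousOp X)
    {k C K C₀ k₁ K₁ : ℝ} (hk : 0 < k) (hC : 0 < C) (hK : K = (2 * Real.exp 1 * C ^ 2)⁻¹)
    (hk₁ : k + 1 < k₁) (hK₁ : 0 < K₁) (hF : GrowthBound (symbol X) (k + 1) K C₀ k₁ K₁)
    (φ : Fin n → HidaTest) :
    wNorm k C (X φ) ^ 2 ≤ Real.exp (2 * ∑' p, wt n (1 / 2) (-1) (1 / 2) (-1) p) * C₀ *
      ∏ i, wNorm (k₁ + 1) √(2 * Real.exp 1 * K₁) (φ i) ^ 2 := by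
  have he := Real.exp_pos 1
  have hO₁ : IsEntireOnLines (symbol X) := hX.symbol_eq ▸ isEntireOnLines_series hX.isRegular
  have hc : symbolCoeff (symbol X) = opCoeff X := by
    rw [hX.symbol_eq, symbolCoeff_series hX.isRegular]
  obtain ⟨h1, h2⟩ := hsTerm_symbolCoeff_summable hO₁ hC hK hK₁ hF
  rw [hc] at h1 h2
  refine (hX.wNorm_sq_le hC (by linarith) (Real.sqrt_pos.2 (by positivity)) h1 φ).trans ?_
  rw [mul_comm (Real.exp _)]
  exact mul_le_mul_of_nonneg_right h2 (Finset.prod_nonneg fun i _ => sq_nonneg _)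

end Characterization

/-! ### Multiplication by the exponential of the pairing -/

section Pairing

variable {n : ℕ}

lemma two_mul_norm_mul_le {δ : ℝ} (hδ : 0 < δ) (k : ℝ) (ξ η : ℕ → ℂ) (j : ℕ) :
    2 * ‖ξ j * η j‖ ≤
      δ * (‖η j‖ ^ 2 * mu j ^ (2 * -k)) + δ⁻¹ * (‖ξ j‖ ^ 2 * mu j ^ (2 * k)) := by
  have hm := Real.rpow_pos_of_pos (mu_pos j) k
  rw [norm_mul, mul_comm 2 (-k), mul_comm 2 k, Real.rpow_mul (mu_pos j).le,
    Real.rpow_mul (mu_pos j).le, Real.rpow_neg (mu_pos j).le]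
  simp only [Real.rpow_two]
  set m := mu j ^ k
  have h := two_mul_le_add_sq (√δ * (‖η j‖ * m⁻¹)) ((√δ)⁻¹ * (‖ξ j‖ * m))
  have hs : 0 < √δ := Real.sqrt_pos.2 hδ
  have e : 2 * (√δ * (‖η j‖ * m⁻¹)) * ((√δ)⁻¹ * (‖ξ j‖ * m)) = 2 * (‖ξ j‖ * ‖η j‖) := by
    field_simp
  rw [e] at h
  simp only [mul_pow, inv_pow, Real.sq_sqrt hδ.le] at h
  simpa only [inv_pow] using h

lemma summable_hPair (ξ η : TestFun) : Summable fun j => (ξ : ℕ → ℂ) j * (η : ℕ → ℂ) j := by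
  refine Summable.of_norm_bounded (((summable_testFun η (-0)).mul_left 1).add
    ((summable_testFun ξ 0).mul_left 1⁻¹)) fun j => ?_
  have h := two_mul_norm_mul_le one_pos 0 ξ η j
  have := norm_nonneg ((ξ : ℕ → ℂ) j * (η : ℕ → ℂ) j)
  linarith

/-- The pairing is small against the negative Sobolev norm of one argument, at the cost of the
positive Sobolev norm of the other. -/
lemma two_mul_norm_hPair_le {δ : ℝ} (hδ : 0 < δ) (k : ℝ) (ξ η : TestFun) :
    2 * ‖hPair ξ η‖ ≤ δ * hNormSq (-k) η + δ⁻¹ * hNormSq k ξ := by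
  have hs := (summable_hPair ξ η).norm
  have h1 := ((summable_testFun η (-k)).mul_left δ).add ((summable_testFun ξ k).mul_left δ⁻¹)
  unfold hNormSq
  rw [← tsum_mul_left, ← tsum_mul_left, ← ((summable_testFun η (-k)).mul_left δ).tsum_add
    ((summable_testFun ξ k).mul_left δ⁻¹)]
  refine (mul_le_mul_of_nonneg_left (norm_tsum_le_tsum_norm hs) zero_le_two).trans ?_
  rw [← tsum_mul_left]
  exact (hs.mul_left 2).tsum_le_tsum (fun j => two_mul_norm_mul_le hδ k ξ η j) h1

lemma hPair_lines (ξ₁ ξ₂ η₁ η₂ : TestFun) (z w : ℂ) :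
    hPair (z • ξ₁ + ξ₂) (w • η₁ + η₂) =
      z * w * hPair ξ₁ η₁ + z * hPair ξ₁ η₂ + w * hPair ξ₂ η₁ + hPair ξ₂ η₂ := by
  have h := fun ξ η => (summable_hPair ξ η).hasSum
  refine Eq.trans ?_ (((((h ξ₁ η₁).mul_left (z * w)).add ((h ξ₁ η₂).mul_left z)).add
    ((h ξ₂ η₁).mul_left w)).add (h ξ₂ η₂)).tsum_eq
  refine tsum_congr fun j => ?_
  simp only [Submodule.coe_add, Submodule.coe_smul, Pi.add_apply, Pi.smul_apply, smul_eq_mul]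
  ring

/-- The product of a function with `exp(s ∑_i ⟨ξ^i, η⟩_0)`. -/
def expTwist (s : ℂ) (F : (Fin n → TestFun) → TestFun → ℂ) (ξ : Fin n → TestFun)
    (η : TestFun) : ℂ :=
  Complex.exp (s * ∑ i, hPair (ξ i) η) * F ξ η

lemma IsEntireOnLines.expTwist {F : (Fin n → TestFun) → TestFun → ℂ} (h : IsEntireOnLines F)
    (s : ℂ) : IsEntireOnLines (expTwist s F) := by
  intro ξ₁ ξ₂ η₁ η₂
  refine Differentiable.mul ?_ (h ξ₁ ξ₂ η₁ η₂)
  simp only [hPair_lines]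
  fun_prop

/-- Half of the constant `K` is left to the twist, and distributed over the `n` pairings. -/
lemma GrowthBound.expTwist {F : (Fin n → TestFun) → TestFun → ℂ} {k K C k₁ K₁ : ℝ} (hK : 0 < K)
    (hk : k ≤ k₁) (h : GrowthBound F k (K / 2) C k₁ K₁) {s : ℂ} (hs : ‖s‖ ≤ 1) :
    GrowthBound (expTwist s F) k K C k₁ (K₁ + 2 * (n + 1) / K) := by
  intro ξ η
  have hn : (0 : ℝ) < n + 1 := by positivity
  have h1 : ‖Complex.exp (s * ∑ i, hPair (ξ i) η)‖ ^ 2 ≤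
      Real.exp (2 * (n + 1) / K * ∑ i, hNormSq k₁ (ξ i) + K / 2 * hNormSq (-k) η) := by
    rw [Complex.norm_exp, ← Real.exp_nat_mul]
    refine Real.exp_le_exp.2 ?_
    have h2 : (s * ∑ i, hPair (ξ i) η).re ≤ ∑ i, ‖hPair (ξ i) η‖ :=
      (Complex.re_le_norm _).trans <| by
        rw [norm_mul]
        exact (mul_le_of_le_one_left (norm_nonneg _) hs).trans (norm_sum_le _ _)
    have h3 : ∀ i, 2 * ‖hPair (ξ i) η‖ ≤
        K / (2 * (n + 1)) * hNormSq (-k) η + 2 * (n + 1) / K * hNormSq k₁ (ξ i) := fun i => by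
      have := two_mul_norm_hPair_le (δ := K / (2 * (n + 1))) (by positivity) k (ξ i) η
      rw [inv_div] at this
      refine this.trans ?_
      have := hNormSq_mono hk (ξ i)
      gcongr
    have h4 := Finset.sum_le_sum fun (i : Fin n) (_ : i ∈ univ) => h3 i
    rw [Finset.sum_add_distrib, ← Finset.mul_sum, Finset.sum_const, Finset.card_univ,
      Fintype.card_fin, nsmul_eq_mul, ← Finset.mul_sum (a := 2 * ((n : ℝ) + 1) / K)] at h4
    have h5 : (n : ℝ) * (K / (2 * (n + 1)) * hNormSq (-k) η) ≤ K / 2 * hNormSq (-k) η := by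
      rw [← mul_assoc]
      refine mul_le_mul_of_nonneg_right ?_ (hNormSq_nonneg _ _)
      rw [mul_div_assoc', div_le_div_iff₀ (by positivity) two_pos]
      nlinarith
    push_cast
    linarith
  calc ‖WhiteNoise.expTwist s F ξ η‖ ^ 2
      = ‖Complex.exp (s * ∑ i, hPair (ξ i) η)‖ ^ 2 * ‖F ξ η‖ ^ 2 := by
        rw [WhiteNoise.expTwist, norm_mul, mul_pow]
    _ ≤ Real.exp (2 * (n + 1) / K * ∑ i, hNormSq k₁ (ξ i) + K / 2 * hNormSq (-k) η) *
        (C * Real.exp (K₁ * ∑ i, hNormSq k₁ (ξ i) + K / 2 * hNormSq (-k) η)) :=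
        mul_le_mul h1 (h ξ η) (sq_nonneg _) (Real.exp_pos _).le
    _ = _ := by
        rw [mul_left_comm, ← Real.exp_add]
        congr 2
        ring

lemma HasGaussianGrowth.expTwist {F : (Fin n → TestFun) → TestFun → ℂ} (h : HasGaussianGrowth F)
    {s : ℂ} (hs : ‖s‖ ≤ 1) : HasGaussianGrowth (expTwist s F) := by
  intro k K hk hK
  obtain ⟨C, k₁, K₁, hk₁, hK₁, hF⟩ := h k (K / 2) hk (by positivity)
  exact ⟨C, k₁, _, hk₁, by positivity, hF.expTwist hK hk₁.le hs⟩

lemma reducedSymbol_eq_expTwist (X : MultiOp n) : reducedSymbol X = expTwist (-1) (symbol X) := by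
  funext ξ η
  rw [reducedSymbol, expTwist, neg_one_mul]

lemma expTwist_one_reducedSymbol (X : MultiOp n) : expTwist 1 (reducedSymbol X) = symbol X := by
  funext ξ η
  rw [expTwist, reducedSymbol, one_mul, ← mul_assoc, ← Complex.exp_add, add_neg_cancel,
    Complex.exp_zero, one_mul]

end Pairing

/-! ### Graded polarization -/

section GradedWords

lemma monom_mapDomain {ι κ R : Type*} [CommMonoid R] (π : ι → κ) (r : κ → R) (α : ι →₀ ℕ) :
    monom r (α.mapDomain π) = monom (fun i => r (π i)) α :=
  Finsupp.prod_mapDomain_index (fun _ => pow_zero _) fun _ _ _ => pow_add _ _ _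

/-- Suppose that the letters are graded by `π`, and that the `a`-th argument is the part of `u` of
grade `γ a`. Then the form is a multiple of the part of the power series at `u` with the degrees
prescribed by `γ`: both are the mixed partial derivative of the power series along the linear
combinations of the parts of `u`. -/
lemma wordForm_graded {ι κ : Type*} {T : Type} [Fintype T] [DecidableEq T] [DecidableEq κ]
    {c : (ι →₀ ℕ) → ℂ} {u : ι → ℂ} (π : ι → κ) (γ : T → κ)
    (hc : ∀ R : ℝ, 0 ≤ R → Summable fun α => ‖c α‖ * monom (fun i => R * ‖u i‖) α) :
    wordForm c (fun a i => if π i = γ a then u i else 0) = mfac (letterCount γ) *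
      ∑' α : ι →₀ ℕ, if α.mapDomain π = letterCount γ then c α * monom u α else 0 := by
  set v : T → ι → ℂ := fun a i => if π i = γ a then u i else 0 with hv
  set c' : (κ →₀ ℕ) → ℂ := fun β =>
    ∑' α : ι →₀ ℕ, if α.mapDomain π = β then c α * monom u α else 0 with hc'
  have hN : ∀ {R : ℝ} {y : T → ℝ} {x : ℝ}, 0 ≤ R → (∀ a, y a ≤ x) →
      R * ∑ a, y a ≤ R * Fintype.card T * x := fun {R y x} hR h => by
    have := Finset.sum_le_card_nsmul univ y x fun a _ => h a
    rw [Finset.card_univ, nsmul_eq_mul] at this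
    rw [mul_assoc]
    exact mul_le_mul_of_nonneg_left this hR
  have h1 : ∀ R : ℝ, 0 ≤ R → Summable fun α => ‖c α‖ * monom (fun i => R * ∑ a, ‖v a i‖) α := by
    intro R hR
    have h0 : ∀ i, 0 ≤ R * ∑ a, ‖v a i‖ := fun i => by positivity
    refine Summable.of_nonneg_of_le (fun α => mul_nonneg (norm_nonneg _) (monom_nonneg h0 α))
      (fun α => mul_le_mul_of_nonneg_left (monom_le_monom h0 (fun i => hN hR fun a => ?_) α)
        (norm_nonneg _)) (hc (R * Fintype.card T) (by positivity))
    simp only [hv]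
    split_ifs <;> simp
  have hsum : ∀ z : T → ℂ, Summable fun α => c α * monom (fun i => ∑ a, z a * v a i) α := fun z =>
    Summable.of_norm_bounded (summable_linearForms h1 z) fun α => by rw [norm_mul, norm_monom]
  have h2 : ∀ R : ℝ, 0 ≤ R → Summable fun β => ‖c' β‖ *
      monom (fun k => R * ∑ a, ‖(Pi.single (γ a) 1 : κ → ℂ) k‖) β := by
    intro R hR
    have hR' : 0 ≤ R * Fintype.card T * 1 := by positivity
    have hG := hc _ hR'
    have hG' := (hasSum_fiberwise hG fun α : ι →₀ ℕ => α.mapDomain π).summable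
    have h0 : ∀ k, 0 ≤ R * ∑ a, ‖(Pi.single (γ a) 1 : κ → ℂ) k‖ := fun k => by positivity
    have hu0 : ∀ α, 0 ≤ monom (fun i => ‖u i‖) α := monom_nonneg fun _ => norm_nonneg _
    have hR0 : ∀ β : κ →₀ ℕ, 0 ≤ monom (fun _ => R * Fintype.card T * 1) β :=
      monom_nonneg fun _ => hR'
    refine Summable.of_nonneg_of_le (fun β => mul_nonneg (norm_nonneg _) (monom_nonneg h0 β))
      (fun β => ?_) hG'
    have e : ∀ α : ι →₀ ℕ, (if α.mapDomain π = β then ‖c α‖ *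
        monom (fun i => R * Fintype.card T * 1 * ‖u i‖) α else 0) =
        ‖if α.mapDomain π = β then c α * monom u α else 0‖ *
          monom (fun _ => R * Fintype.card T * 1) β := fun α => by
      split_ifs with h
      · rw [← h, monom_mapDomain, norm_mul, norm_monom, monom_mul]; ring
      · simp
    have hs : Summable fun α : ι →₀ ℕ => ‖if α.mapDomain π = β then c α * monom u α else 0‖ := by
      have h3 := hc 1 zero_le_one
      simp only [one_mul] at h3
      refine Summable.of_nonneg_of_le (fun _ => norm_nonneg _) (fun α => ?_) h3
      split_ifs
      · rw [norm_mul, norm_monom]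
      · rw [norm_zero]; exact mul_nonneg (norm_nonneg _) (hu0 α)
    rw [tsum_congr e, tsum_mul_right]
    refine mul_le_mul (norm_tsum_le_tsum_norm hs) (monom_le_monom h0 (fun k => hN hR fun a => ?_) β)
      (monom_nonneg h0 β) (tsum_nonneg fun _ => norm_nonneg _)
    rw [Pi.single_apply]
    split_ifs <;> simp
  have key : (fun z : T → ℂ => ∑' α, c α * monom (fun i => ∑ a, z a * v a i) α) =
      fun z => ∑' β, c' β * monom (fun k => ∑ a, z a * (Pi.single (γ a) 1 : κ → ℂ) k) β := by
    funext z
    rw [← (hasSum_fiberwise (hsum z) fun α : ι →₀ ℕ => α.mapDomain π).tsum_eq]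
    refine tsum_congr fun β => ?_
    rw [hc', ← tsum_mul_right]
    refine tsum_congr fun α => ?_
    split_ifs with h
    · rw [← h, monom_mapDomain, mul_assoc, ← monom_mul]
      congr 2
      funext i
      rw [mul_sum]
      refine Finset.sum_congr rfl fun a _ => ?_
      simp only [hv, Pi.single_apply]
      split_ifs <;> ring
    · rw [zero_mul]
  rw [← mixedPartial_linearForms h1, key, mixedPartial_linearForms h2, wordForm_single, mul_comm]

end GradedWords

/-! ### Argument slots of the homogeneous forms -/

section Slots

variable {n : ℕ} {l : ℕ} {M : Fin n → ℕ}

/-- The block of an argument slot of a form of order `(l, M)`. -/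
def slotBlock (l : ℕ) (M : Fin n → ℕ) : (Σ i, Fin (M i)) ⊕ Fin l → Option (Fin n) :=
  Sum.elim (fun s => some s.1) fun _ => none

/-- The arrays supported on one block that are put into the argument slots of a form of order
`(l, M)`. -/
def slotFun (ξ : ∀ i, Fin (M i) → TestFun) (η : Fin l → TestFun) :
    (Σ i, Fin (M i)) ⊕ Fin l → RapidFun n :=
  Sum.elim (fun s => join (Pi.single s.1 (ξ s.1 s.2)) 0) fun b => join 0 (η b)

/-- The word of the basis vectors `e_J`, `e_I` in the argument slots. -/
def slotWord (p : (Fin l → ℕ) × (∀ i, Fin (M i) → ℕ)) : (Σ i, Fin (M i)) ⊕ Fin l → Idx n :=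
  Sum.elim (fun s => (some s.1, p.2 s.1 s.2)) fun b => (none, p.1 b)

lemma prod_slots {R : Type*} [CommMonoid R] (g : (Σ i, Fin (M i)) ⊕ Fin l → R) :
    ∏ a, g a = (∏ i, ∏ a, g (Sum.inl ⟨i, a⟩)) * ∏ b, g (Sum.inr b) := by
  rw [Fintype.prod_sum_type, Fintype.prod_sigma]

lemma sum_slots {R : Type*} [AddCommMonoid R] (g : (Σ i, Fin (M i)) ⊕ Fin l → R) :
    ∑ a, g a = (∑ i, ∑ a, g (Sum.inl ⟨i, a⟩)) + ∑ b, g (Sum.inr b) := by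
  rw [Fintype.sum_sum_type, Fintype.sum_sigma]

lemma join_sum_slots (ξ : ∀ i, Fin (M i) → TestFun) (η : Fin l → TestFun)
    (z : (Σ i, Fin (M i)) ⊕ Fin l → ℂ) (p : Idx n) :
    (join (fun i => ∑ a, z (Sum.inl ⟨i, a⟩) • ξ i a) (∑ b, z (Sum.inr b) • η b) : Idx n → ℂ) p =
      ∑ a, z a * (slotFun ξ η a : Idx n → ℂ) p := by
  rw [sum_slots]
  obtain ⟨_ | i, j⟩ := p
  · simp [slotFun]
  · rw [Finset.sum_eq_single i]
    · simp [slotFun]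
    · intro i' _ hi'
      refine Finset.sum_eq_zero fun a _ => ?_
      simp [slotFun, Pi.single_eq_of_ne hi'.symm]
    · simp

lemma slotFun_basisFun (p : (Fin l → ℕ) × (∀ i, Fin (M i) → ℕ)) (a : (Σ i, Fin (M i)) ⊕ Fin l) :
    (slotFun (fun i a => basisFun (p.2 i a)) (fun b => basisFun (p.1 b)) a : Idx n → ℂ) =
      Pi.single (slotWord p a) 1 := by
  funext ⟨o, j⟩
  rcases a with ⟨i, a⟩ | b
  · rcases o with _ | i'
    · simp [slotFun, slotWord]
    · rcases eq_or_ne i' i with rfl | h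
      · simp [slotFun, slotWord, basisFun, Pi.single_apply]
      · simp [slotFun, slotWord, h]
  · rcases o with _ | i'
    · simp [slotFun, slotWord, basisFun, Pi.single_apply]
    · simp [slotFun, slotWord]

lemma slotFun_diag (ξ : Fin n → TestFun) (η : TestFun) (a : (Σ i, Fin (M i)) ⊕ Fin l) (p : Idx n) :
    (slotFun (M := M) (l := l) (fun i _ => ξ i) (fun _ => η) a : Idx n → ℂ) p =
      if p.1 = slotBlock l M a then (join ξ η : Idx n → ℂ) p else 0 := by
  obtain ⟨o, j⟩ := p
  rcases a with ⟨i, a⟩ | b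
  · rcases o with _ | i'
    · simp [slotFun, slotBlock]
    · rcases eq_or_ne i' i with rfl | h
      · simp [slotFun, slotBlock]
      · simp [slotFun, slotBlock, h]
  · rcases o with _ | i'
    · simp [slotFun, slotBlock]
    · simp [slotFun, slotBlock]

lemma slotWord_injective :
    Function.Injective (slotWord : (Fin l → ℕ) × (∀ i, Fin (M i) → ℕ) → _ → Idx n) := by
  rintro ⟨I, J⟩ ⟨I', J'⟩ h
  refine Prod.ext (funext fun b => ?_) (funext fun i => funext fun a => ?_)
  · exact congrArg Prod.snd (congrFun h (Sum.inr b))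
  · exact congrArg Prod.snd (congrFun h (Sum.inl ⟨i, a⟩))

lemma mem_range_slotWord {f : (Σ i, Fin (M i)) ⊕ Fin l → Idx n}
    (h : ∀ a, (f a).1 = slotBlock l M a) :
    f ∈ Set.range (slotWord (l := l) (M := M)) := by
  refine ⟨(fun b => (f (Sum.inr b)).2, fun i a => (f (Sum.inl ⟨i, a⟩)).2), ?_⟩
  funext a
  rcases a with ⟨i, a⟩ | b
  · exact Prod.ext (h (Sum.inl ⟨i, a⟩)).symm rfl
  · exact Prod.ext (h (Sum.inr b)).symm rfl

/-- The degrees `(l, M)` of a multi-index on arrays in the `η`-block and in the `ξ`-blocks. -/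
def multiOrder (α : Idx n →₀ ℕ) : ℕ × (Fin n → ℕ) :=
  (α.mapDomain Prod.fst none, fun i => α.mapDomain Prod.fst (some i))

lemma letterCount_slotBlock_none : letterCount (slotBlock l M) none = l := by
  rw [letterCount, Finsupp.finsetSum_apply, sum_slots]
  simp [slotBlock]

lemma letterCount_slotBlock_some (i : Fin n) : letterCount (slotBlock l M) (some i) = M i := by
  rw [letterCount, Finsupp.finsetSum_apply, sum_slots]
  simp [slotBlock, Finsupp.single_apply]

lemma mapDomain_eq_letterCount_iff (α : Idx n →₀ ℕ) :
    α.mapDomain Prod.fst = letterCount (slotBlock l M) ↔ multiOrder α = (l, M) := by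
  constructor
  · intro h
    refine Prod.ext ?_ (funext fun i => ?_)
    · exact (DFunLike.congr_fun h none).trans letterCount_slotBlock_none
    · exact (DFunLike.congr_fun h (some i)).trans (letterCount_slotBlock_some i)
  · intro h
    ext o
    rcases o with _ | i
    · exact (congrArg Prod.fst h).trans letterCount_slotBlock_none.symm
    · exact (congrFun (congrArg Prod.snd h) i).trans (letterCount_slotBlock_some i).symm

lemma mfac_letterCount_slotBlock :
    mfac (letterCount (slotBlock l M)) = l.factorial * ∏ i, ((M i).factorial : ℝ) := by
  rw [mfac, Finsupp.prod_fintype _ _ (fun _ => by simp), Fintype.prod_option]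
  simp only [letterCount_slotBlock_none, letterCount_slotBlock_some]

end Slots

/-! ### The Fock expansion -/

section FockExpansion

variable {n : ℕ}

/-- The Taylor coefficients of `Ψ = exp(-∑_i ⟨ξ^i, η⟩_0) Ξ̂`. -/
def reducedCoeff (X : MultiOp n) : (Idx n →₀ ℕ) → ℂ := symbolCoeff (reducedSymbol X)

lemma IsContinuousOp.isRegular_reducedCoeff {X : MultiOp n} (hX : IsContinuousOp X) :
    IsRegular (reducedCoeff X) ∧ series (reducedCoeff X) = reducedSymbol X := by
  have h1 : IsEntireOnLines (reducedSymbol X) := by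
    rw [reducedSymbol_eq_expTwist, hX.symbol_eq]
    exact (isEntireOnLines_series hX.isRegular).expTwist _
  have h2 : HasGaussianGrowth (reducedSymbol X) := by
    rw [reducedSymbol_eq_expTwist, hX.symbol_eq]
    exact hX.isRegular.hasGaussianGrowth.expTwist (by simp)
  exact ⟨isRegular_symbolCoeff h1 h2, series_symbolCoeff h1 h2⟩

/-- The polarizations of the homogeneous parts of `Ψ` are its mixed partial derivatives. -/
lemma IsContinuousOp.fockForm_eq {X : MultiOp n} (hX : IsContinuousOp X) (l : ℕ) (M : Fin n → ℕ)
    (ξ : ∀ i, Fin (M i) → TestFun) (η : Fin l → TestFun) :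
    fockForm X l M ξ η = ((l.factorial : ℂ) * ∏ i, ((M i).factorial : ℂ))⁻¹ *
      wordForm (reducedCoeff X) fun a => (slotFun ξ η a : Idx n → ℂ) := by
  obtain ⟨h1, h2⟩ := hX.isRegular_reducedCoeff
  rw [fockForm, ← mixedPartial_linearForms (h1.summable_linearForms (slotFun ξ η)), ← h2]
  simp only [series]
  congr 2
  funext z
  refine tsum_congr fun α => ?_
  congr 2
  funext p
  exact join_sum_slots ξ η z p

lemma IsContinuousOp.fockKernel_eq {X : MultiOp n} (hX : IsContinuousOp X) (l : ℕ) (M : Fin n → ℕ)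
    (p : (Fin l → ℕ) × (∀ i, Fin (M i) → ℕ)) :
    fockKernel X l M p = ((l.factorial : ℂ) * ∏ i, ((M i).factorial : ℂ))⁻¹ *
      (reducedCoeff X (letterCount (slotWord p)) * mfac (letterCount (slotWord p))) := by
  rw [fockKernel, hX.fockForm_eq]
  simp only [slotFun_basisFun, wordForm_single]

/-- The form `K_{l,M}` on the diagonal is the value of its kernel. -/
lemma IsContinuousOp.kernelEval_fockKernel {X : MultiOp n} (hX : IsContinuousOp X) (l : ℕ)
    (M : Fin n → ℕ) (ξ : Fin n → TestFun) (η : TestFun) :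
    kernelEval (fockKernel X l M) ξ η = fockForm X l M (fun i _ => ξ i) (fun _ => η) := by
  rw [hX.fockForm_eq, wordForm, kernelEval]
  rw [← (slotWord_injective (l := l) (M := M)).tsum_eq, ← tsum_mul_left]
  · refine tsum_congr fun p => ?_
    rw [hX.fockKernel_eq, prod_slots]
    simp only [slotFun_diag]
    simp only [slotWord, slotBlock, Sum.elim_inl, Sum.elim_inr, if_true, join_none, join_some]
    ring
  · intro f hf
    refine mem_range_slotWord fun a => ?_
    by_contra hne
    refine hf ?_
    change _ * ∏ a, _ = (0 : ℂ)
    rw [Finset.prod_eq_zero (mem_univ a), mul_zero]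
    rw [slotFun_diag, if_neg hne]

/-- The part of a family of coefficients whose degrees in the blocks lie in `P`. -/
def gradedPart (c : (Idx n →₀ ℕ) → ℂ) (P : Set (ℕ × (Fin n → ℕ))) : (Idx n →₀ ℕ) → ℂ :=
  {α | multiOrder α ∈ P}.indicator c

lemma hsTerm_gradedPart (c : (Idx n →₀ ℕ) → ℂ) (P : Set (ℕ × (Fin n → ℕ))) (s : Idx n → ℝ) :
    hsTerm (gradedPart c P) s = {α | multiOrder α ∈ P}.indicator (hsTerm c s) := by
  funext α
  by_cases h : multiOrder α ∈ P <;> simp [hsTerm, gradedPart, h]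

lemma IsRegular.gradedPart {c : (Idx n →₀ ℕ) → ℂ} (hc : IsRegular c) (P : Set (ℕ × (Fin n → ℕ))) :
    IsRegular (gradedPart c P) := by
  intro k C hk hC
  obtain ⟨k₂, C₂, hk₂, hC₂, hs⟩ := hc k C hk hC
  exact ⟨k₂, C₂, hk₂, hC₂, by rw [hsTerm_gradedPart]; exact hs.indicator _⟩

/-- The form `K_{l,M}` on the diagonal is the homogeneous part of `Ψ` of order `(l, M)`. -/
lemma IsContinuousOp.fockForm_diag {X : MultiOp n} (hX : IsContinuousOp X) (l : ℕ)
    (M : Fin n → ℕ) (ξ : Fin n → TestFun) (η : TestFun) :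
    fockForm X l M (fun i _ => ξ i) (fun _ => η) =
      series (gradedPart (reducedCoeff X) {(l, M)}) ξ η := by
  have hc : ∀ R : ℝ, 0 ≤ R → Summable fun α => ‖reducedCoeff X α‖ *
      monom (fun p => R * ‖(join ξ η : Idx n → ℂ) p‖) α := fun R hR => by
    simpa using hX.isRegular_reducedCoeff.1.summable_linearForms (fun _ : Unit => join ξ η) R hR
  have h := wordForm_graded (c := reducedCoeff X) (u := (join ξ η : Idx n → ℂ)) Prod.fst
    (slotBlock l M) hc
  have e : (fun a => (slotFun (M := M) (l := l) (fun i _ => ξ i) (fun _ => η) a : Idx n → ℂ)) =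
      fun a p => if p.1 = slotBlock l M a then (join ξ η : Idx n → ℂ) p else 0 :=
    funext fun a => funext fun p => slotFun_diag ξ η a p
  rw [hX.fockForm_eq, e, h, mfac_letterCount_slotBlock, ← mul_assoc]
  push_cast
  rw [inv_mul_cancel₀, one_mul, series]
  · refine tsum_congr fun α => ?_
    simp only [mapDomain_eq_letterCount_iff, gradedPart, Set.indicator_apply, Set.mem_ofPred_eq,
      Set.mem_singleton_iff, ite_mul, zero_mul]
  · exact mul_ne_zero (Nat.cast_ne_zero.2 (Nat.factorial_ne_zero _))
      (Finset.prod_ne_zero_iff.2 fun i _ => Nat.cast_ne_zero.2 (Nat.factorial_ne_zero _))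

/-- Kernels of continuous operators are regular. Up to constants, `|κ_{I,J}|²` is `(α!)² |c_α|²` for
the multi-index `α` of the word `(I, J)`, and the number of words with this multi-index is at most a
constant times `1 / α!`, so the sum is dominated by the weighted `ℓ²` norm of the Taylor
coefficients. -/
lemma IsContinuousOp.isRegularKernel_fockKernel {X : MultiOp n} (hX : IsContinuousOp X) (l : ℕ)
    (M : Fin n → ℕ) : IsRegularKernel (fockKernel X l M) := by
  intro k' hk'
  obtain ⟨k₂, C₂, hk₂, hC₂, hs⟩ :=
    hX.isRegular_reducedCoeff.1 (k' / 2) 1 (by positivity) one_pos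
  set c := reducedCoeff X
  set w := wt n (1 ^ 2) (k' / 2) (C₂ ^ 2)⁻¹ (-k₂)
  have hw : ∀ p, 0 < w p := fun p => wt_pos (by positivity) (by positivity) _ _ p
  refine ⟨2 * k₂, by positivity, ?_⟩
  have h1 : Summable fun f : (Σ i, Fin (M i)) ⊕ Fin l → Idx n =>
      hsTerm c w (letterCount f) * mfac (letterCount f) := by
    refine (summable_words (𝕜 := ℝ) (h := fun α => hsTerm c w α * mfac α) ?_).1
    refine Summable.of_nonneg_of_le (fun α => ?_) (fun α => ?_) hs
    · split_ifs
      · exact div_nonneg (norm_nonneg _) (mfac_pos α).le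
      · exact le_rfl
    · have h0 := hsTerm_nonneg c hw α
      split_ifs
      · rw [norm_mul, Real.norm_of_nonneg h0, Real.norm_of_nonneg (mfac_pos α).le,
          mul_div_cancel_right₀ _ (mfac_pos α).ne']
      · exact h0
  have h2 := (h1.comp_injective (slotWord_injective (l := l) (M := M))).mul_left
    (‖((l.factorial : ℂ) * ∏ i, ((M i).factorial : ℂ))⁻¹‖ ^ 2 * ∏ i, ∏ _a : Fin (M i), C₂ ^ 2)
  refine h2.congr fun p => ?_
  have e1 : (∏ b, mu (p.1 b)) ^ k' = ∏ b, w (none, p.1 b) := by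
    rw [← Real.finsetProd_rpow _ _ fun b _ => (mu_pos _).le]
    refine Finset.prod_congr rfl fun b _ => ?_
    simp only [w, wt, Option.elim_none]
    rw [one_pow, one_mul]; congr 1; ring
  have e2 : (∏ i, ∏ a, mu (p.2 i a)) ^ (-(2 * k₂)) =
      (∏ i, ∏ _a : Fin (M i), C₂ ^ 2) * ∏ i, ∏ a, w (some i, p.2 i a) := by
    rw [← Real.finsetProd_rpow _ _ fun i _ => Finset.prod_nonneg fun a _ => (mu_pos _).le,
      ← Finset.prod_mul_distrib]
    refine Finset.prod_congr rfl fun i _ => ?_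
    rw [← Real.finsetProd_rpow _ _ fun a _ => (mu_pos _).le, ← Finset.prod_mul_distrib]
    refine Finset.prod_congr rfl fun a _ => ?_
    simp only [w, wt, Option.elim_some]
    rw [mul_inv_cancel_left₀ (by positivity)]; congr 1; ring
  rw [hX.fockKernel_eq, e1, e2, norm_mul, norm_mul, Complex.norm_real,
    Real.norm_of_nonneg (mfac_pos _).le]
  simp only [Function.comp_apply, hsTerm, monom_letterCount]
  rw [prod_slots]
  simp only [slotWord, Sum.elim_inl, Sum.elim_inr]
  ring

/-- The operators with the symbols `exp(∑_i ⟨ξ^i, η⟩_0) Ψ_{l,M}`, where `Ψ_{l,M}` is the homogeneous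
part of `Ψ`, are the components of the Fock expansion. -/
lemma IsContinuousOp.isFockComponent {X Y : MultiOp n} (hX : IsContinuousOp X)
    (hY : IsContinuousOp Y) {l : ℕ} {M : Fin n → ℕ}
    (h : symbol Y = expTwist 1 (series (gradedPart (reducedCoeff X) {(l, M)}))) :
    IsFockComponent X l M Y := by
  have h1 : ∀ ξ η, symbol Y ξ η =
      fockForm X l M (fun i _ => ξ i) (fun _ => η) * expPair ξ η := fun ξ η => by
    rw [h, hX.fockForm_diag, expTwist, expPair, one_mul, mul_comm]
  refine ⟨⟨hY, hX.isRegularKernel_fockKernel l M, fun ξ η => ?_⟩, h1⟩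
  rw [h1, hX.kernelEval_fockKernel]

lemma series_sub_sum_gradedPart {c : (Idx n →₀ ℕ) → ℂ} (hc : IsRegular c)
    (S : Finset (ℕ × (Fin n → ℕ))) (ξ : Fin n → TestFun) (η : TestFun) :
    series c ξ η - ∑ j ∈ S, series (gradedPart c {j}) ξ η = series (gradedPart c (↑S)ᶜ) ξ η := by
  have hs : ∀ P, Summable fun α => gradedPart c P α * monom (join ξ η : Idx n → ℂ) α := fun P =>
    Summable.of_norm <| ((hc.gradedPart P).summable (join ξ η)).congr fun α => by
      rw [norm_mul, norm_monom]
  have hs' : Summable fun α => c α * monom (join ξ η : Idx n → ℂ) α :=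
    Summable.of_norm <| (hc.summable (join ξ η)).congr fun α => by rw [norm_mul, norm_monom]
  unfold series
  rw [← Summable.tsum_finsetSum fun j _ => hs {j}, ← hs'.tsum_sub (summable_sum fun j _ => hs {j})]
  refine tsum_congr fun α => ?_
  rw [← Finset.sum_mul, ← sub_mul]
  congr 1
  simp only [gradedPart, Set.indicator_apply, Set.mem_ofPred_eq, Set.mem_singleton_iff,
    Finset.sum_ite_eq, Set.mem_compl_iff, Finset.mem_coe]
  by_cases h : multiOrder α ∈ S <;> simp [h]

/-- The tails of the weighted `ℓ²` norm vanish. -/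
lemma exists_tsum_hsTerm_gradedPart_le {c : (Idx n →₀ ℕ) → ℂ} {s : Idx n → ℝ} (hs : ∀ p, 0 < s p)
    (hc : Summable (hsTerm c s)) {ε : ℝ} (hε : 0 < ε) :
    ∃ S₀ : Finset (ℕ × (Fin n → ℕ)), ∀ S, S₀ ⊆ S →
      ∑' α, hsTerm (gradedPart c (↑S)ᶜ) s α ≤ ε := by
  classical
  obtain ⟨A, hA⟩ := ((tendsto_order.1 (tendsto_tsum_compl_atTop_zero (hsTerm c s))).2 ε hε).exists
  refine ⟨A.image multiOrder, fun S hS => le_trans ?_ hA.le⟩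
  have hsub : {α : Idx n →₀ ℕ | multiOrder α ∈ (↑S : Set (ℕ × (Fin n → ℕ)))ᶜ} ⊆ {α | α ∉ A} :=
    fun α hα hαA => hα (hS (Finset.mem_image_of_mem _ hαA))
  rw [hsTerm_gradedPart]
  refine le_trans ?_ (tsum_subtype {α | α ∉ A} (hsTerm c s)).ge
  refine (hc.indicator _).tsum_le_tsum (fun α => ?_) (hc.indicator _)
  exact Set.indicator_le_indicator_of_subset hsub (fun α => hsTerm_nonneg c hs α) α

/-- Unconditional convergence of the Fock expansion: the symbols of the remainders satisfy a common
growth bound with constants that tend to zero. -/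
lemma IsContinuousOp.hasOpSum {X : MultiOp n} (hX : IsContinuousOp X)
    {Y : ℕ × (Fin n → ℕ) → MultiOp n} (hY : ∀ j, IsContinuousOp (Y j))
    (hYs : ∀ j, symbol (Y j) = expTwist 1 (series (gradedPart (reducedCoeff X) {j}))) :
    HasOpSum Y X := by
  intro k C hk hC
  have he := Real.exp_pos 1
  set K : ℝ := (2 * Real.exp 1 * C ^ 2)⁻¹ with hK
  have hK0 : 0 < K := by positivity
  -- With this `C'` the weighted `ℓ²` norm of the coefficients of `Ψ` is a growth constant for
  -- `K / 2`; multiplication by `exp(∑_i ⟨ξ^i, η⟩_0)` uses up the other half of `K`.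
  set C' : ℝ := (√(K / 2))⁻¹ with hC'
  have hC'0 : 0 < C' := inv_pos.2 (Real.sqrt_pos.2 (by positivity))
  have hC'K : (C' ^ 2)⁻¹ = K / 2 := by
    rw [hC', inv_pow, inv_inv, Real.sq_sqrt (by positivity)]
  obtain ⟨hc, hcs⟩ := hX.isRegular_reducedCoeff
  obtain ⟨k₂, C₂, hk₂, hC₂, hs⟩ := hc (k + 1) C' (by linarith) hC'0
  set k₁ := max k₂ (k + 2)
  have hk₁ : k + 1 < k₁ := (by linarith : k + 1 < k + 2).trans_le (le_max_right _ _)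
  set K₁ : ℝ := C₂ ^ 2 + 2 * (n + 1) / K
  have hK₁ : 0 < K₁ := by positivity
  set B := Real.exp (2 * ∑' p, wt n (1 / 2) (-1) (1 / 2) (-1) p) with hB
  have hB0 : 0 < B := Real.exp_pos _
  refine ⟨k₁ + 1, √(2 * Real.exp 1 * K₁), by linarith, Real.sqrt_pos.2 (by positivity),
    fun ε hε => ?_⟩
  obtain ⟨S₀, hS₀⟩ := exists_tsum_hsTerm_gradedPart_le
    (fun p => wt_pos (by positivity) (by positivity) _ _ p) hs (ε := ε ^ 2 / B) (by positivity)
  refine ⟨S₀, fun S hS φ => ?_⟩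
  have hD : IsContinuousOp (X - ∑ j ∈ S, Y j) := hX.sub (IsContinuousOp.sum hY S)
  have hDs : symbol (X - ∑ j ∈ S, Y j) =
      expTwist 1 (series (gradedPart (reducedCoeff X) (↑S)ᶜ)) := by
    funext ξ η
    rw [symbol_sub, symbol_sum, ← expTwist_one_reducedSymbol, ← hcs]
    simp only [hYs, expTwist]
    rw [← Finset.mul_sum, ← mul_sub, series_sub_sum_gradedPart hc]
  have hs' : Summable (hsTerm (gradedPart (reducedCoeff X) (↑S)ᶜ)
      (wt n (C' ^ 2) (k + 1) (C₂ ^ 2)⁻¹ (-k₂))) := by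
    rw [hsTerm_gradedPart]; exact hs.indicator _
  have hG := (growthBound_series hC'0 hC₂ hs').mono (le_max_left k₂ (k + 2)) (by positivity)
  rw [hC'K] at hG
  have h1 := hD.wNorm_sq_le_of_growthBound hk hC hK hk₁ hK₁
    (hDs ▸ hG.expTwist hK0 hk₁.le (by simp)) φ
  rw [Finset.prod_pow] at h1
  refine le_of_sq_le_sq (h1.trans ?_) (mul_nonneg hε.le
    (Finset.prod_nonneg fun i _ => wNorm_nonneg _ _ _))
  rw [mul_pow]
  refine mul_le_mul_of_nonneg_right ?_ (sq_nonneg _)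
  have h2 := mul_le_mul_of_nonneg_left (hS₀ S hS) hB0.le
  rwa [mul_div_cancel₀ _ hB0.ne'] at h2

/-- The Fock expansion of a continuous operator. -/
theorem IsContinuousOp.exists_fockExpansion {X : MultiOp n} (hX : IsContinuousOp X) :
    ∃ Y : ℕ × (Fin n → ℕ) → MultiOp n,
      (∀ l M, IsFockComponent X l M (Y (l, M))) ∧ HasOpSum Y X := by
  have h : ∀ j, ∃ Y : MultiOp n, IsContinuousOp Y ∧
      symbol Y = expTwist 1 (series (gradedPart (reducedCoeff X) {j})) := fun j => by
    have hj := hX.isRegular_reducedCoeff.1.gradedPart {j}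
    exact (existsUnique_op_of_symbol ((isEntireOnLines_series hj).expTwist 1)
      (hj.hasGaussianGrowth.expTwist (by simp))).exists
  choose Y hY hYs using h
  exact ⟨Y, fun l M => hX.isFockComponent (hY (l, M)) (hYs (l, M)), hX.hasOpSum hY hYs⟩

end FockExpansion

end

end WhiteNoise

theorem theorem2 (n : ℕ) :
    -- a function with `(O₁)` and `(O₂)` is the symbol of a (unique) continuous operator
    (∀ F : (Fin n → WhiteNoise.TestFun) → WhiteNoise.TestFun → ℂ,
      WhiteNoise.IsEntireOnLines F → WhiteNoise.HasGaussianGrowth F →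
        ∃! X : WhiteNoise.MultiOp n, WhiteNoise.IsContinuousOp X ∧ WhiteNoise.symbol X = F) ∧
    -- the moduli of continuity are controlled by the constants in `(O₂)` only
    (∀ k C : ℝ, 0 < k → 0 < C → ∃ k' K : ℝ, 0 < k' ∧ 0 < K ∧
      ∀ k₁ K₁ : ℝ, k' < k₁ → 0 < K₁ → ∃ k₂ C₂ B : ℝ, 0 < k₂ ∧ 0 < C₂ ∧ 0 < B ∧
        ∀ X : WhiteNoise.MultiOp n, WhiteNoise.IsContinuousOp X →
          ∀ C₀ : ℝ, WhiteNoise.GrowthBound (WhiteNoise.symbol X) k' K C₀ k₁ K₁ →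
            ∀ φ : Fin n → WhiteNoise.HidaTest,
              WhiteNoise.wNorm k C (X φ) ^ 2 ≤
                B * C₀ * ∏ i, WhiteNoise.wNorm k₂ C₂ (φ i) ^ 2) ∧
    -- every continuous operator has a convergent Fock expansion
    (∀ X : WhiteNoise.MultiOp n, WhiteNoise.IsContinuousOp X →
      ∃ Y : ℕ × (Fin n → ℕ) → WhiteNoise.MultiOp n,
        (∀ l M, WhiteNoise.IsFockComponent X l M (Y (l, M))) ∧ WhiteNoise.HasOpSum Y X) := by
  refine ⟨fun F h hF => WhiteNoise.existsUnique_op_of_symbol h hF, fun k C hk hC => ?_,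
    fun X hX => hX.exists_fockExpansion⟩
  have he := Real.exp_pos 1
  refine ⟨k + 1, (2 * Real.exp 1 * C ^ 2)⁻¹, by linarith, by positivity, fun k₁ K₁ hk₁ hK₁ => ?_⟩
  exact ⟨k₁ + 1, √(2 * Real.exp 1 * K₁), _, by linarith, Real.sqrt_pos.2 (by positivity),
    Real.exp_pos _, fun X hX C₀ hF φ => hX.wNorm_sq_le_of_growthBound hk hC rfl hk₁ hK₁ hF φ⟩
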